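/- Let $\mathcal W_1$ be a finite alphabet and $\Sigma^+\subset\mathcal W_1^{\mathbb N}$ a one-sided Markov shift (a compact one), with shift $\sigma$. A word $w$ is admissible if its cylinder $[w]\subset\Sigma^+$ is non-empty, and $\mathcal W_n^{A,a}$ is the set of admissible words of length $n$ with first letter $A$ and last letter $a$. Let $R:\Sigma^+\to(0,\infty)$ be such that, for some $\theta\in(0,1)$ and $K\ge 0$, $|\log R(y)-\log R(z)|\le K\theta^n$ whenever $n>1$ and $y,z\in\Sigma^+$ have the same first $n$ letters; put $R_n=\prod_{i<n}R\circ\sigma^i$. Let $G$ be a countable discrete group, $\mathfrak s:\mathcal W_1\to G$, $\underline{\mathfrak s}(w_1\cdots w_n)=\mathfrak s(w_1)\cdots\mathfrak s(w_n)$, and assume that the skew product $T_{\mathfrak s}(y,g)=(\sigma y,\mathfrak s(y_0)^{-1}g)$ on $\Sigma^+\times G$ is topologically transitive. Let $\rho$ be a countable direct sum of quotient representations of $G$ in $\mathcal H=\bigoplus_i\ell^2(G/K_i,\mathbb R)$ ($K_i\le G$), and let $0\ne f\in\mathcal H$ be a non-negative function. Fix $A,a\in\mathcal W_1$ with $[A]\neq\emptyset$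 and $x\in\sigma[a]$. For $c:\mathbb N\to(0,\infty)$, $t>0$ and $N\in\mathbb N$ set $$\phi_{c;\le N}[t](g)=\sum_{n=1}^N t^{-n}c_n\sum_{w\in\mathcal W_n^{A,a}:\,\underline{\mathfrak s}(w)=g}R_n(wx),\qquad \phi^*(g)=\phi(g^{-1}),\qquad \phi\ast_\rho f=\sum_{h\in G}\phi(h)\rho(h)f,$$ write $\phi_{\le N}[t]$ for $c\equiv1$, and let $$\gamma(f)=\inf\Big\{t>0:\ \sup_N\sum_{h\in G}\phi_{\le N}[t](h)\,\langle\rho(h)f,f\rangle<\infty\Big\}.$$ Call $c$ slowly increasing if it is positive and non-decreasing, $c_n\to\infty$, and $c_{n+k}/c_n\to1$ as $n\to\infty$ for every $k$. For a word $w$ let $w\wedge x$ be the length of the longest common prefix of $w$ and $x$. Then there are a slowly increasing $c$ and a sequence $t_k>\gamma(f)$ with $t_k\to\gamma(f)$ such that the function $\Upsilon_{c,\ast}:G\to\mathbb R$, $$\Upsilon_{c,\ast}(g)=\limsup_{k\to\infty}\lim_{N\to\infty}\frac{\langle\rho(g)(\phi_{c;\le N}[t_k]\ast_\rho f),\ \phi^*_{c;\le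 N}[t_k]\ast_\rho f\rangle}{\langle\phi_{c;\le N}[t_k]\ast_\rho f,\ \phi^*_{c;\le N}[t_k]\ast_\rho f\rangle},$$ is well defined (for each $k$ the denominators are positive for all large $N$, the inner limits exist, and for each $g$ they are bounded in $k$), and there are a finite $\sigma$-invariant Borel measure $\mu$ on $\Sigma^+$ and a constant $C>1$ such that: (i) for every word $w$ (of any length $n\ge0$) for which $awA$ is admissible, $$C^{-\theta^{w\wedge x}}\,\Upsilon_{c,\ast}(\underline{\mathfrak s}(w))\ \le\ \gamma(f)^n\int_{[awA]}(R_n\circ\sigma)^{-1}\,d\mu\ \le\ C^{\theta^{w\wedge x}}\,\Upsilon_{c,\ast}(\underline{\mathfrak s}(w));$$ (ii) for every admissible word $w$ of length $n\ge1$, $$C^{-1}\,\Upsilon_{c,\ast}(\underline{\mathfrak s}(w))\ \le\ \gamma(f)^n\int_{[w]}R_n^{-1}\,d\mu\ \le\ C\,\Upsilon_{c,\ast}(\underline{\mathfrak s}(w)).$$ -/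

import Mathlib

open Filter Topology MeasureTheory

noncomputable section

namespace ThermoDensity

/-! ### One-sided Markov shifts -/

section Shift

variable {S : Type*}

/-- The left shift `σ` on one-sided sequences. -/
def shift (y : ℕ → S) : ℕ → S := fun i => y (i + 1)

/-- The one-sided Markov shift `Σ⁺` with transition relation `τ`, as a set of sequences. -/
def markovShift (τ : S → S → Prop) : Set (ℕ → S) := {y | ∀ i, τ (y i) (y (i + 1))}

/-- The set of sequences that begin with the word `w`. -/
def cyl (w : List S) : Set (ℕ → S) := {y | ∀ (i : ℕ) (h : i < w.length), y i = w[i]}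

/-- The concatenation `w y` of a finite word and a one-sided sequence. -/
def concat : List S → (ℕ → S) → ℕ → S
  | [], y => y
  | b :: w, y => fun i => Nat.casesOn i b (fun j => concat w y j)

/-- A word is admissible if it occurs in a point of `Σ⁺`; since `Σ⁺` is mapped into itself by the
shift, this means that its cylinder in `Σ⁺` is not empty. -/
def Admissible (τ : S → S → Prop) (w : List S) : Prop := (cyl w ∩ markovShift τ).Nonempty

open Classical in
/-- `w ∧ x`: the length of the longest common prefix of the word `w` and the sequence `x`. -/
def wedge : List S → (ℕ → S) → ℕ
  | [], _ => 0
  | b :: w, x => if b = x 0 then wedge w (shift x) + 1 else 0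

/-- The multiplicative Birkhoff product `R_n(y) = R(y) R(σ y) ⋯ R(σ^{n-1} y)`. -/
def birkhoffProd (R : (ℕ → S) → ℝ) (n : ℕ) (y : ℕ → S) : ℝ :=
  ∏ i ∈ Finset.range n, R (shift^[i] y)

/-- `log R` is locally Hölder on `Σ⁺` with parameter `θ`: `Var_n (log R) ≤ K θ^n` for `n > 1`. -/
def LogHolder (τ : S → S → Prop) (R : (ℕ → S) → ℝ) (θ : ℝ) : Prop :=
  ∃ K : ℝ, ∀ n : ℕ, 1 < n → ∀ y ∈ markovShift τ, ∀ z ∈ markovShift τ,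
    (∀ i < n, y i = z i) → |Real.log (R y) - Real.log (R z)| ≤ K * θ ^ n

open Classical in
/-- The finite set `𝒲_n^{A,a}` of admissible words of length `n` with first letter `A` and last
letter `a`. -/
def wordsBetween [Finite S] (τ : S → S → Prop) (A a : S) (n : ℕ) : Finset (List S) :=
  (List.finite_length_eq S n).toFinset.filter
    fun w => Admissible τ w ∧ w.head? = some A ∧ w.getLast? = some a

end Shift

/-! ### Skew products -/

section Skew

variable {S G : Type*} [Group G]

/-- `𝔰(w) = 𝔰(w₁) ⋯ 𝔰(w_n)`. -/
def wordProd (s : S → G) (w : List S) : G := (w.map s).prod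

/-- The skew product `T_𝔰 (y, g) = (σ y, 𝔰(y₀)⁻¹ g)`. -/
def skewProduct (s : S → G) (p : (ℕ → S) × G) : (ℕ → S) × G :=
  (shift p.1, (s (p.1 0))⁻¹ * p.2)

/-- Topological transitivity of the restriction of `T` to a set `X` (with its subspace topology)
that `T` maps into itself. -/
def TransitiveOn {Z : Type*} [TopologicalSpace Z] (T : Z → Z) (X : Set Z) : Prop :=
  ∀ U V : Set Z, IsOpen U → IsOpen V → (U ∩ X).Nonempty → (V ∩ X).Nonempty →
    ∃ n : ℕ, (T^[n] '' (U ∩ X) ∩ V).Nonempty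

end Skew

/-! ### Sums of quotient representations -/

section Rep

variable {G : Type*} [Group G]

/-- The real Hilbert space `ℓ²(X)`. -/
abbrev Ell2 (X : Type*) := lp (fun _ : X => ℝ) 2

variable {X : Type*} [MulAction G X]

theorem memlp_smul (g : G) (f : Ell2 X) :
    Memℓp (fun p : X => (f : X → ℝ) (g⁻¹ • p)) 2 := by
  have h2 : 0 < (2 : ENNReal).toReal := by norm_num
  have hf := (memℓp_gen_iff h2).1 (lp.memℓp f)
  exact (memℓp_gen_iff h2).2 ((MulAction.toPerm (α := G) (β := X) g⁻¹).summable_iff.2 hf)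

/-- Translation by `g` on `ℓ²(X)`: `(ρ(g) f)(p) = f(g⁻¹ p)`. -/
def translate (g : G) (f : Ell2 X) : Ell2 X := ⟨fun p => (f : X → ℝ) (g⁻¹ • p), memlp_smul g f⟩

theorem translate_apply (g : G) (f : Ell2 X) (p : X) :
    (translate g f : X → ℝ) p = (f : X → ℝ) (g⁻¹ • p) := rfl

theorem norm_translate (g : G) (f : Ell2 X) : ‖translate g f‖ = ‖f‖ := by
  have h2 : 0 < (2 : ENNReal).toReal := by norm_num
  rw [lp.norm_eq_tsum_rpow h2, lp.norm_eq_tsum_rpow h2]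
  congr 1
  exact (MulAction.toPerm (α := G) (β := X) g⁻¹).tsum_eq
    (fun p => ‖(f : X → ℝ) p‖ ^ (2 : ENNReal).toReal)

/-- The orthogonal (real unitary) representation of `G` in `ℓ²(X)` that permutes the standard
orthonormal basis. -/
def permRep : G →* (Ell2 X ≃ₗᵢ[ℝ] Ell2 X) where
  toFun g :=
    { toFun := translate g
      invFun := translate g⁻¹
      map_add' := fun _ _ => rfl
      map_smul' := fun _ _ => rfl
      left_inv := fun f => by
        refine lp.ext (funext fun p => ?_)
        simp [translate_apply]
      right_inv := fun f => by
        refine lp.ext (funext fun p => ?_)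
        simp [translate_apply]
      norm_map' := norm_translate g }
  map_one' := by
    refine LinearIsometryEquiv.ext fun f => lp.ext (funext fun p => ?_)
    change (f : X → ℝ) ((1 : G)⁻¹ • p) = (f : X → ℝ) p
    simp
  map_mul' g h := by
    refine LinearIsometryEquiv.ext fun f => lp.ext (funext fun p => ?_)
    change (f : X → ℝ) ((g * h)⁻¹ • p) = (f : X → ℝ) (h⁻¹ • g⁻¹ • p)
    simp [mul_smul]

/-- The Hilbert space `ℋ = ⨁ᵢ ℓ²(G/Kᵢ)`, realised as `ℓ²` of the disjoint union of the coset
spaces `G/Kᵢ`, on which `G` acts by left multiplication. -/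
abbrev CosetSpace {ι : Type*} (K : ι → Subgroup G) := Ell2 (Σ i, G ⧸ K i)

/-- The sum `ρ` of the quotient representations `λ_{Kᵢ}` of `G`. -/
abbrev cosetRep {ι : Type*} (K : ι → Subgroup G) :
    G →* (CosetSpace K ≃ₗᵢ[ℝ] CosetSpace K) := permRep

/-- `φ ∗_ρ f = ∑_h φ(h) ρ(h) f`. -/
def convVec {ι : Type*} {K : ι → Subgroup G} (φ : G → ℝ) (f : CosetSpace K) : CosetSpace K :=
  ∑' h : G, φ h • cosetRep K h f

/-- `φ^*(g) = φ(g⁻¹)`. -/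
def reflect (φ : G → ℝ) : G → ℝ := fun g => φ g⁻¹

end Rep

/-! ### Thermodynamic densities -/

section Density

variable {S G : Type*} [Finite S] [Group G]

open Classical in
/-- The partial sum
`φ_{c;≤N}^{A,a}[t](g) = ∑_{n=1}^N t^{-n} c_n ∑_{w ∈ 𝒲_n^{A,a}, 𝔰(w) = g} R_n(w x)`. -/
def density (τ : S → S → Prop) (R : (ℕ → S) → ℝ) (s : S → G) (A a : S) (x : ℕ → S)
    (c : ℕ → ℝ) (N : ℕ) (t : ℝ) (g : G) : ℝ :=
  ∑ n ∈ Finset.Icc 1 N, (t ^ n)⁻¹ * c n *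
    ∑ w ∈ (wordsBetween τ A a n).filter (fun w => wordProd s w = g),
      birkhoffProd R n (concat w x)

variable {ι : Type*} {K : ι → Subgroup G}

/-- The convergence parameter
`γ(f) = inf {t > 0 : sup_N ∫ ⟨ρ(h) f, f⟩ dφ_{≤N}[t](h) < ∞}`, where `c = 1`. -/
def convParam (τ : S → S → Prop) (R : (ℕ → S) → ℝ) (s : S → G) (A a : S) (x : ℕ → S)
    (f : CosetSpace K) : ℝ :=
  sInf {t : ℝ | 0 < t ∧ BddAbove (Set.range fun N : ℕ =>
    ∑' h : G, density τ R s A a x (fun _ => 1) N t h * inner ℝ (cosetRep K h f) f)}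

/-- The coefficient `⟨ρ(g) (φ_{c;≤N}[t] ∗_ρ f), φ^*_{c;≤N}[t] ∗_ρ f⟩`. -/
def starCoeff (τ : S → S → Prop) (R : (ℕ → S) → ℝ) (s : S → G) (A a : S) (x : ℕ → S)
    (f : CosetSpace K) (c : ℕ → ℝ) (N : ℕ) (t : ℝ) (g : G) : ℝ :=
  inner ℝ (cosetRep K g (convVec (density τ R s A a x c N t) f))
    (convVec (reflect (density τ R s A a x c N t)) f)

/-- `c` is slowly increasing: positive, nondecreasing, with limit `∞`, and `c_{n+k} / c_n → 1` for
every `k`. -/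
def SlowlyIncreasing (c : ℕ → ℝ) : Prop :=
  (∀ n, 0 < c n) ∧ Monotone c ∧ Tendsto c atTop atTop ∧
    ∀ k : ℕ, Tendsto (fun n => c (n + k) / c n) atTop (𝓝 1)

/-- The function `Υ_{c,*}(g) = limsup_k lim_N starCoeff(g) / starCoeff(1)` at the parameters `t_k`
is well defined, with value `Υ`: the quotients have positive denominators for large `N`, the inner
limits exist in `ℝ`, and they are bounded in `k`, so that the `limsup` is finite. -/
def IsUpsilon (τ : S → S → Prop) (R : (ℕ → S) → ℝ) (s : S → G) (A a : S) (x : ℕ → S)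
    (f : CosetSpace K) (c : ℕ → ℝ) (t : ℕ → ℝ) (Υ : G → ℝ) : Prop :=
  (∀ k, ∀ᶠ N in atTop, 0 < starCoeff τ R s A a x f c N (t k) 1) ∧
  ∃ L : ℕ → G → ℝ,
    (∀ k g, Tendsto (fun N => starCoeff τ R s A a x f c N (t k) g /
      starCoeff τ R s A a x f c N (t k) 1) atTop (𝓝 (L k g))) ∧
    ∀ g, Bornology.IsBounded (Set.range fun k => L k g) ∧
      Υ g = limsup (fun k => L k g) atTop

end Density

end ThermoDensity

end

open ThermoDensity

/-! Patterson–Sullivan construction. Put `ψ(g) = ⟨ρ(g) f, f⟩ ≥ 0` and let `v` run through the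
admissible words from `A` to `a`. The series `P(t) = ∑_v c_{|v|} t^{-|v|} R_{|v|}(v x) ψ(𝔰(v))`
diverges below `γ(f)` and converges above it, and a suitable slowly increasing `c` makes it diverge
at `γ(f)` as well. The coefficients `⟨ρ(g) (φ ∗ f), φ^* ∗ f⟩` are the sums over pairs `(u, v)` with
weight `ψ(𝔰(u) g 𝔰(v))`.

A word `v = p r` cut into two pieces carries a point mass at `r x`, of weight
`c_{|p|+1} c_{|r|} t^{-|v|} R_{|v|}(v x) ψ(𝔰(v))`. The measure `μ` is a weak limit, as `t ↓ γ(f)`,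
of the sums of these masses divided by the coefficient at `g = 1`. A long word has many cuts, so
that `P(t)` is negligible against the total mass. Since `c` varies slowly and the shift moves the
cut of a word by one letter, the limit is invariant.

Multiplied by `t ^ n`, the integral of `(R_n ∘ σ)⁻¹` over `[a w A]`, where `n = |w|`, is, up to the
normalisation and `O(P(t))`, the sum over the words `u w v`, with `u` and `v` from `A` to `a`, cut
in front of the last letter of `u`. It differs from the coefficient at `g = 𝔰(w)` in that `R_{|u|}`
is evaluated at `u w v x` and not at `u x`, and in the arguments of `c`. As `w v x` and `x` agree on
the first `w ∧ x` letters, bounded distortion gives the factor `C ^ θ ^ (w ∧ x)`. Any other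
admissible word is first extended on both sides by connecting words of trivial cocycle, which
transitivity of the skew product provides, at the cost of a constant. -/

noncomputable section

open scoped ENNReal

namespace ThermoDensity

section Words

variable {S : Type*} {τ : S → S → Prop} {u v w : List S} {b : S} {y z : ℕ → S}

@[simp] theorem concat_nil (y : ℕ → S) : concat [] y = y := rfl

@[simp] theorem concat_cons_zero (b : S) (w : List S) (y : ℕ → S) : concat (b :: w) y 0 = b := rfl

@[simp] theorem concat_cons_succ (b : S) (w : List S) (y : ℕ → S) (i : ℕ) :
    concat (b :: w) y (i + 1) = concat w y i := rfl

@[simp] theorem shift_concat_cons (b : S) (w : List S) (y : ℕ → S) :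
    shift (concat (b :: w) y) = concat w y := rfl

theorem concat_append (u v : List S) (y : ℕ → S) : concat (u ++ v) y = concat u (concat v y) := by
  induction u with
  | nil => rfl
  | cons b u ih =>
    funext i
    cases i with
    | zero => rfl
    | succ i => simp [ih]

theorem concat_singleton_shift (y : ℕ → S) : concat [y 0] (shift y) = y := by
  funext i
  cases i <;> rfl

theorem shift_iterate_length_concat (u : List S) (y : ℕ → S) :
    shift^[u.length] (concat u y) = y := by
  induction u with
  | nil => rfl
  | cons b u ih => simpa only [List.length_cons, Function.iterate_succ_apply, shift_concat_cons]

theorem concat_apply_lt (w : List S) (y : ℕ → S) (i : ℕ) (h : i < w.length) :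
    concat w y i = w[i] := by
  induction w generalizing i with
  | nil => simp at h
  | cons b w ih =>
    cases i with
    | zero => rfl
    | succ i => simpa using ih i (by simpa using h)

theorem concat_apply_eq_of_forall_lt {m : ℕ} (u : List S) (h : ∀ i < m, y i = z i) :
    ∀ i < u.length + m, concat u y i = concat u z i := by
  induction u with
  | nil => simpa using h
  | cons b u ih =>
    intro i hi
    cases i with
    | zero => rfl
    | succ i => exact ih i (by simp only [List.length_cons] at hi; omega)

theorem concat_apply_of_lt_wedge (w : List S) (x y : ℕ → S) (i : ℕ) (hi : i < wedge w x) :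
    concat w y i = x i := by
  induction w generalizing x i with
  | nil => simp [wedge] at hi
  | cons b w ih =>
    by_cases hb : b = x 0
    · cases i with
      | zero => exact hb
      | succ i =>
        simp only [wedge, hb, if_true] at hi
        exact ih (shift x) i (by omega)
    · simp [wedge, hb] at hi

theorem concat_mem_cyl (w : List S) (y : ℕ → S) : concat w y ∈ cyl w := concat_apply_lt w y

theorem concat_shift_iterate_of_mem_cyl (h : y ∈ cyl w) :
    concat w (shift^[w.length] y) = y := by
  induction w generalizing y with
  | nil => rfl
  | cons b w ih =>
    have htail : shift y ∈ cyl w := fun i hi => h (i + 1) (by simpa using hi)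
    have hhead : y 0 = b := h 0 (by simp)
    funext i
    cases i with
    | zero => exact hhead.symm
    | succ i =>
      rw [concat_cons_succ, List.length_cons, Function.iterate_succ_apply, ih htail]
      rfl

theorem exists_concat_shift_iterate (y : ℕ → S) (n : ℕ) :
    ∃ u : List S, u.length = n ∧ concat u (shift^[n] y) = y := by
  refine ⟨List.ofFn fun i : Fin n => y i, List.length_ofFn, ?_⟩
  have hy : y ∈ cyl (List.ofFn fun i : Fin n => y i) := fun i hi => by simp
  simpa using concat_shift_iterate_of_mem_cyl hy

theorem concat_mem_cyl_iff (h : w.length ≤ u.length) : concat u y ∈ cyl w ↔ w <+: u := by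
  constructor
  · intro hc
    rw [List.prefix_iff_eq_take]
    refine List.ext_getElem (by simp [h]) fun i h1 _ => ?_
    rw [List.getElem_take, ← hc i h1, concat_apply_lt u y i (by omega)]
  · rintro ⟨v, rfl⟩
    rw [concat_append]
    exact concat_mem_cyl _ _

theorem shift_mem_markovShift (hy : y ∈ markovShift τ) : shift y ∈ markovShift τ :=
  fun i => hy (i + 1)

theorem shift_iterate_mem_markovShift (hy : y ∈ markovShift τ) (n : ℕ) :
    shift^[n] y ∈ markovShift τ := by
  induction n with
  | zero => exact hy
  | succ n ih => rw [Function.iterate_succ_apply']; exact shift_mem_markovShift ih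

theorem concat_cons_mem_markovShift_iff :
    concat (b :: w) y ∈ markovShift τ ↔ τ b (concat w y 0) ∧ concat w y ∈ markovShift τ := by
  refine ⟨fun h => ⟨h 0, shift_mem_markovShift h⟩, fun ⟨h0, h⟩ i => ?_⟩
  cases i with
  | zero => exact h0
  | succ i => exact h i

theorem mem_markovShift_of_concat_mem (h : concat u y ∈ markovShift τ) : y ∈ markovShift τ := by
  simpa only [shift_iterate_length_concat] using shift_iterate_mem_markovShift h u.length

theorem concat_mem_of_concat_append_mem (h : concat (u ++ v) y ∈ markovShift τ) :
    concat v y ∈ markovShift τ :=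
  mem_markovShift_of_concat_mem (concat_append u v y ▸ h)

theorem concat_mem_of_getLast? (hu : u.getLast? = some b) (h : concat u y ∈ markovShift τ)
    (hz : concat [b] z ∈ markovShift τ) : concat u z ∈ markovShift τ := by
  induction u with
  | nil => simp at hu
  | cons d u ih =>
    cases u with
    | nil =>
      obtain rfl : d = b := by simpa using hu
      exact hz
    | cons e u =>
      rw [List.getLast?_cons_cons] at hu
      rw [concat_cons_mem_markovShift_iff] at h ⊢
      exact ⟨h.1, ih hu h.2⟩

theorem admissible_of_concat_mem (h : concat w y ∈ markovShift τ) : Admissible τ w :=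
  ⟨_, concat_mem_cyl w y, h⟩

theorem Admissible.exists_concat_mem (h : Admissible τ w) : ∃ y, concat w y ∈ markovShift τ := by
  obtain ⟨y, hy, hy'⟩ := h
  exact ⟨shift^[w.length] y, by rwa [concat_shift_iterate_of_mem_cyl hy]⟩

theorem Admissible.of_infix (h : Admissible τ u) (hw : w <:+: u) : Admissible τ w := by
  obtain ⟨p, q, rfl⟩ := hw
  obtain ⟨y, hy⟩ := h.exists_concat_mem
  rw [concat_append] at hy
  exact admissible_of_concat_mem (concat_mem_of_concat_append_mem hy)

theorem Admissible.singleton_of_mem (h : Admissible τ u) (hb : b ∈ u) : Admissible τ [b] :=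
  h.of_infix ((List.singleton_infix_iff b u).2 hb)

theorem concat_append_append_mem {b' : S} (hu : u.getLast? = some b) (hua : Admissible τ u)
    (hw : Admissible τ (b :: (w ++ [b']))) (hv : v.head? = some b')
    (hvy : concat v y ∈ markovShift τ) : concat (u ++ (w ++ v)) y ∈ markovShift τ := by
  obtain ⟨z, hz⟩ := hua.exists_concat_mem
  obtain ⟨z', hz'⟩ := hw.exists_concat_mem
  obtain ⟨v, rfl⟩ := List.head?_eq_some_iff.1 hv
  have htail : concat (b :: (w ++ [b'])) (concat v y) ∈ markovShift τ :=
    concat_mem_of_getLast? (b := b') (by rw [← List.cons_append, List.getLast?_concat]) hz' hvy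
  rw [concat_append]
  refine concat_mem_of_getLast? hu hz ?_
  rw [← concat_append] at htail ⊢
  simpa using htail

end Words

section BirkhoffProducts

variable {S : Type*} {τ : S → S → Prop} {R R' : (ℕ → S) → ℝ}

theorem birkhoffProd_add (R : (ℕ → S) → ℝ) (m n : ℕ) (y : ℕ → S) :
    birkhoffProd R (m + n) y = birkhoffProd R m y * birkhoffProd R n (shift^[m] y) := by
  simp only [birkhoffProd, Finset.prod_range_add]
  congr 1
  exact Finset.prod_congr rfl fun i _ => by rw [add_comm, Function.iterate_add_apply]

theorem birkhoffProd_pos (hR : ∀ y, 0 < R y) (n : ℕ) (y : ℕ → S) : 0 < birkhoffProd R n y :=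
  Finset.prod_pos fun _ _ => hR _

theorem pow_le_birkhoffProd {lo : ℝ} (h0 : 0 ≤ lo) (hR : ∀ y, lo ≤ R y) (n : ℕ) (y : ℕ → S) :
    lo ^ n ≤ birkhoffProd R n y := by
  simpa [birkhoffProd] using Finset.prod_le_prod (s := Finset.range n) (f := fun _ => lo)
    (g := fun i => R (shift^[i] y)) (fun _ _ => h0) (fun _ _ => hR _)

theorem birkhoffProd_le_pow {hi : ℝ} (h0 : ∀ y, 0 ≤ R y) (hR : ∀ y, R y ≤ hi) (n : ℕ)
    (y : ℕ → S) : birkhoffProd R n y ≤ hi ^ n := by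
  simpa [birkhoffProd] using Finset.prod_le_prod (s := Finset.range n) (g := fun _ => hi)
    (f := fun i => R (shift^[i] y)) (fun _ _ => h0 _) (fun _ _ => hR _)

theorem birkhoffProd_congr (h : Set.EqOn R R' (markovShift τ)) (n : ℕ) :
    Set.EqOn (birkhoffProd R n) (birkhoffProd R' n) (markovShift τ) :=
  fun _ hy => Finset.prod_congr rfl fun i _ => h (shift_iterate_mem_markovShift hy i)

/-- The Birkhoff product of `R` along the word `u`, evaluated at the sequence `u y`. -/
def wordWeight (R : (ℕ → S) → ℝ) (u : List S) (y : ℕ → S) : ℝ :=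
  birkhoffProd R u.length (concat u y)

@[simp] theorem wordWeight_nil (R : (ℕ → S) → ℝ) (y : ℕ → S) : wordWeight R [] y = 1 := by
  simp [wordWeight, birkhoffProd]

theorem wordWeight_append (R : (ℕ → S) → ℝ) (u v : List S) (y : ℕ → S) :
    wordWeight R (u ++ v) y = wordWeight R u (concat v y) * wordWeight R v y := by
  simp only [wordWeight, List.length_append, birkhoffProd_add, concat_append,
    shift_iterate_length_concat]

theorem wordWeight_cons (R : (ℕ → S) → ℝ) (b : S) (v : List S) (y : ℕ → S) :
    wordWeight R (b :: v) y = R (concat (b :: v) y) * wordWeight R v y := by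
  have hb : wordWeight R [b] (concat v y) = R (concat (b :: v) y) := by
    simp [wordWeight, birkhoffProd, ← concat_append]
  rw [← List.singleton_append, wordWeight_append, hb]
  rfl

theorem wordWeight_pos (hR : ∀ y, 0 < R y) (u : List S) (y : ℕ → S) : 0 < wordWeight R u y :=
  birkhoffProd_pos hR _ _

end BirkhoffProducts

section Distortion

variable {S : Type*} {τ : S → S → Prop} {R : (ℕ → S) → ℝ} {θ : ℝ}

theorem LogHolder.congr {R' : (ℕ → S) → ℝ} (h : LogHolder τ R θ)
    (hR : Set.EqOn R R' (markovShift τ)) : LogHolder τ R' θ := by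
  obtain ⟨K, hK⟩ := h
  exact ⟨K, fun n hn y hy z hz hyz => hR hy ▸ hR hz ▸ hK n hn y hy z hz hyz⟩

/-- `log R` varies boundedly on each of the finitely many cylinders of length two. -/
theorem LogHolder.exists_abs_log_le [Finite S] (hHol : LogHolder τ R θ) :
    ∃ B : ℝ, ∀ y ∈ markovShift τ, |Real.log (R y)| ≤ B := by
  obtain ⟨K, hK⟩ := hHol
  let cell (p : S × S) : Set (ℕ → S) := {y ∈ markovShift τ | (y 0, y 1) = p}
  have hcell (p : S × S) : Bornology.IsBounded ((fun y => Real.log (R y)) '' cell p) := by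
    refine Metric.isBounded_iff.2 ⟨K * θ ^ 2, ?_⟩
    rintro _ ⟨y, ⟨hy, hyp⟩, rfl⟩ _ ⟨z, ⟨hz, hzp⟩, rfl⟩
    obtain ⟨h0, h1⟩ := Prod.ext_iff.1 (hyp.trans hzp.symm)
    refine hK 2 one_lt_two y hy z hz fun i hi => ?_
    interval_cases i
    exacts [h0, h1]
  obtain ⟨B, hB⟩ := (Bornology.isBounded_iUnion.2 hcell).exists_norm_le
  exact ⟨B, fun y hy => hB _ (Set.mem_iUnion.2 ⟨(y 0, y 1), y, ⟨hy, rfl⟩, rfl⟩)⟩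

theorem LogHolder.exists_abs_log_sub_log_le [Finite S] (hθ0 : 0 < θ) (hHol : LogHolder τ R θ) :
    ∃ K : ℝ, 0 ≤ K ∧ ∀ n : ℕ, 1 ≤ n → ∀ y ∈ markovShift τ, ∀ z ∈ markovShift τ,
      (∀ i < n, y i = z i) → |Real.log (R y) - Real.log (R z)| ≤ K * θ ^ n := by
  obtain ⟨B, hB⟩ := hHol.exists_abs_log_le
  obtain ⟨K, hK⟩ := hHol
  refine ⟨max (max K 0) (2 * B / θ), le_max_of_le_left (le_max_right _ _), ?_⟩
  intro n hn y hy z hz h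
  rcases hn.lt_or_eq with hn | rfl
  · refine (hK n hn y hy z hz h).trans ?_
    gcongr
    exact (le_max_left _ _).trans (le_max_left _ _)
  · calc |Real.log (R y) - Real.log (R z)| ≤ |Real.log (R y)| + |Real.log (R z)| := abs_sub _ _
      _ ≤ B + B := add_le_add (hB y hy) (hB z hz)
      _ = 2 * B / θ * θ ^ 1 := by field_simp; ring
      _ ≤ _ := by gcongr; exact le_max_right _ _

theorem sum_range_pow_succ_le (hθ0 : 0 ≤ θ) (hθ1 : θ < 1) (n : ℕ) :
    ∑ i ∈ Finset.range n, θ ^ (i + 1) ≤ θ / (1 - θ) := by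
  simp only [pow_succ, ← Finset.sum_mul]
  rw [div_eq_inv_mul, ← tsum_geometric_of_lt_one hθ0 hθ1]
  gcongr
  exact (summable_geometric_of_lt_one hθ0 hθ1).sum_le_tsum _ fun _ _ => by positivity

theorem log_wordWeight_sub_le {K : ℝ} (hR : ∀ y, 0 < R y)
    (hK : ∀ n : ℕ, 1 ≤ n → ∀ y ∈ markovShift τ, ∀ z ∈ markovShift τ, (∀ i < n, y i = z i) →
      |Real.log (R y) - Real.log (R z)| ≤ K * θ ^ n)
    {m : ℕ} {y z : ℕ → S} (h : ∀ i < m, y i = z i) (u : List S) (hy : concat u y ∈ markovShift τ)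
    (hz : concat u z ∈ markovShift τ) :
    Real.log (wordWeight R u y) - Real.log (wordWeight R u z) ≤
      K * θ ^ m * ∑ i ∈ Finset.range u.length, θ ^ (i + 1) := by
  induction u with
  | nil => simp
  | cons b u ih =>
    have htail := ih (concat_cons_mem_markovShift_iff.1 hy).2
      (concat_cons_mem_markovShift_iff.1 hz).2
    have hhead := le_of_abs_le (hK ((b :: u).length + m) (by simp; omega) _ hy _ hz
      (concat_apply_eq_of_forall_lt (b :: u) h))
    have hpow : K * θ ^ ((b :: u).length + m) = K * θ ^ m * θ ^ (u.length + 1) := by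
      rw [List.length_cons, pow_add]; ring
    rw [hpow] at hhead
    rw [wordWeight_cons, wordWeight_cons, Real.log_mul (hR _).ne' (wordWeight_pos hR _ _).ne',
      Real.log_mul (hR _).ne' (wordWeight_pos hR _ _).ne', List.length_cons,
      Finset.sum_range_succ, mul_add]
    linarith

/-- The constant `D` is sharp enough for the factor `C ^ (θ ^ m)` of the theorem: sequences with a
long common prefix have almost the same weights. -/
theorem LogHolder.exists_wordWeight_le [Finite S] (hR : ∀ y, 0 < R y) (hθ0 : 0 < θ) (hθ1 : θ < 1)
    (hHol : LogHolder τ R θ) :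
    ∃ D : ℝ, 1 ≤ D ∧ ∀ (m : ℕ) (u : List S) (y z : ℕ → S), concat u y ∈ markovShift τ →
      concat u z ∈ markovShift τ → (∀ i < m, y i = z i) →
        wordWeight R u y ≤ D ^ (θ ^ m) * wordWeight R u z := by
  obtain ⟨K, hK0, hK⟩ := hHol.exists_abs_log_sub_log_le hθ0
  have := sub_pos.2 hθ1
  refine ⟨Real.exp (K * (θ / (1 - θ))), Real.one_le_exp (by positivity), ?_⟩
  intro m u y z hy hz h
  have hlog : Real.log (wordWeight R u y) - Real.log (wordWeight R u z) ≤
      K * (θ / (1 - θ)) * θ ^ m :=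
    calc _ ≤ K * θ ^ m * ∑ i ∈ Finset.range u.length, θ ^ (i + 1) :=
          log_wordWeight_sub_le hR hK h u hy hz
      _ ≤ K * θ ^ m * (θ / (1 - θ)) := by gcongr; exact sum_range_pow_succ_le hθ0.le hθ1 _
      _ = _ := by ring
  rw [← Real.exp_mul, ← Real.exp_log (wordWeight_pos hR u y),
    ← Real.exp_log (wordWeight_pos hR u z), ← Real.exp_add]
  exact Real.exp_le_exp.2 (sub_le_iff_le_add.1 hlog)

end Distortion

section Transitivity

variable {S G : Type*} [Group G] {τ : S → S → Prop} {s : S → G}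

@[simp] theorem wordProd_nil (s : S → G) : wordProd s [] = 1 := rfl

theorem wordProd_append (s : S → G) (u v : List S) :
    wordProd s (u ++ v) = wordProd s u * wordProd s v := by simp [wordProd]

theorem wordProd_cons (s : S → G) (b : S) (v : List S) :
    wordProd s (b :: v) = s b * wordProd s v := by simp [wordProd]

theorem skewProduct_iterate_concat (s : S → G) (u : List S) (y : ℕ → S) (g : G) :
    (skewProduct s)^[u.length] (concat u y, g) = (y, (wordProd s u)⁻¹ * g) := by
  induction u generalizing g with
  | nil => simp
  | cons b u ih =>
    have hstep : skewProduct s (concat (b :: u) y, g) = (concat u y, (s b)⁻¹ * g) := rfl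
    rw [List.length_cons, Function.iterate_succ_apply, hstep, ih, wordProd_cons, mul_inv_rev,
      mul_assoc]

variable [TopologicalSpace S] [DiscreteTopology S]

theorem isOpen_setOf_apply_zero_eq_and_eq {X : Type*} [TopologicalSpace X] [DiscreteTopology X]
    (b : S) (g : X) : IsOpen {p : (ℕ → S) × X | p.1 0 = b ∧ p.2 = g} := by
  have hpre : IsOpen ((fun p : (ℕ → S) × X => (p.1 0, p.2)) ⁻¹' {(b, g)}) :=
    (isOpen_discrete _).preimage (by fun_prop)
  simpa only [Set.preimage, Set.mem_singleton_iff, Prod.mk.injEq] using hpre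

variable [TopologicalSpace G] [DiscreteTopology G]

theorem TransitiveOn.exists_wordProd_eq
    (h : TransitiveOn (skewProduct s) (markovShift τ ×ˢ Set.univ)) {b b' : S}
    (hb : Admissible τ [b]) (hb' : Admissible τ [b']) (g : G) :
    ∃ (u : List S) (z : ℕ → S), concat u z ∈ markovShift τ ∧ concat u z 0 = b ∧ z 0 = b' ∧
      wordProd s u = g := by
  obtain ⟨y, hy⟩ := hb.exists_concat_mem
  obtain ⟨y', hy'⟩ := hb'.exists_concat_mem
  obtain ⟨n, p, ⟨⟨q, k⟩, ⟨⟨hqb, hk⟩, hq, -⟩, hqp⟩, hpb', hpg⟩ :=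
    h _ _ (isOpen_setOf_apply_zero_eq_and_eq b 1) (isOpen_setOf_apply_zero_eq_and_eq b' g⁻¹)
      ⟨(concat [b] y, 1), ⟨rfl, rfl⟩, hy, trivial⟩ ⟨(concat [b'] y', g⁻¹), ⟨rfl, rfl⟩, hy', trivial⟩
  obtain ⟨u, hun, huq⟩ := exists_concat_shift_iterate q n
  obtain rfl : k = 1 := hk
  have hiter := skewProduct_iterate_concat s u (shift^[n] q) 1
  rw [huq, hun, hqp] at hiter
  subst hiter
  exact ⟨u, shift^[n] q, huq.symm ▸ hq, huq.symm ▸ hqb, hpb', by simpa using hpg⟩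

/-- Transitivity is applied to a letter that may follow `b`, since it might otherwise produce the
trivial word when `b = b'`. -/
theorem TransitiveOn.exists_wordProd_eq_admissible
    (h : TransitiveOn (skewProduct s) (markovShift τ ×ˢ Set.univ)) {b b' : S}
    (hb : Admissible τ [b]) (hb' : Admissible τ [b']) (g : G) :
    ∃ e : List S, wordProd s e = g ∧ Admissible τ (b :: (e ++ [b'])) := by
  obtain ⟨y, hy⟩ := hb.exists_concat_mem
  have hy0 : Admissible τ [y 0] := admissible_of_concat_mem (y := shift y) <| by
    rw [concat_singleton_shift]; exact mem_markovShift_of_concat_mem hy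
  obtain ⟨e, z, hez, he0, rfl, he⟩ := h.exists_wordProd_eq hy0 hb' g
  refine ⟨e, he, admissible_of_concat_mem (y := shift z) ?_⟩
  rw [← List.cons_append, concat_append, concat_singleton_shift,
    concat_cons_mem_markovShift_iff, he0]
  exact ⟨(concat_cons_mem_markovShift_iff.1 hy).1, hez⟩

end Transitivity

section Sums

variable {α β : Type*} {s : Set α} {t : Set β} {f : α → ℝ≥0∞} {g : β → ℝ≥0∞}

theorem tsum_le_tsum_of_injOn (φ : α → β) (hmap : Set.MapsTo φ s t) (hinj : Set.InjOn φ s)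
    (hle : ∀ z ∈ s, f z ≤ g (φ z)) : ∑' z : s, f z ≤ ∑' z : t, g z :=
  calc ∑' z : s, f z ≤ ∑' z : s, g (hmap.restrict φ s t z : t) :=
        ENNReal.tsum_le_tsum fun z => hle z z.2
    _ ≤ ∑' z : t, g z :=
        ENNReal.tsum_comp_le_tsum_of_injective (hmap.restrict_inj.2 hinj) fun z : t => g z

theorem tsum_le_tsum_of_forall_exists (φ : β → α)
    (h : ∀ a ∈ s, ∃ z ∈ t, φ z = a ∧ f a ≤ g z) : ∑' a : s, f a ≤ ∑' z : t, g z := by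
  choose ψ hmem hφ hle using h
  have hinj : Function.Injective fun a : s => (⟨ψ a a.2, hmem a a.2⟩ : t) :=
    Function.Injective.of_comp (f := fun z : t => φ z) fun a a' haa =>
      Subtype.ext ((hφ a a.2).symm.trans (haa.trans (hφ a' a'.2)))
  exact (ENNReal.tsum_le_tsum fun a : s => hle a a.2).trans
    (ENNReal.tsum_comp_le_tsum_of_injective hinj fun z : t => g z)

theorem tsum_le_tsum_of_forall_mem {t : Set α} (h : ∀ z ∈ s, f z ≠ 0 → z ∈ t) :
    ∑' z : s, f z ≤ ∑' z : t, f z := by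
  rw [tsum_subtype, tsum_subtype]
  refine ENNReal.tsum_le_tsum fun z => ?_
  by_cases hz : z ∈ s
  · by_cases h0 : f z = 0
    · simp [Set.indicator, h0]
    · simp [hz, h z hz h0]
  · simp [hz]

theorem ofReal_mul_le_ofReal_mul {X Y p q p' q' k l : ℝ} (hX : 0 ≤ X) (hp : 0 ≤ p) (hq : 0 ≤ q)
    (hk : 0 ≤ k) (hl : 0 ≤ l) (hXY : X ≤ k * Y) (hpp : p ≤ p') (hqq : q ≤ l * q') :
    ENNReal.ofReal (X * (p * q)) ≤ ENNReal.ofReal (l * k) * ENNReal.ofReal (Y * (p' * q')) := by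
  rw [← ENNReal.ofReal_mul (by positivity)]
  refine ENNReal.ofReal_le_ofReal ?_
  have hkY := hX.trans hXY
  have hp' := hp.trans hpp
  calc X * (p * q) ≤ k * Y * (p' * (l * q')) := by gcongr
    _ = l * k * (Y * (p' * q')) := by ring

theorem SlowlyIncreasing.exists_le {c : ℕ → ℝ} (hc : SlowlyIncreasing c) (n : ℕ) {ε : ℝ}
    (hε : 0 < ε) : ∃ m, ∀ k, m ≤ k → c (k + n) ≤ (1 + ε) * c k := by
  obtain ⟨hpos, -, -, hlim⟩ := hc
  have hlt := (hlim n).eventually (gt_mem_nhds (show (1 : ℝ) < 1 + ε by linarith))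
  obtain ⟨m, hm⟩ := eventually_atTop.1 hlt
  exact ⟨m, fun k hk => ((div_lt_iff₀ (hpos k)).1 (hm k hk)).le⟩

end Sums

section System

variable {S G : Type*} [Group G]

/-- The data from which the measure is built: a Markov shift on the alphabet `S`, a potential `R`
of bounded distortion, a cocycle `s` that takes every value along words between any two letters
(this is how transitivity of the skew product is used), the base point `x` of the sums over words
from `A` to `a`, and a bounded non-negative function `ψ` on `G`, which stands for the matrix
coefficient `g ↦ ⟨ρ(g) f, f⟩`. -/
structure WordSystem (S G : Type*) [Group G] where
  τ : S → S → Prop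
  R : (ℕ → S) → ℝ
  s : S → G
  A : S
  a : S
  x : ℕ → S
  ψ : G → ℝ
  lo : ℝ
  hi : ℝ
  D : ℝ
  θ : ℝ
  ψbound : ℝ
  lo_pos : 0 < lo
  lo_le : ∀ y, lo ≤ R y
  le_hi : ∀ y, R y ≤ hi
  one_le_D : 1 ≤ D
  distortion : ∀ (m : ℕ) (u : List S) (y z : ℕ → S), concat u y ∈ markovShift τ →
    concat u z ∈ markovShift τ → (∀ i < m, y i = z i) →
      wordWeight R u y ≤ D ^ (θ ^ m) * wordWeight R u z
  concat_a_mem : concat [a] x ∈ markovShift τ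
  admissible_A : Admissible τ [A]
  link : ∀ b b', Admissible τ [b] → Admissible τ [b'] → ∀ g,
    ∃ e, wordProd s e = g ∧ Admissible τ (b :: (e ++ [b']))
  ψ_nonneg : ∀ g, 0 ≤ ψ g
  ψ_one_pos : 0 < ψ 1
  ψ_le : ∀ g, ψ g ≤ ψbound

namespace WordSystem

variable (M : WordSystem S G)

theorem R_pos (y : ℕ → S) : 0 < M.R y := M.lo_pos.trans_le (M.lo_le y)

theorem D_nonneg : 0 ≤ M.D := zero_le_one.trans M.one_le_D

theorem admissible_a : Admissible M.τ [M.a] := admissible_of_concat_mem M.concat_a_mem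

/-- The admissible words from `A` to `a`, of all lengths; as `x ∈ σ[a]`, admissibility of `v` is
the condition `v x ∈ Σ⁺`. -/
def Words : Set (List S) :=
  {v | concat v M.x ∈ markovShift M.τ ∧ v.head? = some M.A ∧ v.getLast? = some M.a}

/-- The factor `t^{-|u|} R_{|u|}(u y)`. -/
def scaledWeight (t : ℝ) (u : List S) (y : ℕ → S) : ℝ := (t ^ u.length)⁻¹ * wordWeight M.R u y

/-- The weight `t^{-|v|} R_{|v|}(v x) ψ(𝔰(v))` of a single word. -/
def gibbs (t : ℝ) (v : List S) : ℝ := M.scaledWeight t v M.x * M.ψ (wordProd M.s v)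

/-- The weight of a pair of words in `⟨ρ(g) (φ[t] ∗ f), φ^*[t] ∗ f⟩`: both factors are evaluated at
the base point. -/
def pairWeight (t : ℝ) (g : G) (u v : List S) : ℝ :=
  M.scaledWeight t u M.x * M.scaledWeight t v M.x * M.ψ (wordProd M.s u * g * wordProd M.s v)

/-- The weight of the word `p w q` without the factor that belongs to `w`. -/
def splitWeight (t : ℝ) (w p q : List S) : ℝ :=
  M.scaledWeight t p (concat (w ++ q) M.x) * M.scaledWeight t q M.x *
    M.ψ (wordProd M.s p * wordProd M.s w * wordProd M.s q)

variable {M} {t t₁ : ℝ}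

theorem scaledWeight_pos (ht : 0 < t) (u : List S) (y : ℕ → S) : 0 < M.scaledWeight t u y :=
  mul_pos (by positivity) (wordWeight_pos M.R_pos u y)

theorem gibbs_nonneg (ht : 0 < t) (v : List S) : 0 ≤ M.gibbs t v :=
  mul_nonneg (scaledWeight_pos ht _ _).le (M.ψ_nonneg _)

theorem pairWeight_nonneg (ht : 0 < t) (g : G) (u v : List S) : 0 ≤ M.pairWeight t g u v :=
  mul_nonneg (mul_pos (scaledWeight_pos ht _ _) (scaledWeight_pos ht _ _)).le (M.ψ_nonneg _)

theorem splitWeight_nonneg (ht : 0 < t) (w p q : List S) : 0 ≤ M.splitWeight t w p q :=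
  mul_nonneg (mul_pos (scaledWeight_pos ht _ _) (scaledWeight_pos ht _ _)).le (M.ψ_nonneg _)

theorem scaledWeight_append (t : ℝ) (u v : List S) (y : ℕ → S) :
    M.scaledWeight t (u ++ v) y = M.scaledWeight t u (concat v y) * M.scaledWeight t v y := by
  simp only [scaledWeight, wordWeight_append, List.length_append, pow_add, mul_inv]
  ring

theorem gibbs_append_append (t : ℝ) (p w q : List S) : M.gibbs t (p ++ (w ++ q)) =
    M.scaledWeight t w (concat q M.x) * M.splitWeight t w p q := by
  simp only [gibbs, splitWeight, scaledWeight_append, wordProd_append, mul_assoc]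
  ring

theorem gibbs_append (t : ℝ) (p q : List S) : M.gibbs t (p ++ q) = M.splitWeight t [] p q := by
  simpa [scaledWeight] using M.gibbs_append_append t p [] q

theorem pow_mul_gibbs_append_append (ht : 0 < t) (p w q : List S) :
    t ^ w.length * M.gibbs t (p ++ (w ++ q)) * (wordWeight M.R w (concat q M.x))⁻¹ =
      M.splitWeight t w p q := by
  have hw := (wordWeight_pos M.R_pos w (concat q M.x)).ne'
  rw [gibbs_append_append, scaledWeight]
  field_simp

theorem scaledWeight_le (ht : 0 < t) {m : ℕ} {u : List S} {y z : ℕ → S}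
    (hy : concat u y ∈ markovShift M.τ) (hz : concat u z ∈ markovShift M.τ)
    (h : ∀ i < m, y i = z i) :
    M.scaledWeight t u y ≤ M.D ^ (M.θ ^ m) * M.scaledWeight t u z := by
  rw [scaledWeight, scaledWeight, mul_left_comm]
  gcongr
  exact M.distortion m u y z hy hz h

theorem one_le_mul_scaledWeight (ht : 0 < t) (htt : t ≤ t₁) (e : List S) (y : ℕ → S) :
    1 ≤ (t₁ / M.lo) ^ e.length * M.scaledWeight t e y := by
  have hlo := M.lo_pos
  have hweight : M.lo ^ e.length ≤ wordWeight M.R e y :=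
    pow_le_birkhoffProd M.lo_pos.le M.lo_le _ _
  calc 1 = (t / M.lo) ^ e.length * ((t ^ e.length)⁻¹ * M.lo ^ e.length) := by
        rw [div_pow]; field_simp
    _ ≤ (t₁ / M.lo) ^ e.length * M.scaledWeight t e y := by
        have ht₁ := ht.trans_le htt
        rw [scaledWeight]
        gcongr

theorem scaledWeight_le_append (ht : 0 < t) (htt : t ≤ t₁) {u e : List S} {y z : ℕ → S}
    (hy : concat u y ∈ markovShift M.τ) (hz : concat (u ++ e) z ∈ markovShift M.τ) :
    M.scaledWeight t u y ≤
      M.D * (t₁ / M.lo) ^ e.length * M.scaledWeight t (u ++ e) z := by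
  rw [concat_append] at hz
  have hyz : M.scaledWeight t u y ≤ M.D * M.scaledWeight t u (concat e z) := by
    simpa using scaledWeight_le (m := 0) ht hy hz (by simp)
  calc M.scaledWeight t u y ≤ M.D * M.scaledWeight t u (concat e z) := hyz
    _ ≤ M.D * M.scaledWeight t u (concat e z) *
        ((t₁ / M.lo) ^ e.length * M.scaledWeight t e z) :=
      le_mul_of_one_le_right ((scaledWeight_pos ht _ _).le.trans hyz)
        (one_le_mul_scaledWeight ht htt e z)
    _ = _ := by rw [scaledWeight_append]; ring

theorem scaledWeight_le_prepend (ht : 0 < t) (htt : t ≤ t₁) (v e : List S) (y : ℕ → S) :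
    M.scaledWeight t v y ≤ (t₁ / M.lo) ^ e.length * M.scaledWeight t (e ++ v) y := by
  rw [scaledWeight_append, ← mul_assoc]
  exact le_mul_of_one_le_left (scaledWeight_pos ht _ _).le (one_le_mul_scaledWeight ht htt e _)

variable (M) in
/-- The price for the insertion of two words of trivial cocycle into a word. -/
def insertionConst (t₁ : ℝ) (e e' : List S) : ℝ :=
  M.D * (t₁ / M.lo) ^ e.length * (t₁ / M.lo) ^ e'.length

theorem insertionConst_nonneg (ht₁ : 0 < t₁) (e e' : List S) : 0 ≤ M.insertionConst t₁ e e' := by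
  have hD := M.D_nonneg
  have hlo := M.lo_pos
  rw [insertionConst]
  positivity

theorem scaledWeight_mul_le_insert (ht : 0 < t) (htt : t ≤ t₁) {u v e e' : List S} {y z : ℕ → S}
    (hy : concat u y ∈ markovShift M.τ) (hz : concat (u ++ e) z ∈ markovShift M.τ) :
    M.scaledWeight t u y * M.scaledWeight t v M.x ≤ M.insertionConst t₁ e e' *
      (M.scaledWeight t (u ++ e) z * M.scaledWeight t (e' ++ v) M.x) := by
  have hu := scaledWeight_le_append ht htt hy hz
  calc _ ≤ _ := mul_le_mul hu (scaledWeight_le_prepend ht htt v e' M.x)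
        (scaledWeight_pos ht _ _).le ((scaledWeight_pos ht _ _).le.trans hu)
    _ = _ := by rw [insertionConst]; ring

theorem splitWeight_le_pairWeight_insert (ht : 0 < t) (htt : t ≤ t₁) {w p q e e' : List S}
    (he : wordProd M.s e = 1) (he' : wordProd M.s e' = 1)
    (hpq : concat (p ++ (w ++ q)) M.x ∈ markovShift M.τ)
    (hpe : concat (p ++ e) M.x ∈ markovShift M.τ) :
    M.splitWeight t w p q ≤
      M.insertionConst t₁ e e' * M.pairWeight t (wordProd M.s w) (p ++ e) (e' ++ q) := by
  rw [splitWeight, pairWeight, wordProd_append, wordProd_append, he, he', mul_one, one_mul,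
    ← mul_assoc]
  exact mul_le_mul_of_nonneg_right
    (scaledWeight_mul_le_insert ht htt (by rwa [← concat_append]) hpe) (M.ψ_nonneg _)

theorem pairWeight_le_splitWeight_insert (ht : 0 < t) (htt : t ≤ t₁) {w u v e e' : List S}
    (he : wordProd M.s e = 1) (he' : wordProd M.s e' = 1)
    (hu : concat u M.x ∈ markovShift M.τ)
    (huv : concat ((u ++ e) ++ (w ++ (e' ++ v))) M.x ∈ markovShift M.τ) :
    M.pairWeight t (wordProd M.s w) u v ≤
      M.insertionConst t₁ e e' * M.splitWeight t w (u ++ e) (e' ++ v) := by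
  rw [splitWeight, pairWeight, wordProd_append, wordProd_append, he, he', mul_one, one_mul,
    ← mul_assoc]
  exact mul_le_mul_of_nonneg_right
    (scaledWeight_mul_le_insert ht htt hu (by rwa [← concat_append])) (M.ψ_nonneg _)

theorem append_append_mem_words {u w v : List S} {b b' : S} (hu : u.head? = some M.A)
    (hub : u.getLast? = some b) (hua : Admissible M.τ u)
    (hw : Admissible M.τ (b :: (w ++ [b']))) (hv : v.head? = some b')
    (hva : v.getLast? = some M.a) (hvx : concat v M.x ∈ markovShift M.τ) :
    u ++ (w ++ v) ∈ M.Words := by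
  refine ⟨concat_append_append_mem hub hua hw hv hvx, ?_, ?_⟩
  · rw [List.head?_append, hu]; rfl
  · rw [List.getLast?_append, List.getLast?_append, hva]; rfl

theorem Words.join {u w v : List S} (hu : u ∈ M.Words)
    (hw : Admissible M.τ (M.a :: (w ++ [M.A]))) (hv : v ∈ M.Words) : u ++ (w ++ v) ∈ M.Words :=
  append_append_mem_words hu.2.1 hu.2.2 (admissible_of_concat_mem hu.1) hw hv.2.1 hv.2.2 hv.1

theorem Words.prefix_mem {u v : List S} (hu : u.getLast? = some M.a) (h : u ++ v ∈ M.Words) :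
    u ∈ M.Words := by
  have hne : u ≠ [] := by rintro rfl; simp at hu
  exact ⟨concat_mem_of_getLast? hu (concat_append u v M.x ▸ h.1) M.concat_a_mem,
    List.head?_append_of_ne_nil _ hne ▸ h.2.1, hu⟩

theorem Words.suffix_mem {u v : List S} (hv : v.head? = some M.A) (h : u ++ v ∈ M.Words) :
    v ∈ M.Words := by
  have hne : v ≠ [] := by rintro rfl; simp at hv
  exact ⟨concat_mem_of_concat_append_mem h.1, hv, List.getLast?_append_of_ne_nil _ hne ▸ h.2.2⟩

theorem exists_append_mem_words {b : S} (hb : Admissible M.τ [b]) :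
    ∃ e : List S, e ≠ [] ∧ wordProd M.s e = 1 ∧
      ∀ p v : List S, p.getLast? = some b → p ++ v ∈ M.Words → p ++ e ∈ M.Words := by
  obtain ⟨e, he, hbe⟩ := M.link b M.a hb M.admissible_a (M.s M.a)⁻¹
  refine ⟨e ++ [M.a], by simp, by simp [wordProd_append, wordProd_cons, he], fun p v hp hpv => ?_⟩
  have hne : p ≠ [] := by rintro rfl; simp at hp
  exact append_append_mem_words (List.head?_append_of_ne_nil _ hne ▸ hpv.2.1) hp
    (admissible_of_concat_mem (concat_append p v M.x ▸ hpv.1)) hbe rfl rfl M.concat_a_mem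

theorem exists_prepend_mem_words {b : S} (hb : Admissible M.τ [b]) :
    ∃ e : List S, wordProd M.s e = 1 ∧
      ∀ q v : List S, q.head? = some b → v ++ q ∈ M.Words → e ++ q ∈ M.Words := by
  obtain ⟨e, he, hbe⟩ := M.link M.A b M.admissible_A hb (M.s M.A)⁻¹
  refine ⟨M.A :: e, by simp [wordProd_cons, he], fun q v hq hvq => ?_⟩
  have hne : q ≠ [] := by rintro rfl; simp at hq
  exact append_append_mem_words (u := [M.A]) rfl rfl M.admissible_A hbe hq
    (List.getLast?_append_of_ne_nil _ hne ▸ hvq.2.2) (concat_mem_of_concat_append_mem hvq.1)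

end WordSystem

end System

section Series

variable {S G : Type*} [Group G]

/-- The inverse Birkhoff product on a cylinder. -/
def cylWeight (R : (ℕ → S) → ℝ) (w : List S) : (ℕ → S) → ℝ≥0∞ :=
  (cyl w).indicator fun y => ENNReal.ofReal (birkhoffProd R w.length y)⁻¹

/-- The inverse Birkhoff product along the middle word of a cylinder `[a w A]`. -/
def midWeight (R : (ℕ → S) → ℝ) (a : S) (w : List S) (A : S) : (ℕ → S) → ℝ≥0∞ :=
  (cyl (a :: (w ++ [A]))).indicator fun y => ENNReal.ofReal (birkhoffProd R w.length (shift y))⁻¹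

theorem cylWeight_concat (R : (ℕ → S) → ℝ) (w : List S) (y : ℕ → S) :
    cylWeight R w (concat w y) = ENNReal.ofReal (wordWeight R w y)⁻¹ :=
  Set.indicator_of_mem (concat_mem_cyl w y) _

theorem midWeight_concat (R : (ℕ → S) → ℝ) (a : S) (w : List S) {A : S} {y : ℕ → S}
    (hy : y 0 = A) :
    midWeight R a w A (concat (a :: w) y) = ENNReal.ofReal (wordWeight R w y)⁻¹ := by
  have hmem : concat (a :: w) y = concat (a :: (w ++ [A])) (shift y) := by
    rw [← List.cons_append, concat_append, ← hy, concat_singleton_shift]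
  rw [midWeight, Set.indicator_of_mem]
  · rfl
  · rw [hmem]; exact concat_mem_cyl _ _

namespace WordSystem

section Defs

variable (M : WordSystem S G) (c : ℕ → ℝ) (t : ℝ)

/-- The ways to cut a word of `Words` into a head and a non-empty tail. The cut `(p, r)` stands for
the point `r x` of the orbit of `p r x`. -/
def Cuts : Set (List S × List S) := {z | z.2 ≠ [] ∧ z.1 ++ z.2 ∈ M.Words}

/-- The cuts with non-empty head and long tail at which `F` does not vanish. -/
def LongCuts (m : ℕ) (F : (ℕ → S) → ℝ≥0∞) : Set (List S × List S) :=
  {z | z ∈ M.Cuts ∧ z.1 ≠ [] ∧ m ≤ z.2.length ∧ F (concat z.2 M.x) ≠ 0}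

/-- The ways to write a word of `Words` as `p w q` with non-empty `p` and `q`. -/
def Splits (w : List S) : Set (List S × List S) :=
  {z | z.1 ≠ [] ∧ z.2 ≠ [] ∧ z.1 ++ (w ++ z.2) ∈ M.Words}

/-- The mass of the cut `(p, r)`. With `|p| + 1` in place of `|p|`, the cut `(p, a w v)` gets the
factor `c |p a|` of the pair `(p a, v)`. -/
def cutWeight (z : List S × List S) : ℝ≥0∞ :=
  ENNReal.ofReal (M.gibbs t (z.1 ++ z.2) * (c (z.1.length + 1) * c z.2.length))

/-- The contribution of the cut `(p, r)` to the integral of `F`. -/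
def cutTerm (F : (ℕ → S) → ℝ≥0∞) (z : List S × List S) : ℝ≥0∞ :=
  M.cutWeight c t z * F (concat z.2 M.x)

/-- The term of a word in the series `wordSum`. -/
def wordTerm (v : List S) : ℝ≥0∞ := ENNReal.ofReal (M.gibbs t v * c v.length)

/-- The term of a pair `(u, v)` in the coefficient `pairSum` at `g`. -/
def pairTerm (g : G) (z : List S × List S) : ℝ≥0∞ :=
  ENNReal.ofReal (M.pairWeight t g z.1 z.2 * (c z.1.length * c z.2.length))

/-- The term of `p w q` in the integral of the inverse Birkhoff product over `[w]`, multiplied by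
`t ^ |w|`; the cut sits in front of `w`. -/
def splitTerm (w : List S) (z : List S × List S) : ℝ≥0∞ :=
  ENNReal.ofReal (M.splitWeight t w z.1 z.2 * (c (z.1.length + 1) * c z.2.length))

/-- The series `∑_v c_{|v|} t^{-|v|} R_{|v|}(v x) ψ(𝔰(v))`. -/
def wordSum : ℝ≥0∞ := ∑' v : M.Words, M.wordTerm c t v

/-- The limit of the coefficients `⟨ρ(g) (φ_{c;≤N}[t] ∗ f), φ^*_{c;≤N}[t] ∗ f⟩`. -/
def pairSum (g : G) : ℝ≥0∞ := ∑' z : M.Words ×ˢ M.Words, M.pairTerm c t g z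

/-- The integral of `F` against the sum of weighted point masses along the orbits of the points
`v x`. -/
def cutSum (F : (ℕ → S) → ℝ≥0∞) : ℝ≥0∞ := ∑' z : M.Cuts, M.cutTerm c t F z

end Defs

variable {M : WordSystem S G} {c : ℕ → ℝ} {t t₁ : ℝ} {w : List S} {F : (ℕ → S) → ℝ≥0∞}

theorem cylWeight_le (M : WordSystem S G) (w : List S) (y : ℕ → S) :
    cylWeight M.R w y ≤ ENNReal.ofReal (M.lo ^ w.length)⁻¹ :=
  Set.indicator_le' (fun _ _ => ENNReal.ofReal_le_ofReal <| inv_anti₀ (pow_pos M.lo_pos _)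
    (pow_le_birkhoffProd M.lo_pos.le M.lo_le _ _)) (fun _ _ => zero_le) y

theorem midWeight_le (M : WordSystem S G) (w : List S) (y : ℕ → S) :
    midWeight M.R M.a w M.A y ≤ ENNReal.ofReal (M.lo ^ w.length)⁻¹ :=
  Set.indicator_le' (fun _ _ => ENNReal.ofReal_le_ofReal <| inv_anti₀ (pow_pos M.lo_pos _)
    (pow_le_birkhoffProd M.lo_pos.le M.lo_le _ _)) (fun _ _ => zero_le) y

theorem tsum_cutWeight_le_of_injOn (ht : 0 < t)
    {T : Set (List S × List S)} {k : ℝ} (hk : 0 ≤ k) (hT : T ⊆ M.Cuts)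
    (hinj : Set.InjOn (fun z => z.1 ++ z.2) T)
    (hle : ∀ z ∈ T, c (z.1.length + 1) * c z.2.length ≤ k * c (z.1 ++ z.2).length) :
    ∑' z : T, M.cutWeight c t z ≤ ENNReal.ofReal k * M.wordSum c t := by
  rw [wordSum, ← ENNReal.tsum_mul_left]
  refine tsum_le_tsum_of_injOn (g := fun v => ENNReal.ofReal k * M.wordTerm c t v) _
    (fun z hz => (hT hz).2) hinj fun z hz => ?_
  rw [wordTerm, ← ENNReal.ofReal_mul hk, mul_left_comm]
  exact ENNReal.ofReal_le_ofReal (mul_le_mul_of_nonneg_left (hle z hz) (gibbs_nonneg ht _))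

theorem tsum_cutWeight_length_eq_le (hpos : ∀ n, 0 ≤ c n) (hmono : Monotone c) (ht : 0 < t)
    (i : ℕ) : ∑' z : {z | z ∈ M.Cuts ∧ z.2.length = i}, M.cutWeight c t z ≤
      ENNReal.ofReal (c i) * M.wordSum c t := by
  refine tsum_cutWeight_le_of_injOn ht (hpos i) (fun z hz => hz.1) ?_ ?_
  · rintro ⟨p, r⟩ hz ⟨p', r'⟩ hz' h
    exact Prod.ext_iff.2 (List.append_inj' h (hz.2.trans hz'.2.symm))
  · rintro ⟨p, r⟩ ⟨⟨hr, -⟩, hri⟩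
    have hlen : 0 < r.length := List.length_pos_of_ne_nil hr
    rw [hri, mul_comm]
    refine mul_le_mul_of_nonneg_left (hmono ?_) (hpos i)
    simp only [List.length_append]
    omega

theorem tsum_cutWeight_length_lt_le (hpos : ∀ n, 0 ≤ c n) (hmono : Monotone c) (ht : 0 < t)
    (m : ℕ) : ∑' z : {z | z ∈ M.Cuts ∧ z.2.length < m}, M.cutWeight c t z ≤
      ENNReal.ofReal (m * c m) * M.wordSum c t := by
  have hcover : {z | z ∈ M.Cuts ∧ z.2.length < m} ⊆
      ⋃ i ∈ Finset.range m, {z | z ∈ M.Cuts ∧ z.2.length = i} := fun z hz => by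
    simp only [Set.mem_iUnion, Finset.mem_range]
    exact ⟨_, hz.2, hz.1, rfl⟩
  calc _ ≤ ∑ i ∈ Finset.range m, ∑' z : {z | z ∈ M.Cuts ∧ z.2.length = i}, M.cutWeight c t z :=
        (ENNReal.tsum_mono_subtype _ hcover).trans (ENNReal.tsum_biUnion_le _ _ _)
    _ ≤ ∑ _i ∈ Finset.range m, ENNReal.ofReal (c m) * M.wordSum c t := by
        refine Finset.sum_le_sum fun i hi => ?_
        refine (tsum_cutWeight_length_eq_le hpos hmono ht i).trans ?_
        gcongr
        exact hmono (Finset.mem_range.1 hi).le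
    _ = _ := by
        rw [Finset.sum_const, Finset.card_range, nsmul_eq_mul, ENNReal.ofReal_mul (by positivity),
          ENNReal.ofReal_natCast, mul_assoc]

theorem tsum_cutWeight_nil_le (hpos : ∀ n, 0 ≤ c n) (ht : 0 < t) :
    ∑' z : {z | z ∈ M.Cuts ∧ z.1 = []}, M.cutWeight c t z ≤
      ENNReal.ofReal (c 1) * M.wordSum c t := by
  refine tsum_cutWeight_le_of_injOn ht (hpos 1) (fun z hz => hz.1) ?_ ?_
  · rintro ⟨p, r⟩ ⟨-, rfl : p = []⟩ ⟨p', r'⟩ ⟨-, rfl : p' = []⟩ h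
    simpa using h
  · rintro ⟨p, r⟩ ⟨-, rfl : p = []⟩
    rfl

theorem cutSum_le_add_tsum_longCuts (hpos : ∀ n, 0 ≤ c n) (hmono : Monotone c) (ht : 0 < t)
    (m : ℕ) {B : ℝ} (hB : 0 ≤ B) (hF : ∀ y, F y ≤ ENNReal.ofReal B) :
    M.cutSum c t F ≤ ENNReal.ofReal (B * (m * c m + c 1)) * M.wordSum c t +
      ∑' z : M.LongCuts m F, M.cutTerm c t F z := by
  have hcover : ∀ z ∈ M.Cuts, M.cutTerm c t F z ≠ 0 →
      z ∈ ({z | z ∈ M.Cuts ∧ z.2.length < m} ∪ {z | z ∈ M.Cuts ∧ z.1 = []}) ∪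
        M.LongCuts m F := by
    intro z hz h0
    by_cases hlen : z.2.length < m
    · exact Or.inl (Or.inl ⟨hz, hlen⟩)
    by_cases hnil : z.1 = []
    · exact Or.inl (Or.inr ⟨hz, hnil⟩)
    exact Or.inr ⟨hz, hnil, not_lt.1 hlen, right_ne_zero_of_mul h0⟩
  have hle (T : Set (List S × List S)) : ∑' z : T, M.cutTerm c t F z ≤
      ENNReal.ofReal B * ∑' z : T, M.cutWeight c t z := by
    rw [← ENNReal.tsum_mul_left]
    refine ENNReal.tsum_le_tsum fun z => ?_
    rw [cutTerm, mul_comm]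
    gcongr
    exact hF _
  have hshort := (hle _).trans (mul_le_mul_right (tsum_cutWeight_length_lt_le hpos hmono ht m) _)
  have hnil := (hle _).trans (mul_le_mul_right (tsum_cutWeight_nil_le hpos ht) _)
  calc M.cutSum c t F ≤ _ := tsum_le_tsum_of_forall_mem hcover
    _ ≤ _ := (ENNReal.tsum_union_le _ _ _).trans (add_le_add_left (ENNReal.tsum_union_le _ _ _) _)
    _ ≤ _ := add_le_add_left (add_le_add hshort hnil) _
    _ = _ := by
        have := hpos m
        rw [← mul_add, ← add_mul, ← ENNReal.ofReal_add (by positivity) (hpos 1),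
          ENNReal.ofReal_mul hB, mul_assoc]

theorem exists_tsum_splits_letters_le (ht₁ : 0 < t₁) {b b' : S} (hb : Admissible M.τ [b])
    (hb' : Admissible M.τ [b']) :
    ∃ C, 0 ≤ C ∧ ∀ c : ℕ → ℝ, (∀ n, 0 ≤ c n) → Monotone c → ∀ t, 0 < t → t ≤ t₁ → ∀ w,
      ∑' z : {z | z ∈ M.Splits w ∧ z.1.getLast? = some b ∧ z.2.head? = some b'},
        M.splitTerm c t w z ≤ ENNReal.ofReal C * M.pairSum c t (wordProd M.s w) := by
  obtain ⟨e, hne, he, heb⟩ := exists_append_mem_words hb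
  obtain ⟨e', he', heb'⟩ := exists_prepend_mem_words hb'
  refine ⟨M.insertionConst t₁ e e', insertionConst_nonneg ht₁ e e',
    fun c hpos hmono t ht htt w => ?_⟩
  rw [pairSum, ← ENNReal.tsum_mul_left]
  refine tsum_le_tsum_of_injOn (g := fun z => ENNReal.ofReal _ * M.pairTerm c t _ z)
    (fun z => (z.1 ++ e, e' ++ z.2)) ?_ ?_ ?_
  · rintro ⟨p, q⟩ ⟨⟨-, -, hpq⟩, hp, hq⟩
    exact ⟨heb p _ hp hpq, heb' q (p ++ w) hq (by rwa [List.append_assoc])⟩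
  · rintro ⟨p, q⟩ - ⟨p', q'⟩ - h
    simpa using h
  · rintro ⟨p, q⟩ ⟨⟨-, -, hpq⟩, hp, -⟩
    have hlen := List.length_pos_of_ne_nil hne
    rw [pairTerm, ← one_mul (M.insertionConst t₁ e e')]
    exact ofReal_mul_le_ofReal_mul (splitWeight_nonneg ht w p q) (hpos _) (hpos _)
      (insertionConst_nonneg ht₁ e e') zero_le_one
      (splitWeight_le_pairWeight_insert ht htt he he' hpq.1 (heb p _ hp hpq).1)
      (hmono (by simp only [List.length_append]; omega))
      ((hmono (by simp)).trans (one_mul _).ge)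

theorem exists_tsum_splits_le [Finite S] (M : WordSystem S G) (ht₁ : 0 < t₁) :
    ∃ C, 0 ≤ C ∧ ∀ c : ℕ → ℝ, (∀ n, 0 ≤ c n) → Monotone c → ∀ t, 0 < t → t ≤ t₁ → ∀ w,
      ∑' z : M.Splits w, M.splitTerm c t w z ≤
        ENNReal.ofReal C * M.pairSum c t (wordProd M.s w) := by
  let Letter := {b // Admissible M.τ [b]}
  have := Fintype.ofFinite (Letter × Letter)
  choose C hC0 hC using fun β : Letter × Letter =>
    exists_tsum_splits_letters_le ht₁ β.1.2 β.2.2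
  refine ⟨∑ β, C β, Finset.sum_nonneg fun β _ => hC0 β, fun c hpos hmono t ht htt w => ?_⟩
  have hcover : M.Splits w ⊆ ⋃ β : Letter × Letter,
      {z | z ∈ M.Splits w ∧ z.1.getLast? = some β.1.1 ∧ z.2.head? = some β.2.1} := by
    rintro ⟨p, q⟩ hpq
    have hadm := admissible_of_concat_mem hpq.2.2.1
    refine Set.mem_iUnion.2 ⟨⟨⟨p.getLast hpq.1, hadm.singleton_of_mem ?_⟩,
      ⟨q.head hpq.2.1, hadm.singleton_of_mem ?_⟩⟩, hpq, List.getLast?_eq_some_getLast _,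
      List.head?_eq_some_head _⟩
    · exact List.mem_append_left _ (List.getLast_mem _)
    · exact List.mem_append_right _ (List.mem_append_right _ (List.head_mem _))
  calc _ ≤ ∑ β : Letter × Letter, _ :=
        (ENNReal.tsum_mono_subtype _ hcover).trans (ENNReal.tsum_iUnion_le _ _)
    _ ≤ ∑ β, ENNReal.ofReal (C β) * M.pairSum c t (wordProd M.s w) :=
        Finset.sum_le_sum fun β _ => hC β c hpos hmono t ht htt w
    _ = _ := by rw [← Finset.sum_mul, ENNReal.ofReal_sum_of_nonneg fun β _ => hC0 β]

theorem cutSum_one_le (hpos : ∀ n, 0 ≤ c n) (hmono : Monotone c) (ht : 0 < t) {C : ℝ}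
    (hC : ∑' z : M.Splits [], M.splitTerm c t [] z ≤ ENNReal.ofReal C * M.pairSum c t 1) :
    M.cutSum c t (fun _ => 1) ≤
      ENNReal.ofReal (c 1) * M.wordSum c t + ENNReal.ofReal C * M.pairSum c t 1 := by
  refine (cutSum_le_add_tsum_longCuts hpos hmono ht 0 zero_le_one (by simp)).trans ?_
  simp only [one_mul, Nat.cast_zero, zero_mul, zero_add]
  gcongr
  refine le_trans (tsum_le_tsum_of_injOn id ?_ (Set.injOn_id _) ?_) hC
  · rintro ⟨p, r⟩ ⟨⟨hr, hpr⟩, hp, -⟩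
    exact ⟨hp, hr, hpr⟩
  · rintro ⟨p, r⟩ -
    rw [cutTerm, mul_one, cutWeight, gibbs_append]
    rfl

theorem pow_mul_cutWeight_mul (hpos : ∀ n, 0 ≤ c n) (ht : 0 < t) (p q : List S) {p' r : List S}
    (h : p' ++ r = p ++ (w ++ q)) :
    ENNReal.ofReal (t ^ w.length) * (M.cutWeight c t (p', r) *
      ENNReal.ofReal (wordWeight M.R w (concat q M.x))⁻¹) =
      ENNReal.ofReal (M.splitWeight t w p q * (c (p'.length + 1) * c r.length)) := by
  have hweight := mul_nonneg (gibbs_nonneg (M := M) ht (p' ++ r))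
    (mul_nonneg (hpos (p'.length + 1)) (hpos r.length))
  rw [cutWeight, ← ENNReal.ofReal_mul hweight, ← ENNReal.ofReal_mul (by positivity),
    ← pow_mul_gibbs_append_append ht p w q, ← h]
  congr 1
  ring

theorem pow_mul_cutTerm_cylWeight (hpos : ∀ n, 0 ≤ c n) (ht : 0 < t) (p q : List S) :
    ENNReal.ofReal (t ^ w.length) * M.cutTerm c t (cylWeight M.R w) (p, w ++ q) =
      ENNReal.ofReal (M.splitWeight t w p q *
        (c (p.length + 1) * c (w.length + q.length))) := by
  rw [cutTerm, concat_append, cylWeight_concat, pow_mul_cutWeight_mul hpos ht p q rfl,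
    List.length_append]

theorem pow_mul_cutTerm_midWeight (hpos : ∀ n, 0 ≤ c n) (ht : 0 < t) {u v : List S}
    (hu : u.getLast? = some M.a) (hv : v.head? = some M.A) :
    ENNReal.ofReal (t ^ w.length) *
        M.cutTerm c t (midWeight M.R M.a w M.A) (u.dropLast, M.a :: (w ++ v)) =
      ENNReal.ofReal (M.splitWeight t w u v *
        (c u.length * c (v.length + (w.length + 1)))) := by
  obtain ⟨u, rfl⟩ := List.getLast?_eq_some_iff.1 hu
  obtain ⟨v, rfl⟩ := List.head?_eq_some_iff.1 hv
  rw [List.dropLast_concat, cutTerm, ← List.cons_append, concat_append,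
    midWeight_concat M.R M.a w (concat_cons_zero _ _ _), pow_mul_cutWeight_mul hpos ht (u ++ [M.a])
      (M.A :: v) (by simp)]
  congr! 4
  · simp
  · simp only [List.length_cons, List.length_append]; omega

theorem pairWeight_le_splitWeight (ht : 0 < t) {u v : List S}
    (hw : Admissible M.τ (M.a :: (w ++ [M.A]))) (hu : u ∈ M.Words) (hv : v ∈ M.Words) :
    M.pairWeight t (wordProd M.s w) u v ≤
      M.D ^ (M.θ ^ wedge w M.x) * M.splitWeight t w u v := by
  have hle := scaledWeight_le (m := wedge w M.x) ht hu.1 (z := concat (w ++ v) M.x)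
    (by rw [← concat_append]; exact (Words.join hu hw hv).1)
    fun i hi => by rw [concat_append, concat_apply_of_lt_wedge w _ _ _ hi]
  rw [pairWeight, splitWeight, ← mul_assoc, ← mul_assoc]
  exact mul_le_mul_of_nonneg_right
    (mul_le_mul_of_nonneg_right hle (scaledWeight_pos ht _ _).le) (M.ψ_nonneg _)

theorem splitWeight_le_pairWeight (ht : 0 < t) {u v : List S} (hu : u ∈ M.Words)
    (huv : u ++ (w ++ v) ∈ M.Words) :
    M.splitWeight t w u v ≤
      M.D ^ (M.θ ^ wedge w M.x) * M.pairWeight t (wordProd M.s w) u v := by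
  have hle := scaledWeight_le (m := wedge w M.x) ht (y := concat (w ++ v) M.x)
    (by rw [← concat_append]; exact huv.1) hu.1
    fun i hi => by rw [concat_append, concat_apply_of_lt_wedge w _ _ _ hi]
  rw [pairWeight, splitWeight, ← mul_assoc, ← mul_assoc]
  exact mul_le_mul_of_nonneg_right
    (mul_le_mul_of_nonneg_right hle (scaledWeight_pos ht _ _).le) (M.ψ_nonneg _)

theorem pairSum_le_cutSum_midWeight (hpos : ∀ n, 0 ≤ c n) (hmono : Monotone c) (ht : 0 < t)
    (hw : Admissible M.τ (M.a :: (w ++ [M.A]))) :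
    M.pairSum c t (wordProd M.s w) ≤ ENNReal.ofReal (M.D ^ (M.θ ^ wedge w M.x)) *
      (ENNReal.ofReal (t ^ w.length) * M.cutSum c t (midWeight M.R M.a w M.A)) := by
  have hD := Real.rpow_nonneg M.D_nonneg (M.θ ^ wedge w M.x)
  rw [cutSum, ← ENNReal.tsum_mul_left, ← ENNReal.tsum_mul_left]
  refine tsum_le_tsum_of_injOn (f := M.pairTerm c t (wordProd M.s w))
    (g := fun z => ENNReal.ofReal (M.D ^ (M.θ ^ wedge w M.x)) *
      (ENNReal.ofReal (t ^ w.length) * M.cutTerm c t (midWeight M.R M.a w M.A) z))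
    (fun z => (z.1.dropLast, M.a :: (w ++ z.2))) ?_ ?_ ?_
  · rintro ⟨u, v⟩ ⟨hu, hv⟩
    refine ⟨List.cons_ne_nil _ _, ?_⟩
    rw [List.append_cons, List.dropLast_append_getLast? M.a hu.2.2]
    exact Words.join hu hw hv
  · rintro ⟨u, v⟩ ⟨hu, -⟩ ⟨u', v'⟩ ⟨hu', -⟩ h
    simp only [Prod.mk.injEq, List.cons.injEq, List.append_cancel_left_eq, true_and] at h
    have hu_eq := List.dropLast_append_getLast? M.a hu.2.2
    rw [h.1, List.dropLast_append_getLast? M.a hu'.2.2] at hu_eq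
    exact Prod.ext hu_eq.symm h.2
  · rintro ⟨u, v⟩ ⟨hu, hv⟩
    rw [pow_mul_cutTerm_midWeight hpos ht hu.2.2 hv.2.1, pairTerm,
      ← one_mul (M.D ^ (M.θ ^ wedge w M.x))]
    exact ofReal_mul_le_ofReal_mul (pairWeight_nonneg ht _ _ _) (hpos _) (hpos _) hD zero_le_one
      (pairWeight_le_splitWeight ht hw hu hv) le_rfl ((hmono (by simp)).trans (one_mul _).ge)

theorem exists_eq_of_mem_longCuts_midWeight {m : ℕ} {z : List S × List S}
    (hz : z ∈ M.LongCuts (w.length + 1 + (m + 1)) (midWeight M.R M.a w M.A)) :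
    ∃ u v, u ++ (w ++ v) ∈ M.Words ∧ u ∈ M.Words ∧ v ∈ M.Words ∧ m ≤ v.length ∧
      z = (u.dropLast, M.a :: (w ++ v)) := by
  obtain ⟨p, r⟩ := z
  obtain ⟨⟨-, hpr⟩, hp, hlen, hF⟩ := hz
  dsimp only at hpr hlen hF
  have hcyl := (concat_mem_cyl_iff (by simp at hlen ⊢; omega)).1 (Set.mem_of_indicator_ne_zero hF)
  obtain ⟨v, rfl⟩ := hcyl
  have hsplit : p ++ (M.a :: (w ++ [M.A]) ++ v) = (p ++ [M.a]) ++ (w ++ (M.A :: v)) := by simp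
  rw [hsplit] at hpr
  refine ⟨p ++ [M.a], M.A :: v, hpr, Words.prefix_mem (by simp) hpr,
    Words.suffix_mem (u := p ++ [M.a] ++ w) rfl (by rwa [List.append_assoc]), ?_, ?_⟩
  · simp at hlen ⊢; omega
  · simp

theorem exists_cutSum_midWeight_le (M : WordSystem S G) (hc : SlowlyIncreasing c) (w : List S)
    {ε : ℝ} (hε : 0 < ε) :
    ∃ B, 0 ≤ B ∧ ∀ t, 0 < t →
      ENNReal.ofReal (t ^ w.length) * M.cutSum c t (midWeight M.R M.a w M.A) ≤
        ENNReal.ofReal ((1 + ε) * M.D ^ (M.θ ^ wedge w M.x)) * M.pairSum c t (wordProd M.s w) +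
          ENNReal.ofReal (t ^ w.length) * (ENNReal.ofReal B * M.wordSum c t) := by
  have hpos n := (hc.1 n).le
  obtain ⟨m, hm⟩ := hc.exists_le (w.length + 1) hε
  have hlo := M.lo_pos
  have hD := Real.rpow_nonneg M.D_nonneg (M.θ ^ wedge w M.x)
  set k := w.length + 1 + (m + 1)
  refine ⟨(M.lo ^ w.length)⁻¹ * (k * c k + c 1), by have := hpos k; have := hpos 1; positivity,
    fun t ht => ?_⟩
  refine (mul_le_mul_right (cutSum_le_add_tsum_longCuts hpos hc.2.1 ht k (by positivity)
    (midWeight_le M w)) _).trans ?_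
  rw [mul_add, add_comm]
  refine add_le_add_left ?_ _
  rw [pairSum, ← ENNReal.tsum_mul_left, ← ENNReal.tsum_mul_left]
  refine tsum_le_tsum_of_forall_exists
    (f := fun z => ENNReal.ofReal (t ^ w.length) * M.cutTerm c t (midWeight M.R M.a w M.A) z)
    (g := fun z => ENNReal.ofReal ((1 + ε) * M.D ^ (M.θ ^ wedge w M.x)) *
      M.pairTerm c t (wordProd M.s w) z)
    (fun z => (z.1.dropLast, M.a :: (w ++ z.2))) fun z hz => ?_
  obtain ⟨u, v, huv, hu, hv, hlen, rfl⟩ := exists_eq_of_mem_longCuts_midWeight hz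
  refine ⟨(u, v), ⟨hu, hv⟩, rfl, ?_⟩
  rw [pow_mul_cutTerm_midWeight hpos ht hu.2.2 hv.2.1, pairTerm]
  exact ofReal_mul_le_ofReal_mul (splitWeight_nonneg ht _ _ _) (hpos _) (hpos _) hD
    (by positivity) (splitWeight_le_pairWeight ht hu huv) le_rfl (hm _ hlen)

theorem exists_cutSum_cylWeight_le (M : WordSystem S G) (hc : SlowlyIncreasing c) (w : List S) :
    ∃ B, 0 ≤ B ∧ ∀ t, 0 < t → ∀ C, ∑' z : M.Splits w, M.splitTerm c t w z ≤
        ENNReal.ofReal C * M.pairSum c t (wordProd M.s w) →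
      ENNReal.ofReal (t ^ w.length) * M.cutSum c t (cylWeight M.R w) ≤
        ENNReal.ofReal (2 * C) * M.pairSum c t (wordProd M.s w) +
          ENNReal.ofReal (t ^ w.length) * (ENNReal.ofReal B * M.wordSum c t) := by
  have hpos n := (hc.1 n).le
  obtain ⟨m, hm⟩ := hc.exists_le w.length one_pos
  have hlo := M.lo_pos
  set k := w.length + (m + 1)
  refine ⟨(M.lo ^ w.length)⁻¹ * (k * c k + c 1), by have := hpos k; have := hpos 1; positivity,
    fun t ht C hsplit => ?_⟩
  refine (mul_le_mul_right (cutSum_le_add_tsum_longCuts hpos hc.2.1 ht k (by positivity)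
    (cylWeight_le M w)) _).trans ?_
  rw [mul_add, add_comm]
  refine add_le_add_left ?_ _
  have hlong : ENNReal.ofReal (t ^ w.length) *
      ∑' z : M.LongCuts k (cylWeight M.R w), M.cutTerm c t (cylWeight M.R w) z ≤
        ENNReal.ofReal 2 * ∑' z : M.Splits w, M.splitTerm c t w z := by
    rw [← ENNReal.tsum_mul_left, ← ENNReal.tsum_mul_left]
    refine tsum_le_tsum_of_forall_exists
      (f := fun z => ENNReal.ofReal (t ^ w.length) * M.cutTerm c t (cylWeight M.R w) z)
      (g := fun z => ENNReal.ofReal 2 * M.splitTerm c t w z) (fun z => (z.1, w ++ z.2)) ?_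
    rintro ⟨p, r⟩ ⟨⟨-, hpr⟩, hp, hlen, hF⟩
    dsimp only at hpr hlen hF
    obtain ⟨q, rfl⟩ := (concat_mem_cyl_iff (by omega)).1 (Set.mem_of_indicator_ne_zero hF)
    rw [List.length_append] at hlen
    refine ⟨(p, q), ⟨hp, List.ne_nil_of_length_pos (by dsimp only; omega), hpr⟩, rfl, ?_⟩
    rw [pow_mul_cutTerm_cylWeight hpos ht, splitTerm, ← mul_one (2 : ℝ)]
    exact ofReal_mul_le_ofReal_mul (splitWeight_nonneg ht _ _ _) (hpos _) (hpos _) zero_le_one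
      two_pos.le (one_mul _).ge le_rfl (by convert hm q.length (by omega) using 1 <;> ring_nf)
  calc _ ≤ _ := hlong
    _ ≤ _ := mul_le_mul_right hsplit _
    _ = _ := by rw [ENNReal.ofReal_mul two_pos.le, mul_assoc]

theorem exists_pairSum_le_cutSum_cylWeight [Finite S] (M : WordSystem S G) (t₁ : ℝ) :
    ∃ C, 0 ≤ C ∧ ∀ c : ℕ → ℝ, (∀ n, 0 ≤ c n) → Monotone c → ∀ t, 0 < t → t ≤ t₁ →
      ∀ w, w ≠ [] → Admissible M.τ w → M.pairSum c t (wordProd M.s w) ≤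
        ENNReal.ofReal C * (ENNReal.ofReal (t ^ w.length) * M.cutSum c t (cylWeight M.R w)) := by
  let Letter := {b // Admissible M.τ [b]}
  choose e he hea using fun b : Letter => M.link M.a b M.admissible_a b.2 1
  choose e' he' heA using fun b : Letter => M.link b M.A b.2 M.admissible_A 1
  obtain ⟨C, hC⟩ := Finite.exists_le fun β : Letter × Letter =>
    M.insertionConst t₁ (e β.1) (e' β.2)
  refine ⟨max C 0, le_max_right _ _, fun c hpos hmono t ht htt w hne hw => ?_⟩
  let b : Letter := ⟨w.head hne, hw.singleton_of_mem (List.head_mem _)⟩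
  let b' : Letter := ⟨w.getLast hne, hw.singleton_of_mem (List.getLast_mem _)⟩
  have hwords {u v : List S} (hu : u ∈ M.Words) (hv : v ∈ M.Words) :
      (u ++ e b) ++ (w ++ (e' b' ++ v)) ∈ M.Words := by
    rw [List.append_assoc]
    refine append_append_mem_words hu.2.1 hu.2.2 (admissible_of_concat_mem hu.1) (hea b) ?_ ?_
      (concat_append_append_mem (List.getLast?_eq_some_getLast hne) hw (heA b') hv.2.1 hv.1)
    · rw [List.head?_append_of_ne_nil _ hne]; exact List.head?_eq_some_head _
    · rw [List.getLast?_append, List.getLast?_append, hv.2.2]; rfl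
  rw [cutSum, ← ENNReal.tsum_mul_left, ← ENNReal.tsum_mul_left]
  refine tsum_le_tsum_of_injOn (g := fun z => ENNReal.ofReal (max C 0) *
      (ENNReal.ofReal (t ^ w.length) * M.cutTerm c t (cylWeight M.R w) z))
    (fun z => (z.1 ++ e b, w ++ (e' b' ++ z.2))) ?_ ?_ ?_
  · rintro ⟨u, v⟩ ⟨hu, hv⟩
    exact ⟨by simp [hne], hwords hu hv⟩
  · rintro ⟨u, v⟩ - ⟨u', v'⟩ - h
    simpa using h
  · rintro ⟨u, v⟩ ⟨hu, hv⟩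
    rw [pow_mul_cutTerm_cylWeight hpos ht, pairTerm, ← one_mul (max C 0)]
    refine ofReal_mul_le_ofReal_mul (pairWeight_nonneg ht _ _ _) (hpos _) (hpos _)
      (le_max_right _ _) zero_le_one ?_ (hmono (by simp; omega))
      ((hmono (by simp; omega)).trans (one_mul _).ge)
    refine (pairWeight_le_splitWeight_insert ht htt (he b) (he' b') hu.1 (hwords hu hv).1).trans ?_
    exact mul_le_mul_of_nonneg_right ((hC (b, b')).trans (le_max_left _ _))
      (splitWeight_nonneg ht _ _ _)

theorem exists_cutSum_comp_shift_le (M : WordSystem S G) (hc : SlowlyIncreasing c) {B : ℝ}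
    (hB : 0 ≤ B) (hF : ∀ y, F y ≤ ENNReal.ofReal B) {ε : ℝ} (hε : 0 < ε) :
    ∃ C, 0 ≤ C ∧ ∀ t, 0 < t → M.cutSum c t (fun y => F (shift y)) ≤
      ENNReal.ofReal (1 + ε) * M.cutSum c t F + ENNReal.ofReal C * M.wordSum c t := by
  have hpos n := (hc.1 n).le
  obtain ⟨m, hm⟩ := hc.exists_le 1 hε
  set k := m + 2
  refine ⟨B * (k * c k + c 1), by have := hpos k; have := hpos 1; positivity, fun t ht => ?_⟩
  refine (cutSum_le_add_tsum_longCuts hpos hc.2.1 ht k hB fun y => hF (shift y)).trans ?_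
  rw [add_comm, cutSum, ← ENNReal.tsum_mul_left]
  gcongr
  refine tsum_le_tsum_of_injOn (f := M.cutTerm c t fun y => F (shift y))
    (g := fun z => ENNReal.ofReal (1 + ε) * M.cutTerm c t F z)
    (fun z => (z.1 ++ z.2.take 1, z.2.tail)) ?_ ?_ ?_
  · rintro ⟨p, _ | ⟨b, r⟩⟩ ⟨⟨hr, hpr⟩, -, hlen, -⟩
    · exact absurd rfl hr
    · simp only [List.length_cons] at hlen
      exact ⟨List.ne_nil_of_length_pos (by dsimp only [List.tail]; omega), by simpa using hpr⟩
  · rintro ⟨p, _ | ⟨b, r⟩⟩ ⟨⟨hr, -⟩, -⟩ ⟨p', _ | ⟨b', r'⟩⟩ ⟨⟨hr', -⟩, -⟩ h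
    · exact absurd rfl hr
    · exact absurd rfl hr
    · exact absurd rfl hr'
    · simpa [List.append_left_inj, and_assoc] using h
  · rintro ⟨p, _ | ⟨b, r⟩⟩ ⟨⟨hr, -⟩, -, hlen, -⟩
    · exact absurd rfl hr
    · have hgibbs := gibbs_nonneg (M := M) ht (p ++ b :: r)
      have hratio := hm r.length (by simp only [List.length_cons] at hlen; omega)
      simp only [cutTerm, cutWeight, List.tail, List.take_succ_cons, List.take_zero,
        List.append_assoc, List.singleton_append, ← mul_assoc]
      rw [← ENNReal.ofReal_mul (by positivity)]
      refine mul_le_mul_left (ENNReal.ofReal_le_ofReal ?_) _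
      calc M.gibbs t (p ++ b :: r) * c (p.length + 1) * c (b :: r).length
          ≤ M.gibbs t (p ++ b :: r) * c ((p ++ [b]).length + 1) * ((1 + ε) * c r.length) := by
            have := hpos (p.length + 1)
            have := hpos (b :: r).length
            have := hpos ((p ++ [b]).length + 1)
            gcongr
            · exact hc.2.1 (by simp)
            · exact hratio
        _ = _ := by ring

theorem exists_tsum_short_wordTerm_le [Finite S] (M : WordSystem S G) (hpos : ∀ n, 0 ≤ c n)
    {t₀ : ℝ} (ht₀ : 0 < t₀) (m : ℕ) :
    ∃ C, ∀ t, t₀ ≤ t →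
      ∑' v : {v : List S | v.length < m}, M.wordTerm c t v ≤ ENNReal.ofReal C := by
  have hfin : {v : List S | v.length < m}.Finite := List.finite_length_lt S _
  refine ⟨∑ v ∈ hfin.toFinset, M.gibbs t₀ v * c v.length, fun t ht => ?_⟩
  rw [ENNReal.ofReal_sum_of_nonneg fun v _ => mul_nonneg (gibbs_nonneg ht₀ v) (hpos _)]
  calc ∑' v : {v : List S | v.length < m}, M.wordTerm c t v
      = ∑ v ∈ hfin.toFinset, M.wordTerm c t v := by
        rw [← Finset.tsum_subtype' hfin.toFinset (M.wordTerm c t), hfin.coe_toFinset]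
    _ ≤ _ := by
        refine Finset.sum_le_sum fun v _ => ENNReal.ofReal_le_ofReal ?_
        have := (wordWeight_pos M.R_pos v M.x).le
        have := M.ψ_nonneg (wordProd M.s v)
        have := hpos v.length
        simp only [gibbs, scaledWeight]
        gcongr

theorem mul_tsum_wordTerm_le_cutSum (hpos : ∀ n, 0 ≤ c n) (hmono : Monotone c) (ht : 0 < t)
    {j k m : ℕ} (hj : 2 * k ≤ c j) (hm : ∀ n, m ≤ n → c (n + j) ≤ (1 + 1) * c n) :
    (k : ℝ≥0∞) * ∑' v : {v ∈ M.Words | m + j + 1 ≤ v.length}, M.wordTerm c t v ≤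
      M.cutSum c t fun _ => 1 := by
  rw [← ENNReal.tsum_mul_left]
  refine tsum_le_tsum_of_injOn (f := fun v => k * M.wordTerm c t v)
    (g := M.cutTerm c t fun _ => 1) (fun v => (v.take j, v.drop j)) ?_ ?_ ?_
  · rintro v ⟨hv, hlen⟩
    exact ⟨List.ne_nil_of_length_pos (by simp; omega), by rwa [List.take_append_drop]⟩
  · intro v _ v' _ h
    obtain ⟨htake, hdrop⟩ := Prod.ext_iff.1 h
    rw [← List.take_append_drop j v, ← List.take_append_drop j v']
    exact congrArg₂ _ htake hdrop
  · rintro v ⟨-, hlen⟩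
    have hratio := hm (v.length - j) (by omega)
    rw [Nat.sub_add_cancel (by omega)] at hratio
    rw [cutTerm, mul_one, cutWeight, List.take_append_drop, wordTerm, List.length_take,
      List.length_drop, min_eq_left (by omega), ← ENNReal.ofReal_natCast,
      ← ENNReal.ofReal_mul (by positivity), mul_left_comm]
    refine ENNReal.ofReal_le_ofReal (mul_le_mul_of_nonneg_left ?_ (gibbs_nonneg ht _))
    calc k * c v.length ≤ k * ((1 + 1) * c (v.length - j)) := by gcongr
      _ = 2 * k * c (v.length - j) := by ring
      _ ≤ _ := mul_le_mul_of_nonneg_right (hj.trans (hmono j.le_succ)) (hpos _)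

theorem exists_mul_wordSum_le [Finite S] (M : WordSystem S G) (hc : SlowlyIncreasing c)
    {t₀ : ℝ} (ht₀ : 0 < t₀) (k : ℕ) :
    ∃ C, ∀ t, t₀ ≤ t →
      (k : ℝ≥0∞) * M.wordSum c t ≤ M.cutSum c t (fun _ => 1) + ENNReal.ofReal C := by
  have hpos n := (hc.1 n).le
  obtain ⟨j, hj⟩ := (hc.2.2.1.eventually_ge_atTop (2 * k : ℝ)).exists
  obtain ⟨m, hm⟩ := hc.exists_le j one_pos
  obtain ⟨C, hC⟩ := M.exists_tsum_short_wordTerm_le hpos ht₀ (m + j + 1)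
  refine ⟨k * C, fun t ht => ?_⟩
  have hlong := mul_tsum_wordTerm_le_cutSum (M := M) hpos hc.2.1 (ht₀.trans_le ht) hj hm
  have hcover : M.Words ⊆ {v ∈ M.Words | m + j + 1 ≤ v.length} ∪ {v | v.length < m + j + 1} :=
    fun v hv => (le_or_gt (m + j + 1) v.length).imp (fun h => ⟨hv, h⟩) id
  calc k * M.wordSum c t ≤ k * (∑' v : {v ∈ M.Words | m + j + 1 ≤ v.length}, M.wordTerm c t v +
        ∑' v : {v : List S | v.length < m + j + 1}, M.wordTerm c t v) := by
        gcongr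
        exact (ENNReal.tsum_mono_subtype _ hcover).trans (ENNReal.tsum_union_le _ _ _)
    _ ≤ _ := by
        rw [mul_add, ENNReal.ofReal_mul k.cast_nonneg, ENNReal.ofReal_natCast]
        exact add_le_add hlong (mul_le_mul_right (hC t ht) _)

end WordSystem

end Series

section SlowSequences

theorem slowlyIncreasing_of_tendsto_succ_div {c : ℕ → ℝ} (hpos : ∀ n, 0 < c n) (hmono : Monotone c)
    (htop : Tendsto c atTop atTop) (hratio : Tendsto (fun n => c (n + 1) / c n) atTop (𝓝 1)) :
    SlowlyIncreasing c := by
  refine ⟨hpos, hmono, htop, fun k => ?_⟩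
  induction k with
  | zero => simp [div_self (hpos _).ne']
  | succ k ih =>
    have hprod := (hratio.comp (tendsto_add_atTop_nat k)).mul ih
    rw [one_mul] at hprod
    refine hprod.congr fun n => ?_
    rw [Function.comp_apply, div_mul_div_cancel₀ (hpos _).ne', add_assoc]

theorem slowlyIncreasing_mul_exp {L : ℕ → ℝ} (hnonneg : ∀ n, 0 ≤ L n) (hmono : Monotone L)
    (hinc : Tendsto (fun n => L (n + 1) - L n) atTop (𝓝 0)) :
    SlowlyIncreasing fun n => ((n : ℝ) + 1) * Real.exp (L n) := by
  refine slowlyIncreasing_of_tendsto_succ_div (fun n => by positivity) (fun n k hnk => ?_) ?_ ?_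
  · have hL := hmono hnk
    gcongr
  · refine tendsto_atTop_mono (fun n => ?_) tendsto_natCast_atTop_atTop
    exact (lt_add_one _).le.trans
      (le_mul_of_one_le_right (by positivity) (Real.one_le_exp (hnonneg n)))
  · have hlin : Tendsto (fun n : ℕ => 1 + 1 / ((n : ℝ) + 1)) atTop (𝓝 (1 + 0)) :=
      tendsto_const_nhds.add tendsto_one_div_add_atTop_nhds_zero_nat
    have hprod := hlin.mul ((Real.continuous_exp.tendsto 0).comp hinc)
    rw [add_zero, Real.exp_zero, mul_one] at hprod
    refine hprod.congr fun n => ?_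
    simp only [Function.comp_apply, Real.exp_sub]
    push_cast
    field_simp

/-- The function `n ↦ sup_j min(n, N_j) / (j + 1)`: it has the value at least `N_j / (j + 1)` at
`N_j`, but its increments tend to `0`. -/
def sparseGrowth (N : ℕ → ℕ) (n : ℕ) : ℝ := ⨆ j : ℕ, ((min n (N j) : ℕ) : ℝ) / (j + 1)

variable (N : ℕ → ℕ)

theorem bddAbove_range_sparseGrowth (n : ℕ) :
    BddAbove (Set.range fun j : ℕ => ((min n (N j) : ℕ) : ℝ) / (j + 1)) := by
  refine ⟨n, ?_⟩
  rintro _ ⟨j, rfl⟩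
  exact (div_le_self (by positivity) (by simp)).trans (by exact_mod_cast min_le_left n (N j))

theorem le_sparseGrowth (n j : ℕ) : ((min n (N j) : ℕ) : ℝ) / (j + 1) ≤ sparseGrowth N n :=
  le_ciSup (bddAbove_range_sparseGrowth N n) j

theorem sparseGrowth_nonneg (n : ℕ) : 0 ≤ sparseGrowth N n :=
  Real.iSup_nonneg fun _ => by positivity

theorem sparseGrowth_mono : Monotone (sparseGrowth N) := fun n k hnk =>
  ciSup_mono (bddAbove_range_sparseGrowth N k) fun j => by gcongr

theorem sparseGrowth_succ_le {J n : ℕ} (hn : ∀ j < J, N j ≤ n) :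
    sparseGrowth N (n + 1) ≤ sparseGrowth N n + 1 / (J + 1) := by
  refine ciSup_le fun j => ?_
  rcases lt_or_ge j J with hj | hj
  · rw [min_eq_right ((hn j hj).trans n.le_succ), ← min_eq_right (hn j hj)]
    exact (le_sparseGrowth N n j).trans (le_add_of_nonneg_right (by positivity))
  · calc ((min (n + 1) (N j) : ℕ) : ℝ) / (j + 1) ≤ ((min n (N j) : ℕ) + 1 : ℝ) / (j + 1) := by
          gcongr
          exact_mod_cast (by omega : min (n + 1) (N j) ≤ min n (N j) + 1)
      _ = ((min n (N j) : ℕ) : ℝ) / (j + 1) + 1 / (j + 1) := add_div _ _ _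
      _ ≤ sparseGrowth N n + 1 / (J + 1) := by
          have := le_sparseGrowth N n j
          gcongr

theorem tendsto_sparseGrowth_succ_sub :
    Tendsto (fun n => sparseGrowth N (n + 1) - sparseGrowth N n) atTop (𝓝 0) := by
  have hnonneg n : 0 ≤ sparseGrowth N (n + 1) - sparseGrowth N n :=
    sub_nonneg.2 (sparseGrowth_mono N n.le_succ)
  rw [Metric.tendsto_atTop]
  intro ε hε
  obtain ⟨J, hJ⟩ := exists_nat_one_div_lt hε
  refine ⟨∑ j ∈ Finset.range J, N j, fun n hn => ?_⟩
  have hle := sparseGrowth_succ_le N (J := J) (n := n) fun j hj =>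
    (Finset.single_le_sum (fun _ _ => Nat.zero_le _) (Finset.mem_range.2 hj)).trans hn
  rw [Real.dist_eq, sub_zero, abs_of_nonneg (hnonneg n)]
  linarith

theorem exists_slowlyIncreasing_ge : ∃ c : ℕ → ℝ, SlowlyIncreasing c ∧
    ∀ j, (N j + 1 : ℝ) * Real.exp (N j / (j + 1)) ≤ c (N j) := by
  refine ⟨_, slowlyIncreasing_mul_exp (sparseGrowth_nonneg N) (sparseGrowth_mono N)
    (tendsto_sparseGrowth_succ_sub N), fun j => ?_⟩
  have hle := le_sparseGrowth N (N j) j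
  rw [min_self] at hle
  gcongr

theorem SlowlyIncreasing.exists_le_mul_pow {c : ℕ → ℝ} (hc : SlowlyIncreasing c) {r : ℝ}
    (hr : 1 < r) : ∃ C : ℝ, 0 < C ∧ ∀ n, c n ≤ C * r ^ n := by
  obtain ⟨m, hm⟩ := hc.exists_le 1 (sub_pos.2 hr)
  obtain ⟨hpos, hmono, -, -⟩ := hc
  refine ⟨c m, hpos m, fun n => ?_⟩
  induction n with
  | zero => simpa using hmono (Nat.zero_le m)
  | succ n ih =>
    rcases le_or_gt m n with h | h
    · calc c (n + 1) ≤ r * c n := by simpa only [add_sub_cancel] using hm n h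
        _ ≤ r * (c m * r ^ n) := by gcongr
        _ = c m * r ^ (n + 1) := by ring
    · exact (hmono (by omega)).trans (le_mul_of_one_le_right (hpos m).le (one_le_pow₀ hr.le))

end SlowSequences

section CriticalExponent

theorem tsum_ofReal_mul_pow_ne_top {C r : ℝ} (hC : 0 ≤ C) (hr₀ : 0 ≤ r) (hr₁ : r < 1) :
    ∑' n : ℕ, ENNReal.ofReal (C * r ^ n) ≠ ⊤ := by
  rw [← ENNReal.ofReal_tsum_of_nonneg (fun n => by positivity)
    ((summable_geometric_of_lt_one hr₀ hr₁).mul_left C)]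
  exact ENNReal.ofReal_ne_top

theorem tsum_const_length_eq {S : Type*} [Finite S] (n : ℕ) (k : ℝ≥0∞) :
    ∑' _ : {v : List S | v.length = n}, k = Nat.card S ^ n * k := by
  have := Fintype.ofFinite S
  change ∑' _ : List.Vector S n, k = _
  rw [tsum_fintype, Finset.sum_const, Finset.card_univ, card_vector, nsmul_eq_mul,
    Nat.card_eq_fintype_card, Nat.cast_pow]

namespace WordSystem

variable {S G : Type*} [Group G] {M : WordSystem S G} {c : ℕ → ℝ} {t t₀ : ℝ}

theorem gibbs_rescale (ht : 0 < t) (ht₀ : 0 < t₀) (v : List S) :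
    M.gibbs t v = (t₀ / t) ^ v.length * M.gibbs t₀ v := by
  simp only [gibbs, scaledWeight, div_pow]
  field_simp

variable (M) in
/-- The parameters at which the series `∑_v t^{-|v|} R_{|v|}(v x) ψ(𝔰(v))` converges. -/
def convSet : Set ℝ := {t | 0 < t ∧ M.wordSum (fun _ => 1) t ≠ ⊤}

variable (M) in
/-- The abscissa of convergence of the series `∑_v t^{-|v|} R_{|v|}(v x) ψ(𝔰(v))`; for the
coefficients of `f` this is `γ(f)`. -/
def critExp : ℝ := sInf M.convSet

theorem infinite_words_wordProd_eq_one (M : WordSystem S G) :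
    {v | v ∈ M.Words ∧ wordProd M.s v = 1}.Infinite := by
  obtain ⟨e, he, hAa⟩ := M.link M.A M.a M.admissible_A M.admissible_a ((M.s M.A)⁻¹ * (M.s M.a)⁻¹)
  obtain ⟨w, hw, haA⟩ := M.link M.a M.A M.admissible_a M.admissible_A 1
  have hloop : [M.A] ++ (e ++ [M.a]) ∈ M.Words :=
    append_append_mem_words rfl rfl M.admissible_A hAa rfl rfl M.concat_a_mem
  have hloop_prod : wordProd M.s ([M.A] ++ (e ++ [M.a])) = 1 := by
    simp [wordProd_append, wordProd_cons, he]
  refine Set.Infinite.of_image List.length (Set.infinite_of_forall_exists_gt fun k => ?_)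
  induction k with
  | zero => exact ⟨_, ⟨_, ⟨hloop, hloop_prod⟩, rfl⟩, by simp⟩
  | succ k ih =>
    obtain ⟨-, ⟨v, ⟨hv, hv_prod⟩, rfl⟩, hlt⟩ := ih
    refine ⟨_, ⟨_, ⟨Words.join hloop haA hv, ?_⟩, rfl⟩, ?_⟩
    · rw [wordProd_append _ _ (w ++ v), hloop_prod, wordProd_append, hw, hv_prod, one_mul, one_mul]
    · simp only [List.length_append, List.length_singleton]
      omega

theorem lo_le_of_mem_convSet (ht : t ∈ M.convSet) : M.lo ≤ t := by
  by_contra! hlt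
  have hweight (v : List S) : 1 ≤ M.scaledWeight t v M.x := by
    have ht₀ := ht.1
    rw [scaledWeight, ← div_eq_inv_mul, one_le_div (by positivity)]
    exact (pow_le_pow_left₀ ht₀.le hlt.le _).trans (pow_le_birkhoffProd M.lo_pos.le M.lo_le _ _)
  have := M.infinite_words_wordProd_eq_one.to_subtype
  have hψ : ENNReal.ofReal (M.ψ 1) ≠ 0 := by simpa using M.ψ_one_pos
  refine ht.2 (top_le_iff.1 ?_)
  calc ⊤ = ∑' _ : {v | v ∈ M.Words ∧ wordProd M.s v = 1}, ENNReal.ofReal (M.ψ 1) :=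
        (ENNReal.tsum_const_eq_top_of_ne_zero hψ).symm
    _ ≤ M.wordSum (fun _ => 1) t :=
        tsum_le_tsum_of_injOn (f := fun _ => ENNReal.ofReal (M.ψ 1)) id (fun v hv => hv.1)
          Function.injective_id.injOn fun v hv => by
            rw [id, wordTerm, mul_one, gibbs, hv.2]
            exact ENNReal.ofReal_le_ofReal (le_mul_of_one_le_left (M.ψ_nonneg _) (hweight v))

variable (M) in
/-- The contribution of the words of length `n` to the series
`∑_v t^{-|v|} R_{|v|}(v x) ψ(𝔰(v))`. -/
def level (t : ℝ) (n : ℕ) : ℝ≥0∞ :=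
  ∑' v : {v | v ∈ M.Words ∧ v.length = n}, ENNReal.ofReal (M.gibbs t v)

theorem wordSum_one_le_tsum_level (t : ℝ) :
    M.wordSum (fun _ => 1) t ≤ ∑' n, M.level t n := by
  have hcover : M.Words ⊆ ⋃ n : ℕ, {v | v ∈ M.Words ∧ v.length = n} :=
    fun v hv => Set.mem_iUnion.2 ⟨_, hv, rfl⟩
  simp only [wordSum, wordTerm, mul_one, level]
  exact (ENNReal.tsum_mono_subtype (fun v => ENNReal.ofReal (M.gibbs t v)) hcover).trans
    (ENNReal.tsum_iUnion_le_tsum (fun v => ENNReal.ofReal (M.gibbs t v)) _)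

theorem mul_level_le_wordSum (hpos : ∀ n, 0 ≤ c n) (t : ℝ) (n : ℕ) :
    ENNReal.ofReal (c n) * M.level t n ≤ M.wordSum c t := by
  rw [level, ← ENNReal.tsum_mul_left]
  refine tsum_le_tsum_of_injOn (s := {v | v ∈ M.Words ∧ v.length = n}) (t := M.Words)
    (f := fun v => ENNReal.ofReal (c n) * ENNReal.ofReal (M.gibbs t v)) id
    (fun v hv => hv.1) Function.injective_id.injOn ?_
  rintro v ⟨-, rfl⟩
  rw [← ENNReal.ofReal_mul (hpos _), id, wordTerm, mul_comm]

theorem level_rescale (ht : 0 < t) (ht₀ : 0 < t₀) (n : ℕ) :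
    M.level t n = ENNReal.ofReal ((t₀ / t) ^ n) * M.level t₀ n := by
  rw [level, level, ← ENNReal.tsum_mul_left]
  refine tsum_congr fun v => ?_
  rw [← ENNReal.ofReal_mul (by positivity), gibbs_rescale ht ht₀, v.2.2]

theorem level_le [Finite S] (ht : 0 < t) (n : ℕ) :
    M.level t n ≤ ENNReal.ofReal (M.ψbound * (Nat.card S * M.hi / t) ^ n) := by
  have hgibbs : ∀ v ∈ {v | v ∈ M.Words ∧ v.length = n},
      ENNReal.ofReal (M.gibbs t v) ≤ ENNReal.ofReal ((t ^ n)⁻¹ * M.hi ^ n * M.ψbound) := by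
    rintro v ⟨-, rfl⟩
    have hweight : wordWeight M.R v M.x ≤ M.hi ^ v.length :=
      birkhoffProd_le_pow (fun y => (M.R_pos y).le) M.le_hi _ _
    have hψ := M.ψ_nonneg (wordProd M.s v)
    have hscaled := scaledWeight_pos (M := M) ht v M.x
    rw [gibbs]
    refine ENNReal.ofReal_le_ofReal (mul_le_mul ?_ (M.ψ_le _) hψ ?_)
    · rw [scaledWeight]
      gcongr
    · exact hscaled.le.trans (by rw [scaledWeight]; gcongr)
  calc M.level t n
      ≤ ∑' _ : {v : List S | v.length = n}, ENNReal.ofReal ((t ^ n)⁻¹ * M.hi ^ n * M.ψbound) :=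
        tsum_le_tsum_of_injOn (f := fun v => ENNReal.ofReal (M.gibbs t v))
          (g := fun _ => ENNReal.ofReal ((t ^ n)⁻¹ * M.hi ^ n * M.ψbound)) id
          (fun v hv => hv.2) Function.injective_id.injOn hgibbs
    _ = ENNReal.ofReal (M.ψbound * (Nat.card S * M.hi / t) ^ n) := by
        rw [tsum_const_length_eq, ← ENNReal.ofReal_natCast, ← ENNReal.ofReal_pow (by positivity),
          ← ENNReal.ofReal_mul (by positivity), div_pow, mul_pow]
        congr 1
        ring

theorem mem_convSet_of_level_le [Finite S] (ht : 0 < t) {C r : ℝ} (hC : 0 ≤ C) (hr₀ : 0 ≤ r)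
    (hr₁ : r < 1) (k : ℕ) (h : ∀ n, k ≤ n → M.level t n ≤ ENNReal.ofReal (C * r ^ n)) :
    t ∈ M.convSet := by
  refine ⟨ht, ne_top_of_le_ne_top ?_ (M.wordSum_one_le_tsum_level t)⟩
  rw [← ENNReal.summable.sum_add_tsum_nat_add' (k := k)]
  refine ENNReal.add_ne_top.2 ⟨ENNReal.sum_ne_top.2 fun n _ =>
    ne_top_of_le_ne_top ENNReal.ofReal_ne_top (level_le ht n), ?_⟩
  exact ne_top_of_le_ne_top (tsum_ofReal_mul_pow_ne_top hC hr₀ hr₁)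
    ((ENNReal.tsum_le_tsum fun n => h (n + k) (Nat.le_add_left k n)).trans
      (ENNReal.tsum_comp_le_tsum_of_injective (add_left_injective k) _))

theorem ψbound_nonneg (M : WordSystem S G) : 0 ≤ M.ψbound := (M.ψ_nonneg 1).trans (M.ψ_le 1)

theorem convSet_nonempty [Finite S] (M : WordSystem S G) : M.convSet.Nonempty := by
  have : Nonempty S := ⟨M.a⟩
  have hhi : 0 < M.hi := (M.R_pos M.x).trans_le (M.le_hi _)
  have hS : (0 : ℝ) < Nat.card S := by exact_mod_cast Nat.card_pos
  have ht : 0 < 2 * (Nat.card S * M.hi) := by positivity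
  have hratio : Nat.card S * M.hi / (2 * (Nat.card S * M.hi)) = 1 / 2 := by field_simp
  refine ⟨_, mem_convSet_of_level_le ht M.ψbound_nonneg one_half_pos.le one_half_lt_one 0
    fun n _ => ?_⟩
  rw [← hratio]
  exact level_le ht n

theorem critExp_pos [Finite S] (M : WordSystem S G) : 0 < M.critExp :=
  M.lo_pos.trans_le (le_csInf M.convSet_nonempty fun _ => lo_le_of_mem_convSet)

theorem critExp_le_of_mem_convSet (ht : t ∈ M.convSet) : M.critExp ≤ t :=
  csInf_le ⟨0, fun _ h => h.1.le⟩ ht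

theorem wordSum_ne_top [Finite S] (hc : SlowlyIncreasing c) (ht : M.critExp < t) :
    M.wordSum c t ≠ ⊤ := by
  obtain ⟨t₀, ⟨ht₀, hfin⟩, hlt⟩ := exists_lt_of_csInf_lt M.convSet_nonempty ht
  have htpos := ht₀.trans hlt
  obtain ⟨C, hC0, hC⟩ := hc.exists_le_mul_pow ((one_lt_div ht₀).2 hlt)
  refine ne_top_of_le_ne_top (ENNReal.mul_ne_top ENNReal.ofReal_ne_top hfin)
    (b := ENNReal.ofReal C * M.wordSum (fun _ => 1) t₀) ?_
  rw [wordSum, wordSum, ← ENNReal.tsum_mul_left]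
  refine ENNReal.tsum_le_tsum fun v => ?_
  rw [wordTerm, wordTerm, ← ENNReal.ofReal_mul hC0.le, mul_one, gibbs_rescale htpos ht₀]
  refine ENNReal.ofReal_le_ofReal ?_
  have hgibbs := gibbs_nonneg (M := M) ht₀ v
  calc (t₀ / t) ^ (v : List S).length * M.gibbs t₀ v * c (v : List S).length
      ≤ (t₀ / t) ^ (v : List S).length * M.gibbs t₀ v *
          (C * (t / t₀) ^ (v : List S).length) := by
        gcongr
        exact hC _
    _ = C * M.gibbs t₀ v := by
        simp only [div_pow]
        field_simp

theorem cutWeight_le_rescale (hpos : ∀ n, 0 ≤ c n) (ht₀ : 0 < t₀) (ht : t₀ ≤ t)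
    (z : List S × List S) :
    M.cutWeight c t z ≤ ENNReal.ofReal ((t₀ / t) ^ z.2.length) * M.cutWeight c t₀ z := by
  have htpos := ht₀.trans_le ht
  rw [cutWeight, cutWeight, gibbs_rescale htpos ht₀, ← ENNReal.ofReal_mul (by positivity),
    mul_assoc]
  refine ENNReal.ofReal_le_ofReal (mul_le_mul_of_nonneg_right ?_
    (mul_nonneg (gibbs_nonneg ht₀ _) (mul_nonneg (hpos _) (hpos _))))
  exact pow_le_pow_of_le_one (by positivity) ((div_le_one htpos).2 ht) (by simp)

theorem cutSum_one_ne_top [Finite S] (hc : SlowlyIncreasing c) (ht : M.critExp < t) :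
    M.cutSum c t (fun _ => 1) ≠ ⊤ := by
  have hpos n := (hc.1 n).le
  obtain ⟨t₀, hcrit, hlt⟩ := exists_between ht
  have ht₀ := M.critExp_pos.trans hcrit
  have htpos := ht₀.trans hlt
  obtain ⟨r, hr₁, hr⟩ := exists_between ((one_lt_div ht₀).2 hlt)
  have hr₀ := zero_lt_one.trans hr₁
  obtain ⟨C, hC₀, hC⟩ := hc.exists_le_mul_pow hr₁
  have hratio : t₀ / t * r < 1 := by
    rw [lt_div_iff₀ ht₀] at hr
    rwa [div_mul_eq_mul_div, div_lt_one htpos, mul_comm]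
  have hcover : M.Cuts ⊆ ⋃ i : ℕ, {z | z ∈ M.Cuts ∧ z.2.length = i} :=
    fun z hz => Set.mem_iUnion.2 ⟨_, hz, rfl⟩
  have hlevel i : ∑' z : {z | z ∈ M.Cuts ∧ z.2.length = i}, M.cutWeight c t z ≤
      ENNReal.ofReal (C * (t₀ / t * r) ^ i) * M.wordSum c t₀ :=
    calc _ ≤ ENNReal.ofReal ((t₀ / t) ^ i) *
          ∑' z : {z | z ∈ M.Cuts ∧ z.2.length = i}, M.cutWeight c t₀ z := by
          rw [← ENNReal.tsum_mul_left]
          refine ENNReal.tsum_le_tsum fun z => ?_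
          simpa only [z.2.2] using M.cutWeight_le_rescale hpos ht₀ hlt.le z
      _ ≤ ENNReal.ofReal ((t₀ / t) ^ i) * (ENNReal.ofReal (C * r ^ i) * M.wordSum c t₀) := by
          gcongr
          exact (tsum_cutWeight_length_eq_le hpos hc.2.1 ht₀ i).trans (by gcongr; exact hC i)
      _ = _ := by
          rw [← mul_assoc, ← ENNReal.ofReal_mul (by positivity), mul_pow, mul_left_comm]
  simp only [cutSum, cutTerm, mul_one]
  refine ne_top_of_le_ne_top (ENNReal.mul_ne_top (tsum_ofReal_mul_pow_ne_top hC₀.le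
    (by positivity) hratio) (wordSum_ne_top hc hcrit)) ?_
  rw [← ENNReal.tsum_mul_right]
  exact ((ENNReal.tsum_mono_subtype _ hcover).trans (ENNReal.tsum_iUnion_le_tsum _ _)).trans
    (ENNReal.tsum_le_tsum hlevel)

theorem exists_le_level_critExp [Finite S] (M : WordSystem S G) {r : ℝ} (hr₀ : 0 < r)
    (hr₁ : r < 1) (k : ℕ) : ∃ n, k ≤ n ∧ ENNReal.ofReal (r ^ n) ≤ M.level M.critExp n := by
  by_contra! hlt
  obtain ⟨q, hrq, hq₁⟩ := exists_between hr₁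
  have hq₀ := hr₀.trans hrq
  have hcrit := M.critExp_pos
  have hmem : M.critExp * q ∈ M.convSet := by
    refine mem_convSet_of_level_le (by positivity) zero_le_one (by positivity)
      ((div_lt_one hq₀).2 hrq) k fun n hn => ?_
    calc M.level (M.critExp * q) n
        = ENNReal.ofReal (q⁻¹ ^ n) * M.level M.critExp n := by
          rw [level_rescale (by positivity) hcrit, div_mul_cancel_left₀ hcrit.ne']
      _ ≤ ENNReal.ofReal (q⁻¹ ^ n) * ENNReal.ofReal (r ^ n) := by
          gcongr
          exact (hlt n hn).le
      _ = ENNReal.ofReal (1 * (r / q) ^ n) := by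
          rw [← ENNReal.ofReal_mul (by positivity), ← mul_pow, inv_mul_eq_div, one_mul]
  exact (mul_lt_of_lt_one_right hcrit hq₁).not_ge (critExp_le_of_mem_convSet hmem)

theorem exists_slowlyIncreasing_wordSum_eq_top [Finite S] (M : WordSystem S G) :
    ∃ c : ℕ → ℝ, SlowlyIncreasing c ∧ M.wordSum c M.critExp = ⊤ := by
  choose N hjN hlevel using fun j : ℕ => M.exists_le_level_critExp
    (Real.exp_pos (-(1 / (j + 1 : ℝ))))
    (Real.exp_lt_one_iff.2 (neg_lt_zero.2 (by positivity))) j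
  obtain ⟨c, hc, hcN⟩ := exists_slowlyIncreasing_ge N
  refine ⟨c, hc, ENNReal.eq_top_of_forall_nnreal_le fun r => ?_⟩
  obtain ⟨j, hj⟩ := exists_nat_ge (r : ℝ)
  have hNj : (j : ℝ) ≤ N j := by exact_mod_cast hjN j
  have hr : (r : ℝ) ≤ c (N j) * Real.exp (-(1 / (j + 1 : ℝ))) ^ N j := by
    rw [← Real.exp_nat_mul]
    calc (r : ℝ) ≤ N j + 1 := by linarith
      _ = (N j + 1 : ℝ) * Real.exp (N j / (j + 1)) * Real.exp (N j * -(1 / (j + 1 : ℝ))) := by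
          rw [mul_assoc, ← Real.exp_add, mul_neg, mul_one_div, add_neg_cancel, Real.exp_zero,
            mul_one]
      _ ≤ _ := by gcongr; exact hcN j
  calc (r : ℝ≥0∞) = ENNReal.ofReal r := ENNReal.ofReal_coe_nnreal.symm
    _ ≤ ENNReal.ofReal (c (N j)) * ENNReal.ofReal (Real.exp (-(1 / (j + 1 : ℝ))) ^ N j) := by
        rw [← ENNReal.ofReal_mul (hc.1 _).le]
        exact ENNReal.ofReal_le_ofReal hr
    _ ≤ ENNReal.ofReal (c (N j)) * M.level M.critExp (N j) := by gcongr; exact hlevel j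
    _ ≤ M.wordSum c M.critExp := mul_level_le_wordSum (fun n => (hc.1 n).le) _ _

theorem tendsto_wordSum_top [Finite S] (htop : M.wordSum c M.critExp = ⊤) :
    Tendsto (M.wordSum c) (𝓝[>] M.critExp) (𝓝 ⊤) := by
  rw [ENNReal.tendsto_nhds_top_iff_nnreal]
  intro r
  have hlt : (r : ℝ≥0∞) < M.wordSum c M.critExp := htop ▸ ENNReal.coe_lt_top
  rw [wordSum, ENNReal.tsum_eq_iSup_sum, lt_iSup_iff] at hlt
  obtain ⟨F, hF⟩ := hlt
  have hcont : ContinuousAt (fun t => ∑ v ∈ F, M.wordTerm c t v) M.critExp := by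
    refine tendsto_finsetSum _ fun v _ => (ENNReal.continuous_ofReal.tendsto _).comp ?_
    have hinv : ContinuousAt (fun t : ℝ => (t ^ (v : List S).length)⁻¹) M.critExp :=
      ContinuousAt.inv₀ (by fun_prop) (pow_pos M.critExp_pos _).ne'
    exact ((hinv.tendsto.mul_const _).mul_const _).mul_const _
  filter_upwards [nhdsWithin_le_nhds (hcont.eventually (lt_mem_nhds hF))] with t ht
  exact ht.trans_le (ENNReal.sum_le_tsum F)

end WordSystem

end CriticalExponent

section Topology

variable {S : Type*} {τ : S → S → Prop}

/-- The shift as a self-map of the Markov shift. -/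
def shiftOn (τ : S → S → Prop) (y : markovShift τ) : markovShift τ :=
  ⟨shift y, shift_mem_markovShift y.2⟩

theorem coe_shiftOn_iterate (n : ℕ) (y : markovShift τ) :
    ((shiftOn τ)^[n] y : ℕ → S) = shift^[n] (y : ℕ → S) := by
  induction n generalizing y with
  | zero => rfl
  | succ n ih => rw [Function.iterate_succ_apply, Function.iterate_succ_apply, ih]; rfl

variable [TopologicalSpace S]

theorem continuous_shift : Continuous (shift : (ℕ → S) → ℕ → S) :=
  continuous_pi fun i => continuous_apply (i + 1)

theorem continuous_shiftOn (τ : S → S → Prop) : Continuous (shiftOn τ) :=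
  (continuous_shift.comp continuous_subtype_val).subtype_mk _

theorem continuous_birkhoffProd {R : (ℕ → S) → ℝ}
    (hR : Continuous fun y : markovShift τ => R y) (n : ℕ) :
    Continuous fun y : markovShift τ => birkhoffProd R n y := by
  refine continuous_finsetProd _ fun i _ => ?_
  have := hR.comp ((continuous_shiftOn τ).iterate i)
  simpa only [Function.comp_def, coe_shiftOn_iterate] using this

variable [DiscreteTopology S]

theorem isClosed_markovShift (τ : S → S → Prop) : IsClosed (markovShift τ) := by
  have : markovShift τ = ⋂ i, (fun y : ℕ → S => (y i, y (i + 1))) ⁻¹' {p | τ p.1 p.2} := by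
    ext y; simp [markovShift]
  rw [this]
  exact isClosed_iInter fun i => (isClosed_discrete _).preimage (by fun_prop)

instance instCompactSpaceMarkovShift [Finite S] (τ : S → S → Prop) :
    CompactSpace (markovShift τ) :=
  isCompact_iff_compactSpace.1 (isClosed_markovShift τ).isCompact

theorem isClopen_cyl (w : List S) : IsClopen (cyl w) := by
  have : cyl w = ⋂ i : Fin w.length, (fun y : ℕ → S => y i) ⁻¹' {w[i]} := by
    ext y
    simp only [cyl, Set.mem_ofPred_eq, Set.mem_iInter, Set.mem_preimage, Set.mem_singleton_iff]
    exact ⟨fun h i => h i i.2, fun h i hi => h ⟨i, hi⟩⟩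
  rw [this]
  exact isClopen_iInter_of_finite fun i => (isClopen_discrete _).preimage (continuous_apply _)

theorem isOpen_setOf_forall_lt_eq (y : ℕ → S) (n : ℕ) :
    IsOpen {z : ℕ → S | ∀ i < n, z i = y i} := by
  have : {z : ℕ → S | ∀ i < n, z i = y i} =
      ⋂ i ∈ Finset.range n, (fun z : ℕ → S => z i) ⁻¹' {y i} := by
    ext z; simp
  rw [this]
  exact isOpen_biInter_finset fun i _ => (isOpen_discrete _).preimage (continuous_apply i)

theorem LogHolder.continuous {R : (ℕ → S) → ℝ} {θ : ℝ} (hHol : LogHolder τ R θ) (hθ₀ : 0 < θ)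
    (hθ₁ : θ < 1) (hR : ∀ y ∈ markovShift τ, 0 < R y) :
    Continuous fun y : markovShift τ => R y := by
  obtain ⟨K, hK⟩ := hHol
  suffices hlog : Continuous fun y : markovShift τ => Real.log (R y) from
    (Real.continuous_exp.comp hlog).congr fun y => Real.exp_log (hR y y.2)
  refine continuous_iff_continuousAt.2 fun y => Metric.tendsto_nhds.2 fun ε hε => ?_
  have hlim : Tendsto (fun n : ℕ => K * θ ^ n) atTop (𝓝 0) := by
    simpa using (tendsto_pow_atTop_nhds_zero_of_lt_one hθ₀.le hθ₁).const_mul K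
  obtain ⟨n, hn, hn₁⟩ := ((hlim.eventually (gt_mem_nhds hε)).and (eventually_gt_atTop 1)).exists
  have hopen := (isOpen_setOf_forall_lt_eq (y : ℕ → S) n).preimage
    (continuous_subtype_val (p := (· ∈ markovShift τ)))
  filter_upwards [hopen.mem_nhds fun i _ => rfl] with z hz
  exact (hK n hn₁ z z.2 y y.2 hz).trans_lt hn

theorem exists_continuousMap_eq_indicator_cyl (w : List S) {f : (ℕ → S) → ℝ}
    (hf : Continuous fun y : markovShift τ => f y) :
    ∃ Φ : C(markovShift τ, NNReal), ∀ y : markovShift τ,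
      (cyl w).indicator (fun y => ENNReal.ofReal (f y)) y = Φ y := by
  have hcont : Continuous ((Subtype.val ⁻¹' cyl w).indicator
      fun y : markovShift τ => Real.toNNReal (f y)) :=
    ((isClopen_cyl w).preimage continuous_subtype_val).continuous_indicator
      (continuous_real_toNNReal.comp hf)
  refine ⟨⟨_, hcont⟩, fun y => ?_⟩
  by_cases h : (y : ℕ → S) ∈ cyl w <;> simp [h, ENNReal.ofReal]

end Topology

section WeakLimits

theorem exists_subseq_tendsto_of_mass_le {X : Type*} [TopologicalSpace X] [CompactSpace X]
    [TopologicalSpace.MetrizableSpace X] [MeasurableSpace X] [BorelSpace X] [Nonempty X]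
    (μ : ℕ → FiniteMeasure X) {C : NNReal} (hμ : ∀ k, (μ k).mass ≤ C) :
    ∃ (ν : FiniteMeasure X) (φ : ℕ → ℕ), StrictMono φ ∧ Tendsto (μ ∘ φ) atTop (𝓝 ν) := by
  obtain ⟨⟨π, m⟩, φ, hφ, hlim⟩ := CompactSpace.tendsto_subseq
    fun k => ((μ k).normalize, (⟨(μ k).mass, zero_le, hμ k⟩ : Set.Icc 0 C))
  have hπ : Tendsto (fun k => (μ (φ k)).normalize) atTop (𝓝 π) :=
    (continuous_fst.tendsto _).comp hlim
  have hm : Tendsto (fun k => (μ (φ k)).mass) atTop (𝓝 m) :=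
    ((continuous_subtype_val.comp continuous_snd).tendsto _).comp hlim
  refine ⟨(m : NNReal) • π.toFiniteMeasure, φ, hφ, ?_⟩
  refine FiniteMeasure.tendsto_iff_forall_testAgainstNN_tendsto.2 fun f => ?_
  have hf := FiniteMeasure.tendsto_iff_forall_testAgainstNN_tendsto.1
    (ProbabilityMeasure.tendsto_nhds_iff_toFiniteMeasure_tendsto_nhds _ |>.1 hπ) f
  rw [FiniteMeasure.smul_testAgainstNN_apply]
  exact (hm.mul hf).congr fun k => ((μ (φ k)).testAgainstNN_eq_mass_mul f).symm

/-- Applied to `Φ` and to `B - Φ`, where `B` bounds `Φ`, the inequality becomes an equality. -/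
theorem measurePreserving_of_lintegral_comp_le {X : Type*} [TopologicalSpace X] [CompactSpace X]
    [HasOuterApproxClosed X] [MeasurableSpace X] [BorelSpace X] {T : X → X} (hT : Continuous T)
    {ν : Measure X} [IsFiniteMeasure ν]
    (h : ∀ Φ : C(X, NNReal), ∫⁻ y, Φ (T y) ∂ν ≤ ∫⁻ y, Φ y ∂ν) : MeasurePreserving T ν ν := by
  suffices heq : ∀ Φ : C(X, NNReal), ∫⁻ y, Φ y ∂ν.map T = ∫⁻ y, Φ y ∂ν from
    ⟨hT.measurable, ext_of_forall_lintegral_eq_of_IsFiniteMeasure fun Φ => heq Φ.toContinuousMap⟩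
  intro Φ
  have hmeas : ∀ Ψ : C(X, NNReal), Measurable fun y => (Ψ y : ℝ≥0∞) := fun Ψ =>
    measurable_coe_nnreal_ennreal.comp Ψ.continuous.measurable
  have hfin : ∀ Ψ : C(X, NNReal), ∫⁻ y, Ψ y ∂ν ≠ ⊤ := fun Ψ =>
    ((BoundedContinuousFunction.mkOfCompact Ψ).lintegral_lt_top_of_nnreal ν).ne
  obtain ⟨B, hB⟩ := (isCompact_range Φ.continuous).bddAbove
  let Ψ : C(X, NNReal) := ⟨fun y => B - Φ y, continuous_const.sub Φ.continuous⟩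
  have hΦΨ : ∀ y, (Φ y : ℝ≥0∞) + Ψ y = B := fun y => by
    rw [← ENNReal.coe_add]
    exact congrArg _ (add_tsub_cancel_of_le (hB ⟨y, rfl⟩))
  have hsum : ∫⁻ y, Φ y ∂ν + ∫⁻ y, Ψ y ∂ν = ∫⁻ y, Φ (T y) ∂ν + ∫⁻ y, Ψ (T y) ∂ν := by
    have hΦT : Measurable fun y => (Φ (T y) : ℝ≥0∞) := (hmeas Φ).comp hT.measurable
    rw [← lintegral_add_left (hmeas Φ), ← lintegral_add_left hΦT]
    simp only [hΦΨ]
  rw [lintegral_map (hmeas Φ) hT.measurable]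
  refine (h Φ).antisymm (ENNReal.le_of_add_le_add_right (hfin (Ψ.comp ⟨T, hT⟩)) ?_)
  exact (add_le_add le_rfl (h Ψ)).trans_eq hsum

theorem le_limsup_of_tendsto_of_le {u v : ℕ → ℝ} {l : ℝ} (hv : Bornology.IsBounded (Set.range v))
    (hu : Tendsto u atTop (𝓝 l)) (h : ∀ k, u k ≤ v k) : l ≤ limsup v atTop := by
  rw [← hu.limsup_eq]
  exact limsup_le_limsup (Eventually.of_forall h) hu.isBoundedUnder_ge.isCoboundedUnder_le
    hv.bddAbove.isBoundedUnder_of_range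

theorem limsup_le_of_tendsto_of_le {u v : ℕ → ℝ} {l : ℝ} (hv : Bornology.IsBounded (Set.range v))
    (hu : Tendsto u atTop (𝓝 l)) (h : ∀ k, v k ≤ u k) : limsup v atTop ≤ l := by
  rw [← hu.limsup_eq]
  exact limsup_le_limsup (Eventually.of_forall h)
    hv.bddBelow.isBoundedUnder_of_range.isCoboundedUnder_le hu.isBoundedUnder_le

theorem limsup_const_mul_of_isBounded {v : ℕ → ℝ} (hv : Bornology.IsBounded (Set.range v)) {E : ℝ}
    (hE : 0 ≤ E) : limsup (fun k => E * v k) atTop = E * limsup v atTop :=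
  ((monotone_mul_left_of_nonneg hE).map_limsup_of_continuousAt v
    (continuous_const_mul E).continuousAt hv.bddAbove.isBoundedUnder_of_range
    hv.bddBelow.isBoundedUnder_of_range.isCoboundedUnder_le).symm

theorem le_of_forall_pos_le_one_add_mul {X Y : ℝ} (h : ∀ ε > 0, X ≤ (1 + ε) * Y) : X ≤ Y := by
  have hlim : Tendsto (fun ε : ℝ => (1 + ε) * Y) (𝓝[>] 0) (𝓝 ((1 + 0) * Y)) :=
    (((continuous_const_add (1 : ℝ)).mul_const Y).tendsto 0).mono_left nhdsWithin_le_nhds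
  rw [add_zero, one_mul] at hlim
  exact ge_of_tendsto hlim (eventually_nhdsWithin_of_forall h)

end WeakLimits

section Comparison

theorem toReal_div_le {X Y W : ℝ≥0∞} {a b p : ℝ} (ha : 0 ≤ a) (hb : 0 ≤ b) (hp : 0 ≤ p)
    (hY : Y ≠ ⊤) (hW : W ≠ ⊤) (h : X ≤ ENNReal.ofReal a * Y + ENNReal.ofReal b * W) :
    X.toReal / p ≤ a * (Y.toReal / p) + b * (W.toReal / p) := by
  have hY' := ENNReal.mul_ne_top (ENNReal.ofReal_ne_top (r := a)) hY
  have hW' := ENNReal.mul_ne_top (ENNReal.ofReal_ne_top (r := b)) hW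
  have hle := ENNReal.toReal_mono (ENNReal.add_ne_top.2 ⟨hY', hW'⟩) h
  rw [ENNReal.toReal_add hY' hW', ENNReal.toReal_mul, ENNReal.toReal_mul,
    ENNReal.toReal_ofReal ha, ENNReal.toReal_ofReal hb] at hle
  rw [← mul_div_assoc, ← mul_div_assoc, ← add_div]
  exact div_le_div_of_nonneg_right hle hp

namespace WordSystem

variable {S G : Type*} [Group G] {M : WordSystem S G} {c : ℕ → ℝ} {t : ℝ} {F : (ℕ → S) → ℝ≥0∞}

theorem cutSum_le_mul {B : ℝ≥0∞} (hF : ∀ y, F y ≤ B) :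
    M.cutSum c t F ≤ B * M.cutSum c t (fun _ => 1) := by
  rw [cutSum, cutSum, ← ENNReal.tsum_mul_left]
  refine ENNReal.tsum_le_tsum fun z => ?_
  rw [cutTerm, cutTerm, mul_one, mul_comm]
  exact mul_le_mul_left (hF _) _

theorem cutSum_ne_top [Finite S] (hc : SlowlyIncreasing c) (ht : M.critExp < t) {B : ℝ}
    (hF : ∀ y, F y ≤ ENNReal.ofReal B) : M.cutSum c t F ≠ ⊤ :=
  ne_top_of_le_ne_top (ENNReal.mul_ne_top ENNReal.ofReal_ne_top (cutSum_one_ne_top hc ht))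
    (cutSum_le_mul hF)

theorem exists_pairSum_le_cutSum_one (M : WordSystem S G) (g : G) {t₁ : ℝ} (ht₁ : 0 < t₁) :
    ∃ C, 0 ≤ C ∧ ∀ c : ℕ → ℝ, (∀ n, 0 ≤ c n) → Monotone c → ∀ t, 0 < t → t ≤ t₁ →
      M.pairSum c t g ≤ ENNReal.ofReal C * M.cutSum c t (fun _ => 1) := by
  obtain ⟨w, rfl, hw⟩ := M.link _ _ M.admissible_a M.admissible_A g
  have hD := M.D_nonneg
  have hlo := M.lo_pos
  refine ⟨M.D ^ (M.θ ^ wedge w M.x) * (t₁ ^ w.length * (M.lo ^ w.length)⁻¹), by positivity,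
    fun c hpos hmono t ht htt => (pairSum_le_cutSum_midWeight hpos hmono ht hw).trans ?_⟩
  rw [ENNReal.ofReal_mul (by positivity), ENNReal.ofReal_mul (by positivity), mul_assoc, mul_assoc]
  gcongr
  exact cutSum_le_mul (M.midWeight_le w)

theorem pairSum_ne_top [Finite S] (hc : SlowlyIncreasing c) (ht : M.critExp < t) (g : G) :
    M.pairSum c t g ≠ ⊤ := by
  have ht₀ := M.critExp_pos.trans ht
  obtain ⟨C, -, hC⟩ := M.exists_pairSum_le_cutSum_one g ht₀
  exact ne_top_of_le_ne_top (ENNReal.mul_ne_top ENNReal.ofReal_ne_top (cutSum_one_ne_top hc ht))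
    (hC c (fun n => (hc.1 n).le) hc.2.1 t ht₀ le_rfl)

theorem pairSum_one_pos (hpos : ∀ n, 0 < c n) (ht : 0 < t) : 0 < M.pairSum c t 1 := by
  obtain ⟨u, hu, hu₁⟩ := M.infinite_words_wordProd_eq_one.nonempty
  refine lt_of_lt_of_le ?_ (ENNReal.le_tsum (f := fun z : (M.Words ×ˢ M.Words : Set _) =>
    M.pairTerm c t 1 z) ⟨(u, u), hu, hu⟩)
  have hW := M.scaledWeight_pos ht u M.x
  have hcu := hpos u.length
  have hψ := M.ψ_one_pos
  rw [pairTerm, ENNReal.ofReal_pos]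
  simp only [pairWeight, hu₁, mul_one]
  positivity

theorem toReal_pairSum_one_pos [Finite S] (hc : SlowlyIncreasing c) (ht : M.critExp < t) :
    0 < (M.pairSum c t 1).toReal :=
  ENNReal.toReal_pos (pairSum_one_pos hc.1 (M.critExp_pos.trans ht)).ne' (pairSum_ne_top hc ht 1)

section Ratios

variable (M c t)

/-- The limit of the quotients in the definition of `Υ` at the parameter `t`. -/
def pairRatio (g : G) : ℝ := (M.pairSum c t g).toReal / (M.pairSum c t 1).toReal

/-- The series `wordSum` in the normalisation of `pairRatio`. -/
def wordRatio : ℝ := (M.wordSum c t).toReal / (M.pairSum c t 1).toReal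

/-- The integrals `cutSum` in the normalisation of `pairRatio`. -/
def cutRatio (F : (ℕ → S) → ℝ≥0∞) : ℝ := (M.cutSum c t F).toReal / (M.pairSum c t 1).toReal

theorem pairRatio_nonneg (g : G) : 0 ≤ M.pairRatio c t g :=
  div_nonneg ENNReal.toReal_nonneg ENNReal.toReal_nonneg

end Ratios

theorem exists_cutRatio_one_le [Finite S] (M : WordSystem S G) {t₁ : ℝ} (ht₁ : 0 < t₁) :
    ∃ C, 0 ≤ C ∧ ∀ c : ℕ → ℝ, SlowlyIncreasing c → ∀ t, M.critExp < t → t ≤ t₁ →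
      M.cutRatio c t (fun _ => 1) ≤ c 1 * M.wordRatio c t + C := by
  obtain ⟨C, hC₀, hC⟩ := M.exists_tsum_splits_le ht₁
  refine ⟨C, hC₀, fun c hc t ht htt => ?_⟩
  have hpos := fun n => (hc.1 n).le
  have ht₀ := M.critExp_pos.trans ht
  have hP := toReal_pairSum_one_pos hc ht
  have h := toReal_div_le (hpos 1) hC₀ hP.le (wordSum_ne_top hc ht) (pairSum_ne_top hc ht 1)
    (cutSum_one_le hpos hc.2.1 ht₀ (hC c hpos hc.2.1 t ht₀ htt []))
  rwa [div_self hP.ne', mul_one] at h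

/-- Near the critical exponent a long word has many cuts: `k · wordSum ≤ cutSum + O(1)` for every
`k`, whereas `cutSum` is at most a multiple of `pairSum + wordSum`. -/
theorem tendsto_wordRatio [Finite S] (hc : SlowlyIncreasing c) (htop : M.wordSum c M.critExp = ⊤) :
    Tendsto (M.wordRatio c) (𝓝[>] M.critExp) (𝓝 0) := by
  have hγ := M.critExp_pos
  obtain ⟨C, hC₀, hC⟩ := M.exists_cutRatio_one_le (t₁ := M.critExp + 1) (by linarith)
  refine Metric.tendsto_nhds.2 fun ε hε => ?_
  obtain ⟨k, hk⟩ := exists_nat_gt (C / ε + c 1 + 1)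
  obtain ⟨E, hE⟩ := M.exists_mul_wordSum_le hc hγ k
  have hlarge : ∀ᶠ t in 𝓝[>] M.critExp, ENNReal.ofReal E < M.wordSum c t :=
    (tendsto_wordSum_top htop).eventually (lt_mem_nhds ENNReal.ofReal_lt_top)
  have hnear : ∀ᶠ t in 𝓝[>] M.critExp, t ∈ Set.Ioc M.critExp (M.critExp + 1) :=
    Ioc_mem_nhdsGT (by linarith)
  filter_upwards [hlarge, hnear] with t hEt ⟨ht, htt⟩
  have hP := toReal_pairSum_one_pos hc ht
  have hcut := cutSum_one_ne_top hc ht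
  have hW₀ : 0 < M.wordRatio c t :=
    div_pos (ENNReal.toReal_pos (pos_of_gt hEt).ne' (wordSum_ne_top hc ht)) hP
  have hkW : (k : ℝ) * M.wordRatio c t ≤ M.cutRatio c t (fun _ => 1) + M.wordRatio c t := by
    have h := toReal_div_le zero_le_one zero_le_one hP.le hcut (wordSum_ne_top hc ht)
      (X := k * M.wordSum c t) (by
        rw [ENNReal.ofReal_one, one_mul, one_mul]
        exact (hE t ht.le).trans (add_le_add le_rfl hEt.le))
    rwa [ENNReal.toReal_mul, ENNReal.toReal_natCast, one_mul, one_mul, mul_div_assoc] at h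
  have hCW : C / ε * M.wordRatio c t < C := by nlinarith [hC c hc t ht htt]
  rw [Real.dist_eq, sub_zero, abs_of_pos hW₀]
  rw [div_mul_eq_mul_div, div_lt_iff₀ hε] at hCW
  exact lt_of_mul_lt_mul_left hCW hC₀

theorem exists_parameters_cutRatio_one_le [Finite S] (M : WordSystem S G) :
    ∃ (c : ℕ → ℝ) (t : ℕ → ℝ) (C : NNReal), SlowlyIncreasing c ∧
      (∀ k, t k ∈ Set.Ioc M.critExp (M.critExp + 1)) ∧ Tendsto t atTop (𝓝 M.critExp) ∧
      Tendsto (fun k => M.wordRatio c (t k)) atTop (𝓝 0) ∧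
      ∀ k, M.cutRatio c (t k) (fun _ => 1) ≤ C := by
  obtain ⟨c, hc, htop⟩ := M.exists_slowlyIncreasing_wordSum_eq_top
  have hγ := M.critExp_pos
  obtain ⟨C, hC₀, hC⟩ := M.exists_cutRatio_one_le (t₁ := M.critExp + 1) (by linarith)
  have hword := tendsto_wordRatio hc htop
  have hnear : ∀ᶠ t in 𝓝[>] M.critExp, t ∈ Set.Ioc M.critExp (M.critExp + 1) :=
    Ioc_mem_nhdsGT (by linarith)
  obtain ⟨t, htlim, ht⟩ := exists_seq_forall_of_frequently
    (hnear.and (hword.eventually (gt_mem_nhds zero_lt_one))).frequently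
  refine ⟨c, t, ⟨c 1 + C, add_nonneg (hc.1 1).le hC₀⟩, hc, fun k => (ht k).1,
    (tendsto_nhdsWithin_iff.1 htlim).1, hword.comp htlim, fun k => ?_⟩
  refine (hC c hc (t k) (ht k).1.1 (ht k).1.2).trans (add_le_add ?_ le_rfl)
  exact mul_le_of_le_one_right (hc.1 1).le (ht k).2.le

end WordSystem

end Comparison

section Limit

namespace WordSystem

variable {S G : Type*} [Group G]

section ContinuousWeights

variable [TopologicalSpace S] [DiscreteTopology S] {M : WordSystem S G}

theorem exists_continuousMap_cylWeight (hR : Continuous fun y : markovShift M.τ => M.R y)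
    (w : List S) :
    ∃ Φ : C(markovShift M.τ, NNReal), ∀ y : markovShift M.τ, cylWeight M.R w y = Φ y :=
  exists_continuousMap_eq_indicator_cyl w
    ((continuous_birkhoffProd hR _).inv₀ fun y => (birkhoffProd_pos M.R_pos _ y).ne')

theorem exists_continuousMap_midWeight (hR : Continuous fun y : markovShift M.τ => M.R y)
    (w : List S) :
    ∃ Φ : C(markovShift M.τ, NNReal), ∀ y : markovShift M.τ, midWeight M.R M.a w M.A y = Φ y :=
  exists_continuousMap_eq_indicator_cyl _
    (((continuous_birkhoffProd hR _).comp (continuous_shiftOn M.τ)).inv₀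
      fun y => (birkhoffProd_pos M.R_pos _ (shift y)).ne')

end ContinuousWeights

variable [MeasurableSpace S]

section CutMeasure

variable (M : WordSystem S G) (c : ℕ → ℝ) (t : ℝ)

/-- The sum of weighted point masses along the orbits of the points `v x`, with integral
`cutSum`. -/
def cutMeasure : Measure (markovShift M.τ) :=
  Measure.sum fun z : M.Cuts => M.cutWeight c t z •
    Measure.dirac ⟨concat (z : List S × List S).2 M.x, concat_mem_of_concat_append_mem z.2.2.1⟩

/-- The measure `cutMeasure` in the normalisation of `Υ`. -/
def normalizedMeasure : Measure (markovShift M.τ) :=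
  (M.pairSum c t 1)⁻¹ • M.cutMeasure c t

variable {M c t} {F : (ℕ → S) → ℝ≥0∞} {Φ : markovShift M.τ → ℝ≥0∞}

theorem lintegral_cutMeasure (hΦ : Measurable Φ) (hF : ∀ y : markovShift M.τ, F y = Φ y) :
    ∫⁻ y, Φ y ∂M.cutMeasure c t = M.cutSum c t F := by
  rw [cutMeasure, lintegral_sum_measure, cutSum]
  refine tsum_congr fun z => ?_
  rw [lintegral_smul_measure, lintegral_dirac' _ hΦ, ← hF, cutTerm, smul_eq_mul]

theorem lintegral_normalizedMeasure (hΦ : Measurable Φ) (hF : ∀ y : markovShift M.τ, F y = Φ y) :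
    ∫⁻ y, Φ y ∂M.normalizedMeasure c t = (M.pairSum c t 1)⁻¹ * M.cutSum c t F := by
  rw [normalizedMeasure, lintegral_smul_measure, lintegral_cutMeasure hΦ hF, smul_eq_mul]

theorem toReal_lintegral_normalizedMeasure (hΦ : Measurable Φ)
    (hF : ∀ y : markovShift M.τ, F y = Φ y) :
    (∫⁻ y, Φ y ∂M.normalizedMeasure c t).toReal = M.cutRatio c t F := by
  rw [lintegral_normalizedMeasure hΦ hF, ENNReal.toReal_mul, ENNReal.toReal_inv, mul_comm]
  rfl

theorem normalizedMeasure_univ :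
    M.normalizedMeasure c t Set.univ = (M.pairSum c t 1)⁻¹ * M.cutSum c t (fun _ => 1) := by
  rw [← lintegral_normalizedMeasure measurable_const fun _ => rfl, lintegral_one]

theorem isFiniteMeasure_normalizedMeasure [Finite S] (hc : SlowlyIncreasing c)
    (ht : M.critExp < t) : IsFiniteMeasure (M.normalizedMeasure c t) := by
  refine ⟨?_⟩
  rw [normalizedMeasure_univ]
  exact ENNReal.mul_lt_top (ENNReal.inv_lt_top.2 (pairSum_one_pos hc.1 (M.critExp_pos.trans ht)))
    (cutSum_one_ne_top hc ht).lt_top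

end CutMeasure

variable [TopologicalSpace S] {M : WordSystem S G} {c : ℕ → ℝ} {t : ℕ → ℝ}
  {ν : Measure (markovShift M.τ)} {F : (ℕ → S) → ℝ≥0∞}

/-- The measure `ν` is a weak limit of the measures `normalizedMeasure` along parameters `t k` that
decrease to the critical exponent, with weights `c` for which `wordSum` is negligible. -/
structure IsCriticalLimit (M : WordSystem S G) (c : ℕ → ℝ) (t : ℕ → ℝ)
    (ν : Measure (markovShift M.τ)) : Prop where
  slow : SlowlyIncreasing c
  gt : ∀ k, M.critExp < t k
  le : ∀ k, t k ≤ M.critExp + 1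
  tendsto : Tendsto t atTop (𝓝 M.critExp)
  tendsto_wordRatio : Tendsto (fun k => M.wordRatio c (t k)) atTop (𝓝 0)
  tendsto_cutRatio : ∀ (Φ : C(markovShift M.τ, NNReal)) (F : (ℕ → S) → ℝ≥0∞),
    (∀ y : markovShift M.τ, F y = Φ y) →
      Tendsto (fun k => M.cutRatio c (t k) F) atTop (𝓝 (∫⁻ y, Φ y ∂ν).toReal)

theorem exists_isCriticalLimit [Finite S] [DiscreteTopology S] [MeasurableSingletonClass S]
    (M : WordSystem S G) : ∃ c t, ∃ ν : FiniteMeasure (markovShift M.τ),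
      M.IsCriticalLimit c t ν := by
  obtain ⟨c, t, C, hc, ht, htlim, hword, hC⟩ := M.exists_parameters_cutRatio_one_le
  let μ : ℕ → FiniteMeasure (markovShift M.τ) := fun k =>
    ⟨M.normalizedMeasure c (t k), isFiniteMeasure_normalizedMeasure hc (ht k).1⟩
  have hμ : ∀ (Φ : C(markovShift M.τ, NNReal)) (F : (ℕ → S) → ℝ≥0∞),
      (∀ y : markovShift M.τ, F y = Φ y) → ∀ k,
        (∫⁻ y, Φ y ∂(μ k : Measure (markovShift M.τ))).toReal = M.cutRatio c (t k) F :=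
    fun Φ F hF k => toReal_lintegral_normalizedMeasure
      (measurable_coe_nnreal_ennreal.comp Φ.continuous.measurable) hF
  have hmass : ∀ k, (μ k).mass ≤ C := fun k => by
    have hcut : ((μ k).mass : ℝ) = M.cutRatio c (t k) (fun _ => 1) := by
      rw [← toReal_lintegral_normalizedMeasure measurable_const fun _ => rfl, lintegral_one]
      rfl
    exact_mod_cast hcut.trans_le (hC k)
  have : Nonempty (markovShift M.τ) := ⟨⟨_, M.concat_a_mem⟩⟩
  obtain ⟨ν, φ, hφ, hν⟩ := exists_subseq_tendsto_of_mass_le μ hmass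
  refine ⟨c, t ∘ φ, ν, hc, fun k => (ht _).1, fun k => (ht _).2,
    htlim.comp hφ.tendsto_atTop, hword.comp hφ.tendsto_atTop, fun Φ F hF => ?_⟩
  have hΦ := FiniteMeasure.tendsto_iff_forall_lintegral_tendsto.1 hν
    (BoundedContinuousFunction.mkOfCompact Φ)
  have hfin := (BoundedContinuousFunction.mkOfCompact Φ).lintegral_lt_top_of_nnreal
    (ν : Measure (markovShift M.τ))
  exact ((ENNReal.tendsto_toReal hfin.ne).comp hΦ).congr fun k => hμ Φ F hF (φ k)

end WordSystem

end Limit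

section LimitEstimates

namespace WordSystem

/-- The upper limit of `pairRatio` along the parameters `t k`: the function `Υ` of the theorem, by
`WordSystem.IsCriticalLimit.isUpsilon`. -/
def upsilon {S G : Type*} [Group G] (M : WordSystem S G) (c t : ℕ → ℝ) (g : G) : ℝ :=
  limsup (fun k => M.pairRatio c (t k) g) atTop

namespace IsCriticalLimit

variable {S G : Type*} [Finite S] [Group G] [MeasurableSpace S] [TopologicalSpace S]
  {M : WordSystem S G} {c : ℕ → ℝ} {t : ℕ → ℝ} {ν : Measure (markovShift M.τ)}
  {F : (ℕ → S) → ℝ≥0∞}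

theorem pos (h : M.IsCriticalLimit c t ν) (k : ℕ) : 0 < t k := M.critExp_pos.trans (h.gt k)

theorem isBounded_pairRatio (h : M.IsCriticalLimit c t ν) (g : G) :
    Bornology.IsBounded (Set.range fun k => M.pairRatio c (t k) g) := by
  obtain ⟨C, hC⟩ := (h.tendsto_cutRatio 1 (fun _ => 1) fun _ => by simp).bddAbove_range
  obtain ⟨E, hE₀, hE⟩ := M.exists_pairSum_le_cutSum_one g ((h.pos 0).trans_le (h.le 0))
  refine (Metric.isBounded_Icc (0 : ℝ) (E * C)).subset ?_
  rintro _ ⟨k, rfl⟩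
  refine ⟨M.pairRatio_nonneg _ _ g, ?_⟩
  have hle := hE c (fun n => (h.slow.1 n).le) h.slow.2.1 (t k) (h.pos k) (h.le k)
  calc M.pairRatio c (t k) g ≤ E * M.cutRatio c (t k) (fun _ => 1) := by
        simpa only [zero_mul, add_zero, pairRatio, cutRatio] using
          toReal_div_le hE₀ le_rfl ENNReal.toReal_nonneg (cutSum_one_ne_top h.slow (h.gt k))
            ENNReal.zero_ne_top (hle.trans_eq (by rw [mul_zero, add_zero]))
    _ ≤ E * C := mul_le_mul_of_nonneg_left (hC ⟨k, rfl⟩) hE₀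

theorem upsilon_nonneg (h : M.IsCriticalLimit c t ν) (g : G) : 0 ≤ M.upsilon c t g :=
  le_limsup_of_tendsto_of_le (h.isBounded_pairRatio g) tendsto_const_nhds
    fun k => M.pairRatio_nonneg c (t k) g

theorem toReal_lintegral_comp_shiftOn_le (h : M.IsCriticalLimit c t ν)
    {Φ : C(markovShift M.τ, NNReal)} {B : ℝ} (hB : 0 ≤ B) (hF : ∀ y, F y ≤ ENNReal.ofReal B)
    (hΦ : ∀ y : markovShift M.τ, F y = Φ y) :
    (∫⁻ y, Φ (shiftOn M.τ y) ∂ν).toReal ≤ (∫⁻ y, Φ y ∂ν).toReal := by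
  refine le_of_forall_pos_le_one_add_mul fun ε hε => ?_
  obtain ⟨C, hC₀, hC⟩ := M.exists_cutSum_comp_shift_le h.slow hB hF hε
  have hlim := ((h.tendsto_cutRatio Φ F hΦ).const_mul (1 + ε)).add (h.tendsto_wordRatio.const_mul C)
  rw [mul_zero, add_zero] at hlim
  refine le_of_tendsto_of_tendsto' (h.tendsto_cutRatio (Φ.comp ⟨_, continuous_shiftOn M.τ⟩)
    (fun y => F (shift y)) fun y => hΦ (shiftOn M.τ y)) hlim fun k => ?_
  exact toReal_div_le (by positivity) hC₀ ENNReal.toReal_nonneg (cutSum_ne_top h.slow (h.gt k) hF)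
    (wordSum_ne_top h.slow (h.gt k)) (hC (t k) (h.pos k))

theorem upsilon_le (h : M.IsCriticalLimit c t ν) {Φ : C(markovShift M.τ, NNReal)}
    {B E : ℝ} {g : G} {n : ℕ} (hF : ∀ y, F y ≤ ENNReal.ofReal B)
    (hΦ : ∀ y : markovShift M.τ, F y = Φ y) (hE : 0 ≤ E)
    (hle : ∀ k, M.pairSum c (t k) g ≤
      ENNReal.ofReal E * (ENNReal.ofReal (t k ^ n) * M.cutSum c (t k) F)) :
    M.upsilon c t g ≤ E * (M.critExp ^ n * (∫⁻ y : markovShift M.τ, F y ∂ν).toReal) := by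
  have hlim := ((h.tendsto.pow n).mul (h.tendsto_cutRatio Φ F hΦ)).const_mul E
  simp only [hΦ]
  refine limsup_le_of_tendsto_of_le (h.isBounded_pairRatio g) hlim fun k => ?_
  have htn := pow_nonneg (h.pos k).le n
  have hEt : M.pairSum c (t k) g ≤ ENNReal.ofReal (E * t k ^ n) * M.cutSum c (t k) F +
      ENNReal.ofReal 0 * 0 := by
    rw [ENNReal.ofReal_mul hE, mul_assoc, mul_zero, add_zero]
    exact hle k
  simpa only [zero_mul, add_zero, mul_assoc, pairRatio, cutRatio] using
    toReal_div_le (mul_nonneg hE htn) le_rfl ENNReal.toReal_nonneg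
      (cutSum_ne_top h.slow (h.gt k) hF) ENNReal.zero_ne_top hEt

theorem pow_mul_lintegral_le (h : M.IsCriticalLimit c t ν) {Φ : C(markovShift M.τ, NNReal)}
    {B E : ℝ} {g : G} {n : ℕ} (hΦ : ∀ y : markovShift M.τ, F y = Φ y) (hE : 0 ≤ E) (hB : 0 ≤ B)
    (hle : ∀ k, ENNReal.ofReal (t k ^ n) * M.cutSum c (t k) F ≤
      ENNReal.ofReal E * M.pairSum c (t k) g +
        ENNReal.ofReal (t k ^ n) * (ENNReal.ofReal B * M.wordSum c (t k))) :
    M.critExp ^ n * (∫⁻ y : markovShift M.τ, F y ∂ν).toReal ≤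
      E * M.upsilon c t g := by
  have hlim := ((h.tendsto.pow n).mul (h.tendsto_cutRatio Φ F hΦ)).sub
    (((h.tendsto.pow n).mul_const B).mul h.tendsto_wordRatio)
  rw [mul_zero, sub_zero] at hlim
  have hbdd : Bornology.IsBounded (Set.range fun k => E * M.pairRatio c (t k) g) := by
    rw [← Function.comp_def (E * ·), Set.range_comp]
    exact (h.isBounded_pairRatio g).smul₀ E
  rw [upsilon, ← limsup_const_mul_of_isBounded (h.isBounded_pairRatio g) hE]
  simp only [hΦ]
  refine le_limsup_of_tendsto_of_le hbdd hlim fun k => ?_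
  have htn := pow_nonneg (h.pos k).le n
  have hdiv := toReal_div_le (p := (M.pairSum c (t k) 1).toReal) hE (mul_nonneg htn hB)
    ENNReal.toReal_nonneg (pairSum_ne_top h.slow (h.gt k) g) (wordSum_ne_top h.slow (h.gt k))
    ((hle k).trans_eq (by rw [ENNReal.ofReal_mul htn, mul_assoc (ENNReal.ofReal (t k ^ n))]))
  rw [ENNReal.toReal_mul, ENNReal.toReal_ofReal htn, mul_div_assoc] at hdiv
  exact sub_le_iff_le_add.2 hdiv

variable [DiscreteTopology S]

theorem measurePreserving [MeasurableSingletonClass S] [IsFiniteMeasure ν]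
    (h : M.IsCriticalLimit c t ν) : MeasurePreserving (shiftOn M.τ) ν ν := by
  classical
  refine measurePreserving_of_lintegral_comp_le (continuous_shiftOn M.τ) fun Φ => ?_
  have hfin : ∀ Ψ : C(markovShift M.τ, NNReal), ∫⁻ y, Ψ y ∂ν ≠ ⊤ := fun Ψ =>
    ((BoundedContinuousFunction.mkOfCompact Ψ).lintegral_lt_top_of_nnreal ν).ne
  refine (ENNReal.toReal_le_toReal (hfin (Φ.comp ⟨_, continuous_shiftOn M.τ⟩)) (hfin Φ)).1 ?_
  obtain ⟨B, hB⟩ := (isCompact_range Φ.continuous).bddAbove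
  refine h.toReal_lintegral_comp_shiftOn_le B.2 (F := fun y =>
    if hy : y ∈ markovShift M.τ then (Φ ⟨y, hy⟩ : ℝ≥0∞) else 0) (fun y => ?_) fun y => dif_pos y.2
  rw [NNReal.val_eq_coe, ENNReal.ofReal_coe_nnreal]
  split_ifs with hy
  · exact ENNReal.coe_le_coe.2 (hB ⟨_, rfl⟩)
  · exact zero_le

theorem upsilon_le_lintegral_midWeight (h : M.IsCriticalLimit c t ν)
    (hR : Continuous fun y : markovShift M.τ => M.R y) {w : List S}
    (hw : Admissible M.τ (M.a :: (w ++ [M.A]))) :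
    M.upsilon c t (wordProd M.s w) ≤ M.D ^ (M.θ ^ wedge w M.x) *
      (M.critExp ^ w.length * (∫⁻ y : markovShift M.τ, midWeight M.R M.a w M.A y ∂ν).toReal) := by
  obtain ⟨Φ, hΦ⟩ := exists_continuousMap_midWeight hR w
  exact h.upsilon_le (M.midWeight_le w) hΦ (Real.rpow_nonneg M.D_nonneg _) fun k =>
    pairSum_le_cutSum_midWeight (fun n => (h.slow.1 n).le) h.slow.2.1 (h.pos k) hw

theorem lintegral_midWeight_le (h : M.IsCriticalLimit c t ν)
    (hR : Continuous fun y : markovShift M.τ => M.R y) (w : List S) :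
    M.critExp ^ w.length * (∫⁻ y : markovShift M.τ, midWeight M.R M.a w M.A y ∂ν).toReal ≤
      M.D ^ (M.θ ^ wedge w M.x) *
        M.upsilon c t (wordProd M.s w) := by
  obtain ⟨Φ, hΦ⟩ := exists_continuousMap_midWeight hR w
  refine le_of_forall_pos_le_one_add_mul fun ε hε => ?_
  obtain ⟨B, hB₀, hB⟩ := M.exists_cutSum_midWeight_le h.slow w hε
  have hD := Real.rpow_nonneg M.D_nonneg (M.θ ^ wedge w M.x)
  rw [← mul_assoc (1 + ε)]
  exact h.pow_mul_lintegral_le hΦ (by positivity) hB₀ fun k => hB (t k) (h.pos k)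

theorem exists_upsilon_le_lintegral_cylWeight (h : M.IsCriticalLimit c t ν)
    (hR : Continuous fun y : markovShift M.τ => M.R y) :
    ∃ C, 0 ≤ C ∧ ∀ w, w ≠ [] → Admissible M.τ w →
      M.upsilon c t (wordProd M.s w) ≤
        C * (M.critExp ^ w.length * (∫⁻ y : markovShift M.τ, cylWeight M.R w y ∂ν).toReal) := by
  obtain ⟨C, hC₀, hC⟩ := M.exists_pairSum_le_cutSum_cylWeight (M.critExp + 1)
  refine ⟨C, hC₀, fun w hne hw => ?_⟩
  obtain ⟨Φ, hΦ⟩ := exists_continuousMap_cylWeight hR w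
  exact h.upsilon_le (M.cylWeight_le w) hΦ hC₀ fun k =>
    hC c (fun n => (h.slow.1 n).le) h.slow.2.1 (t k) (h.pos k) (h.le k) w hne hw

theorem exists_lintegral_cylWeight_le (h : M.IsCriticalLimit c t ν)
    (hR : Continuous fun y : markovShift M.τ => M.R y) :
    ∃ C, 0 ≤ C ∧ ∀ w,
      M.critExp ^ w.length * (∫⁻ y : markovShift M.τ, cylWeight M.R w y ∂ν).toReal ≤
        C * M.upsilon c t (wordProd M.s w) := by
  obtain ⟨C, hC₀, hC⟩ := M.exists_tsum_splits_le ((h.pos 0).trans_le (h.le 0))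
  refine ⟨2 * C, by positivity, fun w => ?_⟩
  obtain ⟨Φ, hΦ⟩ := exists_continuousMap_cylWeight hR w
  obtain ⟨B, hB₀, hB⟩ := M.exists_cutSum_cylWeight_le h.slow w
  exact h.pow_mul_lintegral_le hΦ (by positivity) hB₀ fun k => hB (t k) (h.pos k) C
    (hC c (fun n => (h.slow.1 n).le) h.slow.2.1 (t k) (h.pos k) (h.le k) w)

theorem exists_upsilon_comparable (h : M.IsCriticalLimit c t ν) (hθ : 0 ≤ M.θ)
    (hR : Continuous fun y : markovShift M.τ => M.R y) :
    ∃ C, 1 < C ∧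
      (∀ w, Admissible M.τ (M.a :: (w ++ [M.A])) →
        C ^ (-M.θ ^ wedge w M.x) * M.upsilon c t (wordProd M.s w) ≤
            M.critExp ^ w.length * (∫⁻ y, midWeight M.R M.a w M.A y ∂ν).toReal ∧
          M.critExp ^ w.length * (∫⁻ y, midWeight M.R M.a w M.A y ∂ν).toReal ≤
            C ^ (M.θ ^ wedge w M.x) * M.upsilon c t (wordProd M.s w)) ∧
      ∀ w, w ≠ [] → Admissible M.τ w →
        C⁻¹ * M.upsilon c t (wordProd M.s w) ≤
            M.critExp ^ w.length * (∫⁻ y, cylWeight M.R w y ∂ν).toReal ∧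
          M.critExp ^ w.length * (∫⁻ y, cylWeight M.R w y ∂ν).toReal ≤
            C * M.upsilon c t (wordProd M.s w) := by
  obtain ⟨C₁, hC₁₀, hC₁⟩ := h.exists_upsilon_le_lintegral_cylWeight hR
  obtain ⟨C₂, hC₂₀, hC₂⟩ := h.exists_lintegral_cylWeight_le hR
  have hD := M.D_nonneg
  have hC : 0 < M.D + C₁ + C₂ + 2 := by positivity
  have hpow : ∀ w, M.D ^ (M.θ ^ wedge w M.x) ≤ (M.D + C₁ + C₂ + 2) ^ (M.θ ^ wedge w M.x) :=
    fun w => Real.rpow_le_rpow hD (by linarith) (pow_nonneg hθ _)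
  have hγ := fun n => pow_nonneg M.critExp_pos.le n
  have hint : ∀ (n : ℕ) (F : markovShift M.τ → ℝ≥0∞),
      0 ≤ M.critExp ^ n * (∫⁻ y, F y ∂ν).toReal :=
    fun n F => mul_nonneg (hγ n) ENNReal.toReal_nonneg
  refine ⟨M.D + C₁ + C₂ + 2, by linarith, fun w hw => ⟨?_, ?_⟩, fun w hne hw => ⟨?_, ?_⟩⟩
  · rw [Real.rpow_neg hC.le, inv_mul_le_iff₀ (Real.rpow_pos_of_pos hC _)]
    exact (h.upsilon_le_lintegral_midWeight hR hw).trans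
      (mul_le_mul_of_nonneg_right (hpow w) (hint _ _))
  · exact (h.lintegral_midWeight_le hR w).trans
      (mul_le_mul_of_nonneg_right (hpow w) (h.upsilon_nonneg _))
  · rw [inv_mul_le_iff₀ hC]
    exact (hC₁ w hne hw).trans (mul_le_mul_of_nonneg_right (by linarith) (hint _ _))
  · exact (hC₂ w).trans (mul_le_mul_of_nonneg_right (by linarith) (h.upsilon_nonneg _))

end IsCriticalLimit

end WordSystem

end LimitEstimates

section Exhaustions

variable {α : Type*} {s : Set α} {U : ℕ → Finset α}

theorem tendsto_sum_tsum_subtype {f : α → ℝ≥0∞} (hmono : Monotone U) (hU : ∀ N, ↑(U N) ⊆ s)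
    (hex : ∀ z ∈ s, ∃ N, z ∈ U N) :
    Tendsto (fun N => ∑ z ∈ U N, f z) atTop (𝓝 (∑' z : s, f z)) := by
  classical
  have hexhaust : Tendsto (fun N => (U N).subtype (· ∈ s)) atTop atTop :=
    tendsto_atTop_finset_of_monotone (fun _ _ h => Finset.subtype_mono (hmono h)) fun z =>
      (hex z z.2).imp fun _ => Finset.mem_subtype.2
  refine ((ENNReal.summable (f := fun z : s => f z)).hasSum.comp hexhaust).congr fun N => ?_
  exact Finset.sum_subtype_of_mem f fun z hz => hU N hz

theorem bddAbove_range_sum_iff {g : α → ℝ} (hg : ∀ z, 0 ≤ g z) (hmono : Monotone U)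
    (hU : ∀ N, ↑(U N) ⊆ s) (hex : ∀ z ∈ s, ∃ N, z ∈ U N) :
    BddAbove (Set.range fun N => ∑ z ∈ U N, g z) ↔ ∑' z : s, ENNReal.ofReal (g z) ≠ ⊤ := by
  have hlim := tendsto_sum_tsum_subtype (f := fun z => ENNReal.ofReal (g z)) hmono hU hex
  simp only [← ENNReal.ofReal_sum_of_nonneg fun z _ => hg z] at hlim
  constructor
  · rintro ⟨B, hB⟩
    exact ne_top_of_le_ne_top ENNReal.ofReal_ne_top
      (le_of_tendsto' hlim fun N => ENNReal.ofReal_le_ofReal (hB ⟨N, rfl⟩))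
  · refine fun hfin => ⟨(∑' z : s, ENNReal.ofReal (g z)).toReal, ?_⟩
    rintro _ ⟨N, rfl⟩
    have hle : Monotone fun N => ENNReal.ofReal (∑ z ∈ U N, g z) := fun _ _ h =>
      ENNReal.ofReal_le_ofReal (Finset.sum_le_sum_of_subset_of_nonneg (hmono h) fun z _ _ => hg z)
    exact (ENNReal.ofReal_le_iff_le_toReal hfin).1 (hle.ge_of_tendsto hlim N)

end Exhaustions

section MatrixCoefficients

variable {G E : Type*} [Group G] [NormedAddCommGroup E] [InnerProductSpace ℝ E]

/-- The matrix coefficient `g ↦ ⟨π(g) f, f⟩` of an orthogonal representation. -/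
def matrixCoeff (π : G →* (E ≃ₗᵢ[ℝ] E)) (f : E) (g : G) : ℝ := inner ℝ (π g f) f

theorem inner_map_map_inv (π : G →* (E ≃ₗᵢ[ℝ] E)) (f : E) (g h : G) :
    inner ℝ (π g f) (π h⁻¹ f) = matrixCoeff π f (h * g) := by
  rw [← LinearIsometryEquiv.inner_map_map (π h) (π g f), matrixCoeff, map_mul, map_inv]
  exact congrArg (inner ℝ (π h (π g f))) ((π h).apply_symm_apply f)

theorem matrixCoeff_one (π : G →* (E ≃ₗᵢ[ℝ] E)) (f : E) : matrixCoeff π f 1 = ‖f‖ ^ 2 := by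
  rw [matrixCoeff, map_one, LinearIsometryEquiv.coe_one, id, real_inner_self_eq_norm_sq]

theorem matrixCoeff_le (π : G →* (E ≃ₗᵢ[ℝ] E)) (f : E) (g : G) : matrixCoeff π f g ≤ ‖f‖ ^ 2 :=
  (real_inner_le_norm _ _).trans_eq (by rw [LinearIsometryEquiv.norm_map, sq])

theorem matrixCoeff_permRep_nonneg {X : Type*} [MulAction G X] {f : Ell2 X}
    (hf : ∀ p, 0 ≤ (f : X → ℝ) p) (g : G) : 0 ≤ matrixCoeff permRep f g := by
  rw [matrixCoeff, lp.inner_eq_tsum]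
  exact tsum_nonneg fun p => mul_nonneg (hf p) (hf (g⁻¹ • p))

end MatrixCoefficients

section Densities

namespace WordSystem

variable {S G : Type*} [Group G] [Finite S] {M : WordSystem S G} {R : (ℕ → S) → ℝ} {c : ℕ → ℝ}
  {t : ℝ}

theorem mem_wordsBetween_iff {n : ℕ} {w : List S} :
    w ∈ wordsBetween M.τ M.A M.a n ↔ w.length = n ∧ w ∈ M.Words := by
  simp only [wordsBetween, Finset.mem_filter, Set.Finite.mem_toFinset, Set.mem_ofPred_eq, Words]
  refine and_congr_right fun _ => and_congr_left fun hends =>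
    ⟨fun hw => ?_, admissible_of_concat_mem⟩
  obtain ⟨y, hy⟩ := hw.exists_concat_mem
  exact concat_mem_of_getLast? hends.2 hy M.concat_a_mem

open Classical in
variable (M) in
/-- The finite set of words from `A` to `a` of length at most `N`, which exhausts `Words`. -/
def wordsUpTo (N : ℕ) : Finset (List S) :=
  (Finset.Icc 1 N).biUnion (wordsBetween M.τ M.A M.a)

theorem mem_wordsUpTo_iff {N : ℕ} {w : List S} :
    w ∈ M.wordsUpTo N ↔ w.length ≤ N ∧ w ∈ M.Words := by
  simp only [wordsUpTo, Finset.mem_biUnion, Finset.mem_Icc, mem_wordsBetween_iff]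
  refine ⟨?_, fun ⟨hN, hw⟩ => ⟨_, ⟨List.length_pos_of_ne_nil ?_, hN⟩, rfl, hw⟩⟩
  · rintro ⟨n, hn, rfl, hw⟩
    exact ⟨hn.2, hw⟩
  · rintro rfl
    exact absurd hw.2.1 (by simp)

theorem wordsUpTo_mono : Monotone M.wordsUpTo := fun _ _ h _ hw =>
  mem_wordsUpTo_iff.2 ((mem_wordsUpTo_iff.1 hw).imp_left h.trans')

theorem coe_wordsUpTo_subset (N : ℕ) : ↑(M.wordsUpTo N) ⊆ M.Words := fun _ hw =>
  (mem_wordsUpTo_iff.1 hw).2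

theorem exists_mem_wordsUpTo {w : List S} (hw : w ∈ M.Words) : ∃ N, w ∈ M.wordsUpTo N :=
  ⟨w.length, mem_wordsUpTo_iff.2 ⟨le_rfl, hw⟩⟩

open Classical in
theorem density_eq_sum (hR : Set.EqOn R M.R (markovShift M.τ)) (c : ℕ → ℝ) (N : ℕ) (t : ℝ)
    (g : G) : density M.τ R M.s M.A M.a M.x c N t g =
      ∑ w ∈ (M.wordsUpTo N).filter (fun w => wordProd M.s w = g),
        M.scaledWeight t w M.x * c w.length := by
  rw [density, wordsUpTo, Finset.filter_biUnion, Finset.sum_biUnion]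
  · refine Finset.sum_congr rfl fun n _ => ?_
    rw [Finset.mul_sum]
    refine Finset.sum_congr rfl fun w hw => ?_
    obtain ⟨rfl, hwM⟩ := mem_wordsBetween_iff.1 (Finset.mem_filter.1 hw).1
    rw [birkhoffProd_congr hR _ hwM.1, scaledWeight, wordWeight]
    ring
  · intro n _ m _ hnm
    refine Finset.disjoint_left.2 fun w hw hw' => hnm ?_
    rw [← (mem_wordsBetween_iff.1 (Finset.mem_filter.1 hw).1).1,
      (mem_wordsBetween_iff.1 (Finset.mem_filter.1 hw').1).1]

theorem tsum_density_smul {E : Type*} [AddCommGroup E] [Module ℝ E] [TopologicalSpace E]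
    (hR : Set.EqOn R M.R (markovShift M.τ)) (c : ℕ → ℝ) (N : ℕ) (t : ℝ) (F : G → E) :
    ∑' g, density M.τ R M.s M.A M.a M.x c N t g • F g =
      ∑ w ∈ M.wordsUpTo N, (M.scaledWeight t w M.x * c w.length) • F (wordProd M.s w) := by
  classical
  have hmaps : ∀ w ∈ M.wordsUpTo N, wordProd M.s w ∈ (M.wordsUpTo N).image (wordProd M.s) :=
    fun w hw => Finset.mem_image_of_mem _ hw
  rw [tsum_eq_sum (s := (M.wordsUpTo N).image (wordProd M.s)),
    ← Finset.sum_fiberwise_of_maps_to hmaps]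
  · refine Finset.sum_congr rfl fun g _ => ?_
    rw [density_eq_sum hR, Finset.sum_smul]
    refine Finset.sum_congr (by congr) fun w hw => ?_
    rw [(Finset.mem_filter.1 hw).2]
  · intro g hg
    rw [density_eq_sum hR, Finset.sum_eq_zero, zero_smul]
    intro w hw
    obtain ⟨hwN, rfl⟩ := Finset.mem_filter.1 hw
    exact absurd (hmaps w hwN) hg

variable {ι : Type*} {K : ι → Subgroup G} {f : CosetSpace K}

theorem convParam_eq_critExp (hR : Set.EqOn R M.R (markovShift M.τ))
    (hψ : M.ψ = matrixCoeff (cosetRep K) f) :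
    convParam M.τ R M.s M.A M.a M.x f = M.critExp := by
  refine congrArg sInf (Set.ext fun t => and_congr_right fun ht => ?_)
  have hsum : ∀ N, ∑' h : G, density M.τ R M.s M.A M.a M.x (fun _ => 1) N t h *
      inner ℝ (cosetRep K h f) f = ∑ w ∈ M.wordsUpTo N, M.gibbs t w := fun N => by
    refine (M.tsum_density_smul hR (fun _ => 1) N t (matrixCoeff (cosetRep K) f)).trans ?_
    simp only [← hψ, mul_one, smul_eq_mul, gibbs]
  simp only [hsum, wordSum, wordTerm, mul_one]
  exact bddAbove_range_sum_iff (gibbs_nonneg ht) wordsUpTo_mono coe_wordsUpTo_subset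
    fun w => exists_mem_wordsUpTo

theorem starCoeff_eq_sum (hR : Set.EqOn R M.R (markovShift M.τ))
    (hψ : M.ψ = matrixCoeff (cosetRep K) f) (c : ℕ → ℝ) (N : ℕ) (t : ℝ) (g : G) :
    starCoeff M.τ R M.s M.A M.a M.x f c N t g = ∑ z ∈ M.wordsUpTo N ×ˢ M.wordsUpTo N,
      M.pairWeight t g z.1 z.2 * (c z.1.length * c z.2.length) := by
  have hconv : convVec (density M.τ R M.s M.A M.a M.x c N t) f = ∑ w ∈ M.wordsUpTo N,
      (M.scaledWeight t w M.x * c w.length) • cosetRep K (wordProd M.s w) f :=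
    tsum_density_smul hR c N t fun h => cosetRep K h f
  have hconv' : convVec (reflect (density M.τ R M.s M.A M.a M.x c N t)) f =
      ∑ w ∈ M.wordsUpTo N,
        (M.scaledWeight t w M.x * c w.length) • cosetRep K (wordProd M.s w)⁻¹ f := by
    rw [← tsum_density_smul hR c N t fun h => cosetRep K h⁻¹ f, convVec, ← (Equiv.inv G).tsum_eq]
    simp only [reflect, Equiv.inv_apply, inv_inv]
  rw [starCoeff, hconv, hconv', map_sum, inner_sum, Finset.sum_product]
  refine Finset.sum_congr rfl fun u _ => ?_
  rw [sum_inner]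
  refine Finset.sum_congr rfl fun v _ => ?_
  rw [map_smul, real_inner_smul_left, real_inner_smul_right,
    ← Function.comp_apply (f := cosetRep K g), ← LinearIsometryEquiv.coe_mul, ← map_mul,
    inner_map_map_inv, ← hψ, pairWeight, ← mul_assoc (wordProd M.s u)]
  ring

theorem tendsto_starCoeff (hR : Set.EqOn R M.R (markovShift M.τ))
    (hψ : M.ψ = matrixCoeff (cosetRep K) f) (hc : SlowlyIncreasing c) (ht : M.critExp < t) (g : G) :
    Tendsto (fun N => starCoeff M.τ R M.s M.A M.a M.x f c N t g) atTop
      (𝓝 (M.pairSum c t g).toReal) := by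
  have hlim : Tendsto (fun N => ∑ z ∈ M.wordsUpTo N ×ˢ M.wordsUpTo N, M.pairTerm c t g z) atTop
      (𝓝 (M.pairSum c t g)) := by
    refine tendsto_sum_tsum_subtype
      (fun _ _ h => Finset.product_subset_product (wordsUpTo_mono h) (wordsUpTo_mono h))
      (fun N => ?_) fun z hz => ?_
    · rw [Finset.coe_product]
      exact Set.prod_mono (coe_wordsUpTo_subset N) (coe_wordsUpTo_subset N)
    · exact ⟨max z.1.length z.2.length, Finset.mem_product.2
        ⟨mem_wordsUpTo_iff.2 ⟨le_max_left _ _, hz.1⟩, mem_wordsUpTo_iff.2 ⟨le_max_right _ _, hz.2⟩⟩⟩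
  refine ((ENNReal.tendsto_toReal (pairSum_ne_top hc ht g)).comp hlim).congr fun N => ?_
  rw [Function.comp_apply, starCoeff_eq_sum hR hψ,
    ENNReal.toReal_sum (f := M.pairTerm c t g) fun _ _ => ENNReal.ofReal_ne_top]
  exact Finset.sum_congr rfl fun z _ => ENNReal.toReal_ofReal <|
    mul_nonneg (pairWeight_nonneg (M.critExp_pos.trans ht) _ _ _)
      (mul_nonneg (hc.1 _).le (hc.1 _).le)

theorem IsCriticalLimit.isUpsilon [MeasurableSpace S] [TopologicalSpace S] {t : ℕ → ℝ}
    {ν : Measure (markovShift M.τ)} (h : M.IsCriticalLimit c t ν)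
    (hR : Set.EqOn R M.R (markovShift M.τ)) (hψ : M.ψ = matrixCoeff (cosetRep K) f) :
    IsUpsilon M.τ R M.s M.A M.a M.x f c t (M.upsilon c t) := by
  have hpos := fun k => toReal_pairSum_one_pos (M := M) h.slow (h.gt k)
  have hlim := fun k => tendsto_starCoeff hR hψ h.slow (h.gt k)
  exact ⟨fun k => (hlim k 1).eventually (lt_mem_nhds (hpos k)), fun k => M.pairRatio c (t k),
    fun k g => (hlim k g).div (hlim k 1) (hpos k).ne', fun g => ⟨h.isBounded_pairRatio g, rfl⟩⟩

end WordSystem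

end Densities

section PushForward

variable {S : Type*} {τ : S → S → Prop}

theorem measurable_shift [MeasurableSpace S] : Measurable (shift : (ℕ → S) → ℕ → S) :=
  measurable_pi_lambda _ fun i => measurable_pi_apply (i + 1)

theorem measurePreserving_map_coe [MeasurableSpace S]
    {ν : Measure (markovShift τ)} (h : MeasurePreserving (shiftOn τ) ν ν) :
    MeasurePreserving shift (ν.map Subtype.val) (ν.map Subtype.val) := by
  refine ⟨measurable_shift, ?_⟩
  rw [Measure.map_map measurable_shift measurable_subtype_coe]
  nth_rw 2 [← h.map_eq]
  rw [Measure.map_map measurable_subtype_coe h.measurable]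
  rfl

variable [Finite S] [TopologicalSpace S] [DiscreteTopology S] [MeasurableSpace S]
  [MeasurableSingletonClass S]

theorem map_coe_compl_markovShift (ν : Measure (markovShift τ)) :
    ν.map Subtype.val (markovShift τ)ᶜ = 0 := by
  rw [Measure.map_apply measurable_subtype_coe (isClosed_markovShift τ).measurableSet.compl,
    Set.preimage_compl, Subtype.coe_preimage_self, Set.compl_univ, measure_empty]

theorem setIntegral_map_coe (ν : Measure (markovShift τ)) {E : Set (ℕ → S)}
    (hE : MeasurableSet E) {h h' : (ℕ → S) → ℝ} (hh : Set.EqOn h h' (markovShift τ))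
    (hnonneg : ∀ y, 0 ≤ h' y) (hcont : Continuous fun y : markovShift τ => h' y) :
    ∫ y in E, h y ∂(ν.map Subtype.val) =
      (∫⁻ y : markovShift τ, E.indicator (fun y => ENNReal.ofReal (h' y)) y ∂ν).toReal := by
  rw [(MeasurableEmbedding.subtype_coe (isClosed_markovShift τ).measurableSet).setIntegral_map,
    setIntegral_congr_fun (measurable_subtype_coe hE) fun y _ => hh y.2,
    integral_eq_lintegral_of_nonneg_ae (f := fun y : markovShift τ => h' y)
      (.of_forall fun y => hnonneg y) hcont.measurable.aestronglyMeasurable,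
    ← lintegral_indicator (measurable_subtype_coe hE)]
  rfl

namespace WordSystem

variable {G : Type*} [Group G] {M : WordSystem S G} {R : (ℕ → S) → ℝ}

theorem setIntegral_cyl_map_coe (ν : Measure (markovShift M.τ))
    (hR : Set.EqOn R M.R (markovShift M.τ)) (hcont : Continuous fun y : markovShift M.τ => M.R y)
    (w : List S) :
    ∫ y in cyl w, (birkhoffProd R w.length y)⁻¹ ∂(ν.map Subtype.val) =
      (∫⁻ y, cylWeight M.R w y ∂ν).toReal :=
  setIntegral_map_coe ν (isClopen_cyl w).isOpen.measurableSet
    (fun _ hy => congrArg (·⁻¹) (birkhoffProd_congr hR _ hy))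
    (fun y => (inv_pos.2 (birkhoffProd_pos M.R_pos _ y)).le)
    ((continuous_birkhoffProd hcont _).inv₀ fun y => (birkhoffProd_pos M.R_pos _ y).ne')

theorem setIntegral_cyl_append_map_coe (ν : Measure (markovShift M.τ))
    (hR : Set.EqOn R M.R (markovShift M.τ)) (hcont : Continuous fun y : markovShift M.τ => M.R y)
    (w : List S) :
    ∫ y in cyl (M.a :: (w ++ [M.A])), (birkhoffProd R w.length (shift y))⁻¹
        ∂(ν.map Subtype.val) =
      (∫⁻ y, midWeight M.R M.a w M.A y ∂ν).toReal :=
  setIntegral_map_coe ν (isClopen_cyl _).isOpen.measurableSet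
    (fun _ hy => congrArg (·⁻¹) (birkhoffProd_congr hR _ (shift_mem_markovShift hy)))
    (fun y => (inv_pos.2 (birkhoffProd_pos M.R_pos _ (shift y))).le)
    (((continuous_birkhoffProd hcont _).comp (continuous_shiftOn M.τ)).inv₀
      fun y => (birkhoffProd_pos M.R_pos _ (shift y)).ne')

end WordSystem

end PushForward

section Construction

variable {S : Type*} {τ : S → S → Prop}

theorem concat_singleton_mem_of_mem_image_shift {a : S} {x : ℕ → S}
    (hx : x ∈ shift '' (cyl [a] ∩ markovShift τ)) : concat [a] x ∈ markovShift τ := by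
  obtain ⟨y, ⟨hya, hy⟩, rfl⟩ := hx
  rwa [show a = y 0 from (hya 0 Nat.one_pos).symm, concat_singleton_shift]

theorem LogHolder.exists_forall_mulIndicator_mem_Icc [Finite S] {R : (ℕ → S) → ℝ} {θ : ℝ}
    (hHol : LogHolder τ R θ) (hR : ∀ y ∈ markovShift τ, 0 < R y) :
    ∃ lo hi, 0 < lo ∧ ∀ y, (markovShift τ).mulIndicator R y ∈ Set.Icc lo hi := by
  obtain ⟨B, hB⟩ := hHol.exists_abs_log_le
  have hlog : ∀ y ∈ markovShift τ, |Real.log (R y)| ≤ max B 0 := fun y hy =>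
    (hB y hy).trans (le_max_left _ _)
  refine ⟨Real.exp (-max B 0), Real.exp (max B 0), Real.exp_pos _, fun y => ?_⟩
  by_cases hy : y ∈ markovShift τ
  · rw [Set.mulIndicator_of_mem hy, Set.mem_Icc, ← Real.le_log_iff_exp_le (hR y hy),
      ← Real.log_le_iff_le_exp (hR y hy)]
    exact abs_le.1 (hlog y hy)
  · rw [Set.mulIndicator_of_notMem hy, Set.mem_Icc, Real.exp_le_one_iff, Real.one_le_exp_iff,
      neg_nonpos, and_self]
    exact le_max_right _ _

variable [Finite S] [TopologicalSpace S] [DiscreteTopology S] {G : Type*} [Group G]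
  [TopologicalSpace G] [DiscreteTopology G]

/-- The word system of a transitive group extension of a Markov shift and of a vector `f` in an
orthogonal representation of the group. Off the Markov shift the values of the potential do not
matter, and they are set to `1`. -/
def WordSystem.ofTransitive {R : (ℕ → S) → ℝ} (hR : ∀ y ∈ markovShift τ, 0 < R y) {θ : ℝ}
    (hθ₀ : 0 < θ) (hθ₁ : θ < 1) (hHol : LogHolder τ R θ) {s : S → G}
    (htrans : TransitiveOn (skewProduct s) (markovShift τ ×ˢ Set.univ)) {A a : S}
    (hA : Admissible τ [A]) {x : ℕ → S} (hx : x ∈ shift '' (cyl [a] ∩ markovShift τ))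
    {E : Type*} [NormedAddCommGroup E] [InnerProductSpace ℝ E] {π : G →* (E ≃ₗᵢ[ℝ] E)} {f : E}
    (hf : ∀ g, 0 ≤ matrixCoeff π f g) (hf₀ : f ≠ 0) : WordSystem S G :=
  have hbound := hHol.exists_forall_mulIndicator_mem_Icc hR
  have hpos := fun y => hbound.choose_spec.choose_spec.1.trans_le
    (hbound.choose_spec.choose_spec.2 y).1
  have hdist := (hHol.congr Set.eqOn_mulIndicator.symm).exists_wordWeight_le hpos hθ₀ hθ₁
  { τ, s, A, a, x, θ
    R := (markovShift τ).mulIndicator R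
    ψ := matrixCoeff π f
    lo := hbound.choose
    hi := hbound.choose_spec.choose
    D := hdist.choose
    ψbound := ‖f‖ ^ 2
    lo_pos := hbound.choose_spec.choose_spec.1
    lo_le := fun y => (hbound.choose_spec.choose_spec.2 y).1
    le_hi := fun y => (hbound.choose_spec.choose_spec.2 y).2
    one_le_D := hdist.choose_spec.1
    distortion := hdist.choose_spec.2
    concat_a_mem := concat_singleton_mem_of_mem_image_shift hx
    admissible_A := hA
    link := fun _ _ hb hb' => htrans.exists_wordProd_eq_admissible hb hb'
    ψ_nonneg := hf
    ψ_one_pos := by rw [matrixCoeff_one]; exact pow_pos (norm_pos_iff.2 hf₀) 2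
    ψ_le := matrixCoeff_le π f }

end Construction

end ThermoDensity

end

theorem mainTheorem7_general
    {S : Type*} [Finite S] [TopologicalSpace S] [DiscreteTopology S]
    [MeasurableSpace S] [MeasurableSingletonClass S]
    {G : Type*} [Group G] [TopologicalSpace G] [DiscreteTopology G]
    {ι : Type*} (K : ι → Subgroup G)
    (τ : S → S → Prop) (R : (ℕ → S) → ℝ) (hR : ∀ y ∈ markovShift τ, 0 < R y)
    (θ : ℝ) (hθ0 : 0 < θ) (hθ1 : θ < 1) (hHol : LogHolder τ R θ)
    (s : S → G) (htrans : TransitiveOn (skewProduct s) (markovShift τ ×ˢ Set.univ))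
    (A a : S) (hA : Admissible τ [A])
    (x : ℕ → S) (hx : x ∈ shift '' (cyl [a] ∩ markovShift τ))
    (f : CosetSpace K) (hf : ∀ g, 0 ≤ inner ℝ (cosetRep K g f) f) (hf0 : f ≠ 0) :
    ∃ c : ℕ → ℝ, SlowlyIncreasing c ∧
    ∃ t : ℕ → ℝ, (∀ k, convParam τ R s A a x f < t k) ∧
      Tendsto t atTop (𝓝 (convParam τ R s A a x f)) ∧
    ∃ Υ : G → ℝ, IsUpsilon τ R s A a x f c t Υ ∧
    ∃ μ : Measure (ℕ → S), IsFiniteMeasure μ ∧ μ (markovShift τ)ᶜ = 0 ∧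
      MeasurePreserving shift μ μ ∧
    ∃ C : ℝ, 1 < C ∧
      (∀ w : List S, Admissible τ (a :: (w ++ [A])) →
        C ^ (-θ ^ wedge w x) * Υ (wordProd s w) ≤
          convParam τ R s A a x f ^ w.length *
            ∫ y in cyl (a :: (w ++ [A])), (birkhoffProd R w.length (shift y))⁻¹ ∂μ ∧
        convParam τ R s A a x f ^ w.length *
            ∫ y in cyl (a :: (w ++ [A])), (birkhoffProd R w.length (shift y))⁻¹ ∂μ ≤
          C ^ (θ ^ wedge w x) * Υ (wordProd s w)) ∧
      (∀ w : List S, w ≠ [] → Admissible τ w →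
        C⁻¹ * Υ (wordProd s w) ≤
          convParam τ R s A a x f ^ w.length *
            ∫ y in cyl w, (birkhoffProd R w.length y)⁻¹ ∂μ ∧
        convParam τ R s A a x f ^ w.length *
            ∫ y in cyl w, (birkhoffProd R w.length y)⁻¹ ∂μ ≤
          C * Υ (wordProd s w)) := by
  let M := WordSystem.ofTransitive hR hθ0 hθ1 hHol htrans hA hx hf hf0
  have hRM : Set.EqOn R M.R (markovShift τ) := Set.eqOn_mulIndicator.symm
  have hcont : Continuous fun y : markovShift τ => M.R y :=
    (hHol.continuous hθ0 hθ1 hR).congr fun y => hRM y.2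
  have hγ : convParam τ R s A a x f = M.critExp := M.convParam_eq_critExp hRM rfl
  obtain ⟨c, t, ν, h⟩ := M.exists_isCriticalLimit
  obtain ⟨C, hC, hmid, hcyl⟩ := h.exists_upsilon_comparable hθ0.le hcont
  simp only [← M.setIntegral_cyl_append_map_coe ν hRM hcont] at hmid
  simp only [← M.setIntegral_cyl_map_coe ν hRM hcont] at hcyl
  rw [hγ]
  refine ⟨c, h.slow, t, h.gt, h.tendsto, M.upsilon c t, h.isUpsilon hRM rfl,
    (ν : Measure (markovShift M.τ)).map Subtype.val, inferInstance, map_coe_compl_markovShift _,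
    measurePreserving_map_coe h.measurePreserving, C, hC, hmid, hcyl⟩

theorem mainTheorem7
    {S : Type*} [Finite S] [TopologicalSpace S] [DiscreteTopology S]
    [MeasurableSpace S] [MeasurableSingletonClass S]
    {G : Type*} [Group G] [Countable G] [TopologicalSpace G] [DiscreteTopology G]
    {ι : Type*} [Countable ι] (K : ι → Subgroup G)
    (τ : S → S → Prop) (R : (ℕ → S) → ℝ) (hR : ∀ y ∈ markovShift τ, 0 < R y)
    (θ : ℝ) (hθ0 : 0 < θ) (hθ1 : θ < 1) (hHol : LogHolder τ R θ)
    (s : S → G) (htrans : TransitiveOn (skewProduct s) (markovShift τ ×ˢ Set.univ))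
    (A a : S) (hA : Admissible τ [A])
    (x : ℕ → S) (hx : x ∈ shift '' (cyl [a] ∩ markovShift τ))
    (f : CosetSpace K) (hf : ∀ p, 0 ≤ (f : (Σ i, G ⧸ K i) → ℝ) p) (hf0 : f ≠ 0) :
    ∃ c : ℕ → ℝ, SlowlyIncreasing c ∧
    ∃ t : ℕ → ℝ, (∀ k, convParam τ R s A a x f < t k) ∧
      Tendsto t atTop (𝓝 (convParam τ R s A a x f)) ∧
    ∃ Υ : G → ℝ, IsUpsilon τ R s A a x f c t Υ ∧
    ∃ μ : Measure (ℕ → S), IsFiniteMeasure μ ∧ μ (markovShift τ)ᶜ = 0 ∧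
      MeasurePreserving shift μ μ ∧
    ∃ C : ℝ, 1 < C ∧
      -- the sharp estimate, for all words `w` with `a w A` admissible
      (∀ w : List S, Admissible τ (a :: (w ++ [A])) →
        C ^ (-θ ^ wedge w x) * Υ (wordProd s w) ≤
          convParam τ R s A a x f ^ w.length *
            ∫ y in cyl (a :: (w ++ [A])), (birkhoffProd R w.length (shift y))⁻¹ ∂μ ∧
        convParam τ R s A a x f ^ w.length *
            ∫ y in cyl (a :: (w ++ [A])), (birkhoffProd R w.length (shift y))⁻¹ ∂μ ≤
          C ^ (θ ^ wedge w x) * Υ (wordProd s w)) ∧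
      -- the estimate with a uniform constant, for all admissible words
      (∀ w : List S, w ≠ [] → Admissible τ w →
        C⁻¹ * Υ (wordProd s w) ≤
          convParam τ R s A a x f ^ w.length *
            ∫ y in cyl w, (birkhoffProd R w.length y)⁻¹ ∂μ ∧
        convParam τ R s A a x f ^ w.length *
            ∫ y in cyl w, (birkhoffProd R w.length y)⁻¹ ∂μ ≤
          C * Υ (wordProd s w)) :=
  mainTheorem7_general K τ R hR θ hθ0 hθ1 hHol s htrans A a hA x hx f
    (matrixCoeff_permRep_nonneg hf) hf0
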